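/- Let $\mathbb{K}$ be a field, $S=\mathbb{K}[x_1,\dots,x_n]$ with the standard grading, and let $\sigma$ be a term order on $S$. For an ideal $I\subset S$ let $\operatorname{in}_\sigma(I)$ be its initial ideal and $\mathcal{R}(I)=\bigoplus_{s\ge 0}I^st^s\subset S[t]$ its Rees algebra. If $I$ is generated by homogeneous elements of one common degree, choose a minimal homogeneous generating set $g_1,\dots,g_k$ of $I$, let $R=S[t_1,\dots,t_k]$ be the polynomial ring over $\mathbb{K}$ in which all the variables $x_i,t_j$ have degree $1$, and let $\psi:R\to S[t]$ be the $S$-algebra homomorphism with $\psi(t_j)=g_jt$, so that $R/\ker\psi\cong\mathcal{R}(I)$. By $\operatorname{reg}\mathcal{R}(I)$ we mean the Castelnuovo–Mumford regularity $\max\{j-i:\beta^R_{i,j}(R/\ker\psi)\ne 0\}$ of the graded $R$-module $R/\ker\psi$, where $\beta^R_{i,j}$ are the graded Betti numbers of its minimal graded free resolution; it does not depend on the choice of the minimal generators. Let $I=(f_1,\dots,f_m)\subset S$ be an ideal, where $f_1,\dots,f_m$ are homogeneous of the same degree, and suppose that 1. $\operatorname{in}_\sigma(I)=(\operatorname{in}_\sigma(f_1),\dots,\operatorname{in}_\sigma(f_m))$;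 2. $\operatorname{in}_\sigma(I^s)=(\operatorname{in}_\sigma(I))^s$ for all $s\ge 1$; 3. $\mathcal{R}(\operatorname{in}_\sigma(I))$ is Cohen–Macaulay. Then $\operatorname{reg}\mathcal{R}(I)=\operatorname{reg}\mathcal{R}(\operatorname{in}_\sigma(I))$. -/

import Mathlib

open MvPolynomial

noncomputable section

namespace ReesReg

/-! ### Cohen–Macaulay rings -/

/-- The depth of a local ring `A`: the supremum of the lengths of the `A`-regular sequences
contained in the maximal ideal. -/
def depth (A : Type*) [CommRing A] [IsLocalRing A] : ℕ∞ :=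
  ⨆ (rs : List A) (_ : (∀ r ∈ rs, r ∈ IsLocalRing.maximalIdeal A) ∧
      RingTheory.Sequence.IsRegular A rs), (rs.length : ℕ∞)

/-- A Noetherian ring is Cohen–Macaulay if at each maximal ideal its localization has depth equal
to its Krull dimension. -/
def IsCohenMacaulay (A : Type*) [CommRing A] : Prop :=
  IsNoetherianRing A ∧ ∀ (p : Ideal A) [p.IsMaximal],
    ((depth (Localization.AtPrime p) : ℕ∞) : WithBot ℕ∞) = ringKrullDim (Localization.AtPrime p)

/-! ### Minimal graded free resolutions and regularity over a standard graded polynomial ring -/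

section Regularity

variable {K : Type*} [Field K] {τ : Type*}

/-- The `ℤ`-graded pieces of the standard grading of `K[x_s : s ∈ τ]`, in which every variable has
degree `1` (the pieces of negative degree are zero). -/
def stdPiece (K : Type*) [Field K] (τ : Type*) (z : ℤ) : Submodule K (MvPolynomial τ K) :=
  weightedHomogeneousSubmodule K (fun _ : τ => (1 : ℤ)) z

/-- A minimal graded free resolution of a graded module `M = ⨁_z ℳ z` over the standard graded
polynomial ring `R = K[x_s : s ∈ τ]`.  The `i`-th module is the free module
`⨁_{k < rank i} R(-deg i k)`, whose `k`-th basis vector is homogeneous of degree `deg i k`. -/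
structure MinGradedFreeRes {M : Type*} [AddCommGroup M] [Module (MvPolynomial τ K) M]
    (ℳ : ℤ → AddSubgroup M) where
  /-- the rank of the `i`-th free module -/
  rank : ℕ → ℕ
  /-- the degrees of the basis vectors of the `i`-th free module -/
  deg : ∀ i, Fin (rank i) → ℤ
  /-- the augmentation -/
  aug : (Fin (rank 0) → MvPolynomial τ K) →ₗ[MvPolynomial τ K] M
  /-- the differentials -/
  d : ∀ i, (Fin (rank (i + 1)) → MvPolynomial τ K) →ₗ[MvPolynomial τ K]
    (Fin (rank i) → MvPolynomial τ K)
  aug_homogeneous : ∀ k, aug (Pi.single k 1) ∈ ℳ (deg 0 k)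
  d_homogeneous : ∀ i k l, d i (Pi.single k 1) l ∈ stdPiece K τ (deg (i + 1) k - deg i l)
  aug_surjective : Function.Surjective aug
  exact_zero : Function.Exact (d 0) aug
  exact_succ : ∀ i, Function.Exact (d (i + 1)) (d i)
  /-- minimality: all matrix entries lie in the homogeneous maximal ideal -/
  minimal : ∀ i k l, constantCoeff (d i (Pi.single k 1) l) = 0

/-- The graded Betti number `β_{i,j}` read off from a minimal graded free resolution: the number
of summands `R(-j)` in homological degree `i`. -/
def MinGradedFreeRes.betti {M : Type*} [AddCommGroup M] [Module (MvPolynomial τ K) M]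
    {ℳ : ℤ → AddSubgroup M} (F : MinGradedFreeRes (K := K) (τ := τ) ℳ) (i : ℕ) (j : ℤ) : ℕ :=
  Fintype.card {k : Fin (F.rank i) // F.deg i k = j}

/-- `M = ⨁_z ℳ z` has Castelnuovo–Mumford regularity `r`: a minimal graded free resolution of `M`
exists, and `r = max {j - i : β_{i,j} ≠ 0}` (computed from any such resolution; it is unique up to
isomorphism). -/
def HasRegularity (K : Type*) [Field K] (τ : Type*) {M : Type*} [AddCommGroup M]
    [Module (MvPolynomial τ K) M] (ℳ : ℤ → AddSubgroup M) (r : ℤ) : Prop :=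
  Nonempty (MinGradedFreeRes (K := K) (τ := τ) ℳ) ∧
    ∀ F : MinGradedFreeRes (K := K) (τ := τ) ℳ,
      IsGreatest {z : ℤ | ∃ (i : ℕ) (j : ℤ), F.betti i j ≠ 0 ∧ z = j - i} r

/-- The grading of `R/J` induced by the standard grading of `R`. -/
def quotientPiece (J : Ideal (MvPolynomial τ K)) (z : ℤ) : AddSubgroup (MvPolynomial τ K ⧸ J) :=
  (stdPiece K τ z).toAddSubgroup.map (Ideal.Quotient.mk J).toAddMonoidHom

end Regularity

/-! ### Initial ideals, Rees algebras and their presentations -/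

section Rees

variable {K : Type*} [Field K] {n : ℕ}

/-- The initial ideal of `I` with respect to a term order `σ`. -/
def initialIdeal (σ : MonomialOrder (Fin n)) (I : Ideal (MvPolynomial (Fin n) K)) :
    Ideal (MvPolynomial (Fin n) K) :=
  Ideal.span (σ.leadingTerm '' (I : Set (MvPolynomial (Fin n) K)))

/-- The homomorphism `ψ : S[t_1, …, t_m] → S[t]` with `x_i ↦ x_i`, `t_j ↦ f_j t`, where
`S = K[x_1, …, x_n]`. Its image is the Rees algebra of `(f_1, …, f_m)`. The polynomial ring
`S[t_1, …, t_m]` is realized as `K[x_1, …, x_n, t_1, …, t_m]`. -/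
def reesMap {m : ℕ} (f : Fin m → MvPolynomial (Fin n) K) :
    MvPolynomial (Fin n ⊕ Fin m) K →ₐ[K] Polynomial (MvPolynomial (Fin n) K) :=
  aeval (Sum.elim (fun i => Polynomial.C (X i)) (fun j => Polynomial.C (f j) * Polynomial.X))

/-- The defining ideal `ker ψ` of the Rees algebra. -/
def reesKer {m : ℕ} (f : Fin m → MvPolynomial (Fin n) K) :
    Ideal (MvPolynomial (Fin n ⊕ Fin m) K) :=
  RingHom.ker (reesMap f)

/-- `f_1, …, f_m` are homogeneous of one common degree and form a minimal generating set of `I`. -/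
def IsMinimalEquigenerators {m : ℕ} (f : Fin m → MvPolynomial (Fin n) K)
    (I : Ideal (MvPolynomial (Fin n) K)) : Prop :=
  (∃ d : ℕ, ∀ j, (f j).IsHomogeneous d) ∧ Ideal.span (Set.range f) = I ∧
    ∀ j, f j ∉ Ideal.span (f '' {j}ᶜ)

/-- `reg R(I) = r` for an equigenerated homogeneous ideal `I`: for every minimal homogeneous
generating set `f_1, …, f_m` of `I` the standard graded quotient `S[t_1, …, t_m] / ker ψ` has
regularity `r` over `S[t_1, …, t_m]`. An ideal that is not an equigenerated homogeneous ideal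
has no such `r`. -/
def HasReesRegularity (I : Ideal (MvPolynomial (Fin n) K)) (r : ℤ) : Prop :=
  (∃ (m : ℕ) (f : Fin m → MvPolynomial (Fin n) K), IsMinimalEquigenerators f I) ∧
    ∀ (m : ℕ) (f : Fin m → MvPolynomial (Fin n) K), IsMinimalEquigenerators f I →
      HasRegularity K (Fin n ⊕ Fin m) (quotientPiece (reesKer f)) r

end Rees

end ReesReg

end

/-! Choose among the f_j one polynomial g_j for each leading monomial. Then the g_j minimally
generate I and their leading terms minimally generate in(I), so both Rees algebras are quotients R/J
and R/J' of the same polynomial ring R = K[x, t]. Let x_i weigh its own exponent and t_j the leading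
exponent of g_j, with values in the well-ordered monoid `σ.syn`. A monomial of R then weighs exactly
the leading exponent of its image in S[t]. Since in(I^s) = in(I)^s, every leading exponent of I^s
comes from a monomial of degree s in the t_j, and subduction shows that J' is the ideal of leading
forms of J (`isLeading_reesKer`).

A minimal resolution F of R/J', graded by weight and by standard degree, lifts one differential at a
time to a resolution G of R/J with the same ranks and standard degrees (`GradedRes.exists_lift`). G
need not be minimal, so Betti numbers can only drop from J' to J. This gives one inequality between
the regularities; the other could only fail if the extremal Betti number cancelled against a
neighbouring module of G.

Cohen–Macaulayness excludes the cancellation. Locally at the origin, J' contains a regular sequence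
of length c, with c the bound on the length of F, so Hom(F, R) is exact below degree c. Hence every
basis vector of F_i with i < c occurs in the differential leaving F_{i+1}
(`exists_length_of_depth_eq`), with a coefficient of positive degree by minimality. So the maximum
of degree minus i does not decrease along F, and the regularity is attained in F_c at its largest
degree T (`exists_degree_bound`). Degree T then occurs in no other F_i, and β_{c,T} survives in R/J
(`exists_hasRegularity_of_isLeading`).

The length c comes from three facts over a regular local ring of dimension N: an ideal contains a
regular sequence as long as its codimension, a minimal resolution of a module with a regular
sequence of length q has length at most N - q, and Ext below the grade vanishes. -/

noncomputable section

namespace ReesReg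

/-! ### Null-homotopies between complexes of projectives. -/

section Homotopy

variable {Q : Type*} [CommRing Q]

theorem exists_linearMap_lift {P M N : Type*} [AddCommGroup P] [Module Q P] [Module.Projective Q P]
    [AddCommGroup M] [Module Q M] [AddCommGroup N] [Module Q N]
    (f : P →ₗ[Q] M) (g : N →ₗ[Q] M) (h : ∀ v, f v ∈ LinearMap.range g) :
    ∃ k : P →ₗ[Q] N, ∀ v, g (k v) = f v := by
  obtain ⟨k, hk⟩ := Module.projective_lifting_property g.rangeRestrict
    (f.codRestrict (LinearMap.range g) h) g.surjective_rangeRestrict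
  exact ⟨k, fun v => congrArg Subtype.val (LinearMap.congr_fun hk v)⟩

/-- A chain map from a complex of projectives to an exact complex that vanishes on the cokernels
is null-homotopic. -/
theorem exists_homotopy {F G : ℕ → Type*} [∀ i, AddCommGroup (F i)] [∀ i, Module Q (F i)]
    [∀ i, AddCommGroup (G i)] [∀ i, Module Q (G i)] [∀ i, Module.Projective Q (F i)]
    (dF : ∀ i, F (i + 1) →ₗ[Q] F i) (dG : ∀ i, G (i + 1) →ₗ[Q] G i)
    (hF : ∀ i v, dF i (dF (i + 1) v) = 0) (hG : ∀ i, Function.Exact (dG (i + 1)) (dG i))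
    (η : ∀ i, F i →ₗ[Q] G i) (hη : ∀ i v, dG i (η (i + 1) v) = η i (dF i v))
    (h0 : ∀ v, η 0 v ∈ LinearMap.range (dG 0)) :
    ∃ h : ∀ i, F i →ₗ[Q] G (i + 1), (∀ v, η 0 v = dG 0 (h 0 v)) ∧
      ∀ i v, η (i + 1) v = dG (i + 1) (h (i + 1) v) + h i (dF i v) := by
  -- The recursion carries the invariant that `dG i ∘ h` and `η i` agree on boundaries: it says that
  -- `η (i + 1) - h ∘ dF i` takes values in cycles, which exactness lifts.
  have step : ∀ i (h : F i →ₗ[Q] G (i + 1)), (∀ v, dG i (h (dF i v)) = η i (dF i v)) →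
      ∃ h' : F (i + 1) →ₗ[Q] G (i + 2), ∀ v, η (i + 1) v = dG (i + 1) (h' v) + h (dF i v) := by
    intro i h hh
    obtain ⟨k, hk⟩ := exists_linearMap_lift (η (i + 1) - h ∘ₗ dF i) (dG (i + 1)) (by
      intro v
      refine (hG i _).1 ?_
      simp [hη, hh])
    exact ⟨k, fun v => by simp [hk]⟩
  choose! s hs using step
  obtain ⟨k0, hk0⟩ := exists_linearMap_lift (η 0) (dG 0) h0
  let seq : ∀ i, {h : F i →ₗ[Q] G (i + 1) // ∀ v, dG i (h (dF i v)) = η i (dF i v)} := fun i =>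
    Nat.rec ⟨k0, fun v => hk0 _⟩ (fun i h => ⟨s i h.1, fun v => by
      have := hs i h.1 h.2 (dF (i + 1) v)
      rw [hF, map_zero, add_zero] at this
      exact this.symm⟩) i
  exact ⟨fun i => (seq i).1, fun v => (hk0 v).symm, fun i v => hs i (seq i).1 (seq i).2 v⟩

end Homotopy

/-! ### Regular sequences on quotients, in terms of submodules. -/

section RegularSequences

variable {Q : Type*} [CommRing Q] {M : Type*} [AddCommGroup M] [Module Q M]

/-- The submodule `B + aM`. -/
def addSMul (B : Submodule Q M) (a : Q) : Submodule Q M :=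
  B ⊔ LinearMap.range (LinearMap.lsmul Q M a)

theorem mem_addSMul {B : Submodule Q M} {a : Q} {v : M} :
    v ∈ addSMul B a ↔ ∃ w, v - a • w ∈ B := by
  constructor
  · intro h
    obtain ⟨b, hb, _, ⟨w, rfl⟩, rfl⟩ := Submodule.mem_sup.1 h
    exact ⟨w, by simpa using hb⟩
  · rintro ⟨w, hw⟩
    exact Submodule.mem_sup.2 ⟨_, hw, a • w, ⟨w, rfl⟩, by simp⟩

theorem le_addSMul (B : Submodule Q M) (a : Q) : B ≤ addSMul B a := le_sup_left

theorem smul_mem_addSMul (B : Submodule Q M) (a : Q) (v : M) : a • v ∈ addSMul B a :=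
  mem_addSMul.2 ⟨v, by simp⟩

theorem addSMul_ideal (Y : Ideal Q) (a : Q) : addSMul Y a = Y ⊔ Ideal.span {a} := by
  ext v
  rw [mem_addSMul, Submodule.mem_sup]
  constructor
  · rintro ⟨w, hw⟩
    exact ⟨_, hw, a * w, Ideal.mem_span_singleton.2 ⟨w, rfl⟩, by simp⟩
  · rintro ⟨b, hb, c, hc, rfl⟩
    obtain ⟨w, rfl⟩ := Ideal.mem_span_singleton.1 hc
    exact ⟨w, by simpa using hb⟩

/-- The submodule `B + (a₁, …, a_r)M`. -/
def addList (B : Submodule Q M) (l : List Q) : Submodule Q M := l.foldl addSMul B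

@[simp] theorem addList_nil (B : Submodule Q M) : addList B [] = B := rfl

@[simp] theorem addList_cons (B : Submodule Q M) (a : Q) (l : List Q) :
    addList B (a :: l) = addList (addSMul B a) l := rfl

theorem addList_concat (B : Submodule Q M) (a : Q) (l : List Q) :
    addList B (l ++ [a]) = addSMul (addList B l) a := by simp [addList]

theorem addList_ideal (Y : Ideal Q) (l : List Q) : addList Y l = Y ⊔ Ideal.ofList l := by
  induction l generalizing Y with
  | nil => simp
  | cons a l ih => rw [addList_cons, ih, addSMul_ideal, Ideal.ofList_cons, sup_assoc]

/-- `a₁, …, a_r` is a (weakly) regular sequence on `M / B`. -/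
def RegOn (B : Submodule Q M) : List Q → Prop
  | [] => True
  | a :: l => (∀ v, a • v ∈ B → v ∈ B) ∧ RegOn (addSMul B a) l

/-- The definition peels a sequence from the left, whereas regular sequences are built by appending
an element. -/
theorem regOn_concat (B : Submodule Q M) (l : List Q) (a : Q) :
    RegOn B (l ++ [a]) ↔ RegOn B l ∧ ∀ v, a • v ∈ addList B l → v ∈ addList B l := by
  induction l generalizing B with
  | nil => simp [RegOn]
  | cons b l ih => simp [RegOn, ih, and_assoc]

/-- Regularity depends only on the quotient, and `e` identifies M / B with M' / B'. This moves a
regular sequence from Q / J to the cokernel of a resolution. -/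
theorem regOn_comap {M' : Type*} [AddCommGroup M'] [Module Q M'] (e : M →ₗ[Q] M')
    (he : Function.Surjective e) (B : Submodule Q M) (B' : Submodule Q M')
    (hB : ∀ v, v ∈ B ↔ e v ∈ B') (l : List Q) (h : RegOn B' l) : RegOn B l := by
  induction l generalizing B B' with
  | nil => trivial
  | cons a l ih =>
    refine ⟨fun v hv => ?_, ih _ (addSMul B' a) (fun v => ?_) h.2⟩
    · rw [hB, map_smul] at hv
      exact (hB v).2 (h.1 _ hv)
    · simp only [mem_addSMul]
      constructor
      · rintro ⟨w, hw⟩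
        exact ⟨e w, by simpa using (hB _).1 hw⟩
      · rintro ⟨w, hw⟩
        obtain ⟨w, rfl⟩ := he w
        exact ⟨w, (hB _).2 (by simpa using hw)⟩

theorem regOn_of_isWeaklyRegular (B : Submodule Q M) (l : List Q)
    (h : RingTheory.Sequence.IsWeaklyRegular (M ⧸ B) l) : RegOn B l := by
  induction l generalizing B with
  | nil => trivial
  | cons a l ih =>
    rw [RingTheory.Sequence.isWeaklyRegular_cons_iff] at h
    refine ⟨fun v hv => ?_, ih _ ?_⟩
    · rw [← Submodule.Quotient.mk_eq_zero] at hv ⊢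
      exact h.1.right_eq_zero_of_smul (by simpa using hv)
    · have e : QuotSMulTop a (M ⧸ B) ≃ₗ[Q] M ⧸ addSMul B a := by
        refine (Submodule.quotEquivOfEq _ ((addSMul B a).map B.mkQ) ?_).trans
          (Submodule.quotientQuotientEquivQuotient B _ (le_addSMul B a))
        ext x
        obtain ⟨x, rfl⟩ := B.mkQ_surjective x
        constructor
        · intro hx
          obtain ⟨y, -, hy⟩ := Submodule.mem_smul_pointwise_iff_exists _ _ _ |>.1 hx
          obtain ⟨y, rfl⟩ := B.mkQ_surjective y
          exact ⟨a • y, smul_mem_addSMul _ _ _, by simpa using hy⟩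
        · rintro ⟨y, hy, hyx⟩
          obtain ⟨w, hw⟩ := mem_addSMul.1 hy
          refine (Submodule.mem_smul_pointwise_iff_exists _ _ _).2 ⟨B.mkQ w, trivial, ?_⟩
          rw [← hyx, ← map_smul, eq_comm, ← sub_eq_zero, ← map_sub]
          exact (Submodule.Quotient.mk_eq_zero B).2 hw
      exact (e.isWeaklyRegular_congr l).1 h.2

end RegularSequences

/-! ### Hilbert's syzygy theorem and the Auslander–Buchsbaum inequality. -/

section Syzygies

universe u

set_option linter.unusedSectionVars false

variable {Q : Type*} [CommRing Q] {ι : ℕ → Type u} [∀ i, Fintype (ι i)]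

theorem linearMap_pi_mem {κ μ : Type*} [Fintype κ] (f : (κ → Q) →ₗ[Q] (μ → Q)) (Y : Ideal Q)
    {v : κ → Q} (hv : ∀ k, v k ∈ Y) (m : μ) : f v m ∈ Y := by
  classical
  rw [pi_eq_sum_univ' v, map_sum, Finset.sum_apply]
  refine Y.sum_mem fun k _ => ?_
  rw [map_smul, Pi.smul_apply, smul_eq_mul]
  exact Y.mul_mem_right _ (hv k)

/-- Exactness modulo an ideal from the spot `j` on is preserved, with a shift, when the ideal is
enlarged by a regular sequence. -/
theorem exact_mod_addList (d : ∀ i, (ι (i + 1) → Q) →ₗ[Q] (ι i → Q))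
    (hd : ∀ i, Function.Exact (d (i + 1)) (d i)) (xs : List Q) (Y : Ideal Q) (hY : RegOn Y xs)
    (j : ℕ) (hE : ∀ i, j ≤ i → ∀ v, (∀ k, d i v k ∈ Y) → ∃ z, ∀ k, v k - d (i + 1) z k ∈ Y) :
    ∀ i, j + xs.length ≤ i → ∀ v, (∀ k, d i v k ∈ addList Y xs) →
      ∃ z, ∀ k, v k - d (i + 1) z k ∈ addList Y xs := by
  induction xs generalizing Y j with
  | nil => simpa using hE
  | cons a xs ih =>
    intro i hi
    refine ih (addSMul Y a) hY.2 (j + 1) ?_ i (by simp at hi; omega)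
    intro i hi v hv
    obtain ⟨i, rfl⟩ : ∃ i', i = i' + 1 := ⟨i - 1, by omega⟩
    -- `w` represents the connecting homomorphism for multiplication by `a` on Q / Y. As `a • d w`
    -- is zero modulo Y, so is `d w`. Exactness one spot lower gives w ≡ dz, and `v - a • z` is then
    -- a cycle modulo Y.
    choose w hw using fun k => mem_addSMul.1 (hv k)
    have h1 : ∀ k, d i w k ∈ Y := by
      intro k
      apply hY.1
      have h2 := linearMap_pi_mem (d i) Y (v := d (i + 1) v - a • w) (fun k => hw k) k
      rw [map_sub, (hd i).apply_apply_eq_zero, map_smul] at h2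
      simpa using h2
    obtain ⟨z, hz⟩ := hE i (by omega) w h1
    obtain ⟨z', hz'⟩ := hE (i + 1) (by omega) (v - a • z) (by
      intro k
      have h3 := Y.add_mem (hw k) (Y.mul_mem_left a (hz k))
      rw [map_sub, map_smul]
      simp only [Pi.sub_apply, Pi.smul_apply, smul_eq_mul] at h3 ⊢
      convert h3 using 1
      ring)
    refine ⟨z', fun k => mem_addSMul.2 ⟨z k, ?_⟩⟩
    have h4 := hz' k
    simp only [Pi.sub_apply, Pi.smul_apply, smul_eq_mul] at h4 ⊢
    convert h4 using 1
    ring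

/-- Hilbert's syzygy theorem for minimal complexes. -/
theorem isEmpty_of_minimal (d : ∀ i, (ι (i + 1) → Q) →ₗ[Q] (ι i → Q))
    (hd : ∀ i, Function.Exact (d (i + 1)) (d i)) (xs : List Q)
    (hxs : RegOn (⊥ : Ideal Q) xs) (hne : addList (⊥ : Ideal Q) xs ≠ ⊤)
    (hmin : ∀ i v k, d i v k ∈ addList (⊥ : Ideal Q) xs) (i : ℕ) (hi : xs.length ≤ i) :
    IsEmpty (ι (i + 1)) := by
  classical
  refine ⟨fun k => hne ((Ideal.eq_top_iff_one _).2 ?_)⟩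
  -- By minimality all differentials vanish modulo the sequence, so a basis vector is a cycle there.
  -- In this range it is also a boundary, hence zero, which puts 1 into the ideal.
  obtain ⟨z, hz⟩ := exact_mod_addList d hd xs ⊥ hxs 0 (by
    intro i _ v hv
    obtain ⟨z, hz⟩ := (hd i v).1 (funext fun k => by simpa using hv k)
    exact ⟨z, fun k => by simp [hz]⟩) i (by omega) (Pi.single k 1) (hmin i _)
  have := (addList (⊥ : Ideal Q) xs).add_mem (hz k) (hmin (i + 1) z k)
  simpa using this

/-- The index types of the bases of the cone of a multiplication map. -/
def coneIdx (ι : ℕ → Type u) : ℕ → Type u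
  | 0 => ι 0
  | i + 1 => ι (i + 1) ⊕ ι i

instance (i : ℕ) : Fintype (coneIdx ι i) :=
  match i with
  | 0 => inferInstanceAs (Fintype (ι 0))
  | i + 1 => inferInstanceAs (Fintype (ι (i + 1) ⊕ ι i))

/-- The differentials of the cone of the multiplication by `a`. -/
def coneD (d : ∀ i, (ι (i + 1) → Q) →ₗ[Q] (ι i → Q)) (a : Q) :
    ∀ i, (coneIdx ι (i + 1) → Q) →ₗ[Q] (coneIdx ι i → Q)
  | 0 => d 0 ∘ₗ LinearMap.funLeft Q Q Sum.inl + a • LinearMap.funLeft Q Q Sum.inr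
  | i + 1 => LinearMap.pi (Sum.elim
      (fun k => LinearMap.proj k ∘ₗ
        (d (i + 1) ∘ₗ LinearMap.funLeft Q Q Sum.inl + a • LinearMap.funLeft Q Q Sum.inr))
      (fun k => -(LinearMap.proj k ∘ₗ d i ∘ₗ LinearMap.funLeft Q Q Sum.inr)))

theorem coneD_zero_apply (d : ∀ i, (ι (i + 1) → Q) →ₗ[Q] (ι i → Q)) (a : Q)
    (x : ι 1 → Q) (y : ι 0 → Q) :
    coneD d a 0 (Sum.elim x y : ι 1 ⊕ ι 0 → Q) = d 0 x + a • y := rfl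

theorem coneD_succ_apply (d : ∀ i, (ι (i + 1) → Q) →ₗ[Q] (ι i → Q)) (a : Q) (i : ℕ)
    (x : ι (i + 2) → Q) (y : ι (i + 1) → Q) :
    coneD d a (i + 1) (Sum.elim x y : ι (i + 2) ⊕ ι (i + 1) → Q) =
      (Sum.elim (d (i + 1) x + a • y) (-d i y) : ι (i + 1) ⊕ ι i → Q) := by
  funext k
  rcases k with k | k <;> rfl

theorem exists_sum_elim {α β : Type*} (v : α ⊕ β → Q) : ∃ x y, v = Sum.elim x y :=
  ⟨v ∘ Sum.inl, v ∘ Sum.inr, (Sum.elim_comp_inl_inr v).symm⟩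

/-- The cone of multiplication by `a` on a resolution of M has homology M / aM in degree 0 and the
kernel of `a` on M in degree 1; the latter vanishes by regularity. -/
theorem coneD_exact (d : ∀ i, (ι (i + 1) → Q) →ₗ[Q] (ι i → Q))
    (hd : ∀ i, Function.Exact (d (i + 1)) (d i)) (a : Q)
    (ha : ∀ v, a • v ∈ LinearMap.range (d 0) → v ∈ LinearMap.range (d 0)) (i : ℕ) :
    Function.Exact (coneD d a (i + 1)) (coneD d a i) := by
  have key : ∀ (i : ℕ) (x : ι (i + 1) → Q) (y y' : ι i → Q) (z : ι (i + 1) → Q),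
      d i x + a • y = 0 → y = d i z → ∃ x', x = d (i + 1) x' + a • (-z) := by
    intro i x y _ z h1 h2
    obtain ⟨x', hx'⟩ := (hd i (x + a • z)).1 (by rw [map_add, map_smul, ← h2, h1])
    exact ⟨x', by rw [hx']; simp⟩
  intro v
  cases i with
  | zero =>
    obtain ⟨x, y, rfl⟩ := exists_sum_elim (α := ι 1) (β := ι 0) v
    rw [coneD_zero_apply]
    constructor
    · intro h
      obtain ⟨z, hz⟩ := ha y ⟨-x, by rw [map_neg]; exact (eq_neg_of_add_eq_zero_right h).symm⟩
      obtain ⟨x', hx'⟩ := key 0 x y y z h hz.symm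
      refine ⟨(Sum.elim x' (-z) : ι 2 ⊕ ι 1 → Q), ?_⟩
      rw [coneD_succ_apply, ← hx', map_neg, neg_neg, hz]
    · rintro ⟨w, hw⟩
      obtain ⟨x', z, rfl⟩ := exists_sum_elim (α := ι 2) (β := ι 1) w
      rw [coneD_succ_apply] at hw
      have h1 := congrArg (fun f : ι 1 ⊕ ι 0 → Q => f ∘ Sum.inl) hw
      have h2 := congrArg (fun f : ι 1 ⊕ ι 0 → Q => f ∘ Sum.inr) hw
      simp only [Sum.elim_comp_inl, Sum.elim_comp_inr] at h1 h2
      rw [← h1, ← h2, map_add, map_smul, (hd 0).apply_apply_eq_zero, smul_neg, zero_add,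
        add_neg_cancel]
      rfl
  | succ i =>
    obtain ⟨x, y, rfl⟩ := exists_sum_elim (α := ι (i + 2)) (β := ι (i + 1)) v
    rw [coneD_succ_apply]
    constructor
    · intro h
      have h1 := congrArg (fun f : ι (i + 1) ⊕ ι i → Q => f ∘ Sum.inl) h
      have h2 := congrArg (fun f : ι (i + 1) ⊕ ι i → Q => f ∘ Sum.inr) h
      simp only [Sum.elim_comp_inl, Sum.elim_comp_inr] at h1 h2
      obtain ⟨z, hz⟩ := (hd i y).1 (neg_eq_zero.1 h2)
      obtain ⟨x', hx'⟩ := key (i + 1) x y y z h1 hz.symm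
      refine ⟨(Sum.elim x' (-z) : ι (i + 3) ⊕ ι (i + 2) → Q), ?_⟩
      rw [coneD_succ_apply, ← hx', map_neg, neg_neg, hz]
    · rintro ⟨w, hw⟩
      obtain ⟨x', z, rfl⟩ := exists_sum_elim (α := ι (i + 3)) (β := ι (i + 2)) w
      rw [coneD_succ_apply] at hw
      have h1 := congrArg (fun f : ι (i + 2) ⊕ ι (i + 1) → Q => f ∘ Sum.inl) hw
      have h2 := congrArg (fun f : ι (i + 2) ⊕ ι (i + 1) → Q => f ∘ Sum.inr) hw
      simp only [Sum.elim_comp_inl, Sum.elim_comp_inr] at h1 h2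
      rw [← h1, ← h2, map_add, map_smul, (hd (i + 1)).apply_apply_eq_zero, map_neg,
        (hd i).apply_apply_eq_zero]
      funext k
      rcases k with k | k
      · exact congrFun (show 0 + a • d (i + 1) z + a • -d (i + 1) z = 0 by simp) k
      · exact congrFun (show -(-(0 : ι i → Q)) = 0 by simp) k

theorem range_coneD_zero (d : ∀ i, (ι (i + 1) → Q) →ₗ[Q] (ι i → Q)) (a : Q) :
    LinearMap.range (coneD d a 0) = addSMul (LinearMap.range (d 0)) a := by
  ext (v : ι 0 → Q)
  refine Iff.trans ?_ (mem_addSMul (M := ι 0 → Q)).symm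
  constructor
  · rintro ⟨w, rfl⟩
    obtain ⟨x, y, rfl⟩ := exists_sum_elim (α := ι 1) (β := ι 0) w
    exact ⟨y, x, (add_sub_cancel_right (d 0 x) (a • y)).symm⟩
  · rintro ⟨y, x, hx⟩
    exact ⟨(Sum.elim x y : ι 1 ⊕ ι 0 → Q), 
      (congrArg (· + a • y) hx).trans (sub_add_cancel v (a • y))⟩

/-- The Auslander–Buchsbaum inequality: a minimal free resolution of a module that has a regular
sequence of length `q` has length at most `N - q`, where `N` is the length of a regular sequence
generating the maximal ideal. -/
theorem isEmpty_of_regOn (d : ∀ i, (ι (i + 1) → Q) →ₗ[Q] (ι i → Q))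
    (hd : ∀ i, Function.Exact (d (i + 1)) (d i)) (xs : List Q)
    (hxs : RegOn (⊥ : Ideal Q) xs) (hne : addList (⊥ : Ideal Q) xs ≠ ⊤)
    (hmin : ∀ i v k, d i v k ∈ addList (⊥ : Ideal Q) xs) (as : List Q)
    (has : ∀ a ∈ as, a ∈ addList (⊥ : Ideal Q) xs) (hreg : RegOn (LinearMap.range (d 0)) as)
    (i : ℕ) (hi : xs.length < as.length + i) : IsEmpty (ι i) := by
  induction as generalizing ι i with
  | nil =>
    obtain ⟨i, rfl⟩ : ∃ i', i = i' + 1 := ⟨i - 1, by simp at hi; omega⟩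
    exact isEmpty_of_minimal d hd xs hxs hne hmin i (by simp at hi; omega)
  | cons a as ih =>
    -- The cone is a minimal resolution of M / aM, because `a` lies in the maximal ideal, and it
    -- contains the `i`-th module as a summand at spot `i + 1`. Each regular element thus lowers the
    -- bound on the length by one.
    have := ih (coneD d a) (coneD_exact d hd a hreg.1) (by
      rintro (_ | i) v k
      · obtain ⟨x, y, rfl⟩ := exists_sum_elim (α := ι 1) (β := ι 0) v
        rw [coneD_zero_apply]
        exact Ideal.add_mem _ (hmin _ _ _) (Ideal.mul_mem_right _ _ (has a (by simp)))
      · obtain ⟨x, y, rfl⟩ := exists_sum_elim (α := ι (i + 2)) (β := ι (i + 1)) v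
        rw [coneD_succ_apply]
        rcases k with k | k
        · exact Ideal.add_mem _ (hmin _ _ _) (Ideal.mul_mem_right _ _ (has a (by simp)))
        · exact Submodule.neg_mem _ (hmin _ _ _))
      (fun b hb => has b (by simp [hb])) (by rw [range_coneD_zero]; exact hreg.2) (i + 1)
      (by simp at hi; omega)
    exact ⟨fun k => this.false (Sum.inr k : ι (i + 1) ⊕ ι i)⟩

end Syzygies

/-! ### Vanishing of Ext(M, Q / Y) from regular sequences. -/

section Cohomology

variable {Q : Type*} [CommRing Q] {F : ℕ → Type*} [∀ i, AddCommGroup (F i)] [∀ i, Module Q (F i)]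

/-- Vanishing of the `i`-th cohomology of `Hom(F, Q / Y)`, for a complex `F` of projectives. -/
def CohVanish (d : ∀ i, F (i + 1) →ₗ[Q] F i) (Y : Ideal Q) : ℕ → Prop
  | 0 => ∀ φ : F 0 →ₗ[Q] Q, (∀ v, φ (d 0 v) ∈ Y) → ∀ v, φ v ∈ Y
  | i + 1 => ∀ φ : F (i + 1) →ₗ[Q] Q, (∀ v, φ (d (i + 1) v) ∈ Y) →
      ∃ ψ : F i →ₗ[Q] Q, ∀ v, φ v - ψ (d i v) ∈ Y

/-- By projectivity `f` lifts through the map Q × Y → Q, (w, b) ↦ yw + b; the first component of the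
lift is θ. -/
theorem exists_linearMap_of_mem_addSMul {P : Type*} [AddCommGroup P] [Module Q P]
    [Module.Projective Q P] (f : P →ₗ[Q] Q) (Y : Ideal Q) (y : Q) (h : ∀ v, f v ∈ addSMul Y y) :
    ∃ θ : P →ₗ[Q] Q, ∀ v, f v - y * θ v ∈ Y := by
  obtain ⟨k, hk⟩ := exists_linearMap_lift f
    ((LinearMap.lsmul Q Q y).coprod Y.subtype : Q × Y →ₗ[Q] Q) (by
      intro v
      obtain ⟨w, hw⟩ := mem_addSMul.1 (h v)
      exact ⟨(w, ⟨_, hw⟩), by simp⟩)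
  refine ⟨LinearMap.fst Q Q Y ∘ₗ k, fun v => ?_⟩
  rw [← hk v]
  simp

variable [∀ i, Module.Projective Q (F i)]

/-- Rees's vanishing of Ext below the grade. As `y` kills M, multiplication by `y` on the resolution
is null-homotopic through some h, so yφ ≡ φ∘h∘d modulo Y for a cocycle φ. Then φ∘h is a cocycle
modulo Y + (y) one degree lower. By induction it is a coboundary plus yθ modulo Y; composing with d
and cancelling `y` gives φ ≡ θ∘d. -/
theorem cohVanish_of_annihilator (d : ∀ i, F (i + 1) →ₗ[Q] F i)
    (hd : ∀ i, Function.Exact (d (i + 1)) (d i)) (ys : List Q) (Y : Ideal Q) (hY : RegOn Y ys)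
    (hann : ∀ y ∈ ys, ∀ v : F 0, y • v ∈ LinearMap.range (d 0)) (i : ℕ) (hi : i < ys.length) :
    CohVanish d Y i := by
  induction ys generalizing Y i with
  | nil => simp at hi
  | cons y ys ih =>
    obtain ⟨h, h0, hh⟩ := exists_homotopy d d (fun i v => (hd i).apply_apply_eq_zero v) hd
      (fun i => y • LinearMap.id) (fun i v => by simp) (fun v => hann y (by simp) v)
    simp only [LinearMap.smul_apply, LinearMap.id_apply] at h0 hh
    cases i with
    | zero =>
      intro φ hφ v
      apply hY.1
      rw [← map_smul, h0]
      exact hφ _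
    | succ i =>
      intro φ hφ
      have h1 : ∀ v, y * φ v - φ (h i (d i v)) ∈ Y := by
        intro v
        rw [← smul_eq_mul, ← map_smul, hh, map_add, add_sub_cancel_right]
        exact hφ _
      have h2 : ∀ v, (φ ∘ₗ h i) (d i v) ∈ addSMul Y y := by
        intro v
        have := Submodule.sub_mem _ (smul_mem_addSMul Y y (φ v)) (le_addSMul Y y (h1 v))
        simpa using this
      have h3 := ih (addSMul Y y) hY.2 (fun y hy => hann y (by simp [hy])) i (by simpa using hi)
      suffices ∃ θ : F i →ₗ[Q] Q, ∀ v, φ (h i (d i v)) - y * θ (d i v) ∈ Y by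
        obtain ⟨θ, hθ⟩ := this
        refine ⟨θ, fun v => hY.1 _ ?_⟩
        have := Y.add_mem (h1 v) (hθ v)
        rw [smul_eq_mul]
        convert this using 1
        ring
      cases i with
      | zero =>
        obtain ⟨θ, hθ⟩ := exists_linearMap_of_mem_addSMul (φ ∘ₗ h 0) Y y (h3 _ h2)
        exact ⟨θ, fun v => hθ _⟩
      | succ i =>
        obtain ⟨ψ, hψ⟩ := h3 _ h2
        obtain ⟨θ, hθ⟩ := exists_linearMap_of_mem_addSMul
          (φ ∘ₗ h (i + 1) - ψ ∘ₗ d i) Y y hψ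
        refine ⟨θ, fun v => ?_⟩
        have := hθ (d (i + 1) v)
        simpa [(hd i).apply_apply_eq_zero] using this

/-- This is the long exact sequence of 0 → Q/Y → Q/Y → Q/(Y + (y)) → 0. Vanishing in degree `i + 1`
corrects a cocycle modulo Y + (y) by a multiple of `y` to a cocycle modulo Y (`key`), and vanishing
in degree `i` finishes. -/
theorem cohVanish_addSMul (d : ∀ i, F (i + 1) →ₗ[Q] F i)
    (hd : ∀ i, Function.Exact (d (i + 1)) (d i)) (Y : Ideal Q) (y : Q)
    (hy : ∀ v, y • v ∈ Y → v ∈ Y) (i : ℕ) (hv₀ : CohVanish d Y i)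
    (hv : CohVanish d Y (i + 1)) :
    CohVanish d (addSMul Y y) i := by
  have key : ∀ φ : F i →ₗ[Q] Q, (∀ v, φ (d i v) ∈ addSMul Y y) →
      ∃ θ : F i →ₗ[Q] Q, ∀ v, φ (d i v) - y * θ (d i v) ∈ Y := by
    intro φ hφ
    obtain ⟨θ, hθ⟩ := exists_linearMap_of_mem_addSMul (φ ∘ₗ d i) Y y hφ
    obtain ⟨θ', hθ'⟩ := hv θ (fun v => hy _ (by
      have := hθ (d (i + 1) v)
      simpa [(hd i).apply_apply_eq_zero] using this))
    refine ⟨θ', fun v => ?_⟩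
    have := Y.add_mem (hθ v) (Y.mul_mem_left y (hθ' v))
    convert this using 1
    simp only [LinearMap.comp_apply]
    ring
  have cancel : ∀ {a b c : Q}, a - y * b - c ∈ Y → a - c ∈ addSMul Y y := fun {a b c} h =>
    mem_addSMul.2 ⟨b, by rw [smul_eq_mul]; convert h using 1; ring⟩
  cases i with
  | zero =>
    intro φ hφ v
    obtain ⟨θ, hθ⟩ := key φ hφ
    have := hv₀ (φ - y • θ) (by simpa using hθ) v
    simpa using cancel (a := φ v) (b := θ v) (c := 0) (by simpa using this)
  | succ i =>
    intro φ hφ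
    obtain ⟨θ, hθ⟩ := key φ hφ
    obtain ⟨ψ, hψ⟩ := hv₀ (φ - y • θ) (by simpa using hθ)
    exact ⟨ψ, fun v => cancel (b := θ v) (by simpa using hψ v)⟩

theorem cohVanish_addList (d : ∀ i, F (i + 1) →ₗ[Q] F i)
    (hd : ∀ i, Function.Exact (d (i + 1)) (d i)) (N : ℕ) (ys : List Q) (Y : Ideal Q)
    (hY : RegOn Y ys) (hv : ∀ i, i < N → CohVanish d Y i) (i : ℕ) (hi : i + ys.length < N) :
    CohVanish d (addList Y ys) i := by
  induction ys generalizing Y N with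
  | nil => exact hv i (by simpa using hi)
  | cons y ys ih =>
    exact ih (N - 1) _ hY.2 (fun j hj => cohVanish_addSMul d hd Y y hY.1 j (hv j (by omega))
      (hv (j + 1) (by omega))) (by simp at hi; omega)

end Cohomology

/-! ### Zero divisors and associated primes. -/

section AssociatedPrimes

variable {Q : Type*} [CommRing Q] [IsNoetherianRing Q]

/-- An ideal consisting of zero divisors on `Q / Y` lies in a prime annihilating a nonzero element
of `Q / Y`. -/
theorem exists_prime_of_zero_divisors (S Y : Ideal Q) (h : ∀ a ∈ S, ∃ u, u ∉ Y ∧ a * u ∈ Y) :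
    ∃ P : Ideal Q, P.IsPrime ∧ S ≤ P ∧ ∃ u, u ∉ Y ∧ ∀ p ∈ P, p * u ∈ Y := by
  have hsub : (S : Set Q) ⊆ ⋃ P ∈ associatedPrimes Q (Q ⧸ Y), (P : Set Q) := by
    rw [biUnion_associatedPrimes_eq_zero_divisors]
    intro a ha
    obtain ⟨u, hu, hau⟩ := h a ha
    refine ⟨Ideal.Quotient.mk Y u, fun h0 => hu (Ideal.Quotient.eq_zero_iff_mem.1 h0), ?_⟩
    exact Ideal.Quotient.eq_zero_iff_mem.2 hau
  obtain ⟨P, hP, hSP⟩ := (Ideal.subset_union_prime_finite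
    (associatedPrimes.finite Q (Q ⧸ Y)) (f := id) ⊥ ⊥ (fun _ h _ _ => h.1)).1 hsub
  obtain ⟨hPp, x, hx⟩ := isAssociatedPrime_iff.1 hP
  obtain ⟨u, rfl⟩ := Ideal.Quotient.mk_surjective x
  have hmem : ∀ p, p ∈ P ↔ p * u ∈ Y := fun p => by
    rw [hx, Submodule.mem_colon_singleton, Submodule.mem_bot, ← Ideal.Quotient.eq_zero_iff_mem]
    rfl
  refine ⟨P, hPp, hSP, u, fun hu => hPp.ne_top ((Ideal.eq_top_iff_one _).2 ?_), fun p => (hmem p).1⟩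
  rw [hmem, one_mul]
  exact hu

theorem exists_prime_of_annihilator (S Y : Ideal Q) (u : Q) (hu : u ∉ Y) (h : ∀ a ∈ S, a * u ∈ Y) :
    ∃ P : Ideal Q, P.IsPrime ∧ S ≤ P ∧ ∃ u, u ∉ Y ∧ ∀ p ∈ P, p * u ∈ Y :=
  exists_prime_of_zero_divisors S Y fun a ha => ⟨u, hu, h a ha⟩

variable [IsLocalRing Q]

open IsLocalRing

/-- If `P` annihilates a nonzero element of `Q / Y` and `a` is regular on `Q / Y`, then `P + (a)`
annihilates a nonzero element of `Q / (Y + (a))`. -/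
theorem exists_annihilated_addSMul (P Y : Ideal Q) (u : Q) (hu : u ∉ Y) (h : ∀ p ∈ P, p * u ∈ Y)
    (a : Q) (ha : a ∈ maximalIdeal Q) (hreg : ∀ v, a • v ∈ Y → v ∈ Y) :
    ∃ v, v ∉ addSMul Y a ∧ ∀ p ∈ P ⊔ Ideal.span {a}, p * v ∈ addSMul Y a := by
  -- C consists of the elements killed by P modulo Y. An element of C outside Y + (a) is what is
  -- sought. If there is none, regularity of `a` gives C ⊆ Y + aC, and Nakayama forces C ⊆ Y,
  -- contradicting `u`.
  let C : Ideal Q := Y.colon (P : Set Q)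
  have hC : ∀ v, v ∈ C ↔ ∀ p ∈ P, p * v ∈ Y := fun v => by
    simp [C, Submodule.mem_colon, mul_comm]
  by_cases hle : C ≤ addSMul Y a
  · exfalso
    refine hu (Submodule.le_of_le_smul_of_le_jacobson_bot (I := maximalIdeal Q)
      (IsNoetherian.noetherian C) (le_of_eq (jacobson_eq_maximalIdeal _ bot_ne_top).symm) ?_
      ((hC u).2 h))
    intro v hv
    obtain ⟨w, hw⟩ := mem_addSMul.1 (hle hv)
    have hwC : w ∈ C := by
      rw [hC] at hv ⊢
      intro p hp
      apply hreg
      have := Y.sub_mem (hv p hp) (Y.mul_mem_left p hw)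
      rw [smul_eq_mul] at this ⊢
      convert this using 1
      ring
    have := Submodule.add_mem_sup hw (Submodule.smul_mem_smul ha hwC)
    simpa using this
  · obtain ⟨v, hv, hva⟩ := SetLike.not_le_iff_exists.1 hle
    refine ⟨v, hva, fun p hp => ?_⟩
    obtain ⟨q, hq, _, hb, rfl⟩ := Submodule.mem_sup.1 hp
    obtain ⟨b, rfl⟩ := Ideal.mem_span_singleton.1 hb
    rw [add_mul, mul_assoc]
    exact Ideal.add_mem _ (le_addSMul _ _ ((hC v).1 hv q hq)) (smul_mem_addSMul Y a (b * v))

end AssociatedPrimes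

/-! ### Grade and codimension in a regular local ring. -/

section RegularLocal

open IsLocalRing

variable {Q : Type*} [CommRing Q] [IsLocalRing Q]
  {F : ℕ → Type*} [∀ i, AddCommGroup (F i)] [∀ i, Module Q (F i)] [∀ i, Module.Projective Q (F i)]

/-- In a local ring whose maximal ideal is generated by a regular sequence of length `N`, the
maximal ideal is not associated to a regular sequence of length less than `N`. -/
theorem exists_mul_notMem (d : ∀ i, F (i + 1) →ₗ[Q] F i)
    (hd : ∀ i, Function.Exact (d (i + 1)) (d i)) (ε : F 0 →ₗ[Q] Q) (hε : ∃ v, ε v = 1)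
    (hdε : ∀ v, v ∈ LinearMap.range (d 0) ↔ ε v ∈ maximalIdeal Q)
    (xs : List Q) (hxs : RegOn (⊥ : Ideal Q) xs) (hmax : ∀ x ∈ xs, x ∈ maximalIdeal Q)
    (ys : List Q) (hys : RegOn (⊥ : Ideal Q) ys) (hlen : ys.length < xs.length)
    (u : Q) (hu : u ∉ addList (⊥ : Ideal Q) ys) :
    ∃ a ∈ maximalIdeal Q, a * u ∉ addList (⊥ : Ideal Q) ys := by
  by_contra! hcon
  -- For the residue field k, Ext^i(k, Q) vanishes for i < N, so Hom(k, Q / (ys)) = 0. An element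
  -- `u` killed by the maximal ideal modulo (ys) would make `u • ε` a nonzero member of this Hom.
  have h1 := cohVanish_addList d hd xs.length ys ⊥ hys (fun i hi =>
    cohVanish_of_annihilator d hd xs ⊥ hxs (fun x hx v => (hdε _).2 (by
      rw [map_smul]
      exact Ideal.mul_mem_right _ _ (hmax x hx))) i hi) 0 (by simpa using hlen)
  obtain ⟨v, hv⟩ := hε
  have := h1 (u • ε) (fun w => by
    rw [LinearMap.smul_apply, smul_eq_mul, mul_comm]
    exact hcon _ ((hdε _).1 ⟨w, rfl⟩)) v
  rw [LinearMap.smul_apply, hv, smul_eq_mul, mul_one] at this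
  exact hu this

variable [IsNoetherianRing Q]

/-- A prime P killing a nonzero element of Q / (ys) has dim Q/P at least N minus the length of ys.
Some `a` in the maximal ideal is regular on Q / (ys), and P + (a) lies in a prime P' of the same
kind for the longer sequence. Since `a` is not in P, dim Q/P exceeds dim Q/P'. -/
theorem le_ringKrullDim_of_annihilated (d : ∀ i, F (i + 1) →ₗ[Q] F i)
    (hd : ∀ i, Function.Exact (d (i + 1)) (d i)) (ε : F 0 →ₗ[Q] Q) (hε : ∃ v, ε v = 1)
    (hdε : ∀ v, v ∈ LinearMap.range (d 0) ↔ ε v ∈ maximalIdeal Q)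
    (xs : List Q) (hxs : RegOn (⊥ : Ideal Q) xs) (hmax : ∀ x ∈ xs, x ∈ maximalIdeal Q)
    (k : ℕ) (ys : List Q) (hys : RegOn (⊥ : Ideal Q) ys) (hlen : ys.length + k = xs.length)
    (P : Ideal Q) (hP : P.IsPrime) (u : Q) (hu : u ∉ addList (⊥ : Ideal Q) ys)
    (hPu : ∀ p ∈ P, p * u ∈ addList (⊥ : Ideal Q) ys) :
    (k : WithBot ℕ∞) ≤ ringKrullDim (Q ⧸ P) := by
  induction k generalizing ys P u with
  | zero => exact ringKrullDim_nonneg_of_nontrivial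
  | succ k ih =>
    set Y := addList (⊥ : Ideal Q) ys with hY
    obtain ⟨a, ha, hreg⟩ : ∃ a ∈ maximalIdeal Q, ∀ v, a • v ∈ Y → v ∈ Y := by
      by_contra! hcon
      obtain ⟨P', hP', hle, w, hw, hPw⟩ := exists_prime_of_zero_divisors (maximalIdeal Q) Y
        (fun a ha => by
          obtain ⟨v, hv, hv'⟩ := hcon a ha
          exact ⟨v, hv', hv⟩)
      obtain ⟨b, hb, hbw⟩ := exists_mul_notMem d hd ε hε hdε xs hxs hmax ys hys (by omega) w hw
      exact hbw (hPw b (hle hb))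
    obtain ⟨v, hv, hPv⟩ := exists_annihilated_addSMul P Y u hu hPu a ha hreg
    obtain ⟨P', hP', hle, w, hw, hPw⟩ := exists_prime_of_annihilator _ _ v hv hPv
    have h1 := ih (ys ++ [a]) ((regOn_concat _ _ _).2 ⟨hys, hreg⟩) (by simp; omega) P' hP' w
      (by rwa [addList_concat]) (by rwa [addList_concat])
    have haP : a ∉ P := fun h => hu (hreg u (hPu a h))
    have h2 := ringKrullDim_succ_le_of_surjective (Ideal.Quotient.factor (le_sup_left.trans hle))
      (Ideal.Quotient.factor_surjective _) (r := Ideal.Quotient.mk P a)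
      (mem_nonZeroDivisors_of_ne_zero fun h => haP (Ideal.Quotient.eq_zero_iff_mem.1 h))
      (by
        rw [Ideal.Quotient.factor_mk]
        exact Ideal.Quotient.eq_zero_iff_mem.2
          (hle (Ideal.mem_sup_right (Ideal.mem_span_singleton_self a))))
    refine le_trans ?_ h2
    push_cast
    gcongr

/-- The grade of an ideal `J` of a regular local ring is at least the codimension of `J`. -/
theorem exists_regOn_and_le_ringKrullDim (d : ∀ i, F (i + 1) →ₗ[Q] F i)
    (hd : ∀ i, Function.Exact (d (i + 1)) (d i)) (ε : F 0 →ₗ[Q] Q) (hε : ∃ v, ε v = 1)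
    (hdε : ∀ v, v ∈ LinearMap.range (d 0) ↔ ε v ∈ maximalIdeal Q)
    (xs : List Q) (hxs : RegOn (⊥ : Ideal Q) xs) (hmax : ∀ x ∈ xs, x ∈ maximalIdeal Q)
    (J : Ideal Q) (hJ : J ≠ ⊤) :
    ∃ (c k : ℕ) (ys : List Q), RegOn (⊥ : Ideal Q) ys ∧ (∀ y ∈ ys, y ∈ J) ∧ ys.length = c ∧
      c + k = xs.length ∧ (k : WithBot ℕ∞) ≤ ringKrullDim (Q ⧸ J) := by
  have : Nontrivial (Q ⧸ J) := Ideal.Quotient.nontrivial_iff.2 hJ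
  suffices ∀ (k : ℕ) (ys : List Q), RegOn (⊥ : Ideal Q) ys → (∀ y ∈ ys, y ∈ J) →
      ys.length + k = xs.length → ∃ (c k : ℕ) (ys : List Q), RegOn (⊥ : Ideal Q) ys ∧
        (∀ y ∈ ys, y ∈ J) ∧ ys.length = c ∧ c + k = xs.length ∧
          (k : WithBot ℕ∞) ≤ ringKrullDim (Q ⧸ J) from
    this xs.length [] trivial (by simp) (by simp)
  intro k
  induction k with
  | zero => exact fun ys h1 h2 h3 => ⟨_, 0, ys, h1, h2, rfl, h3, ringKrullDim_nonneg_of_nontrivial⟩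
  | succ k ih =>
    intro ys h1 h2 h3
    -- The sequence is extended greedily inside J. Once this is impossible, J consists of zero
    -- divisors and lies in a prime P to which the dimension bound applies, and dim Q/J ≥ dim Q/P.
    by_cases hcon : ∃ a ∈ J, ∀ v, a • v ∈ addList (⊥ : Ideal Q) ys → v ∈ addList (⊥ : Ideal Q) ys
    · obtain ⟨a, ha, hreg⟩ := hcon
      exact ih (ys ++ [a]) ((regOn_concat _ _ _).2 ⟨h1, hreg⟩) (by
        intro y hy
        rcases List.mem_append.1 hy with hy | hy
        · exact h2 y hy
        · rwa [List.mem_singleton.1 hy]) (by simp; omega)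
    · push Not at hcon
      obtain ⟨P, hP, hle, w, hw, hPw⟩ := exists_prime_of_zero_divisors J _
        (fun a ha => by
          obtain ⟨v, hv, hv'⟩ := hcon a ha
          exact ⟨v, hv', hv⟩)
      exact ⟨_, k + 1, ys, h1, h2, rfl, h3,
        (le_ringKrullDim_of_annihilated d hd ε hε hdε xs hxs hmax _ ys h1 h3 P hP w hw hPw).trans
          (ringKrullDim_le_of_surjective (Ideal.Quotient.factor hle)
            (Ideal.Quotient.factor_surjective _))⟩

end RegularLocal

/-! ### Resolutions of Cohen–Macaulay quotients, local case. -/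

section CohenMacaulay

open IsLocalRing

variable {Q A : Type*} [CommRing Q] [IsLocalRing Q] [CommRing A] [IsLocalRing A]

/-- A regular sequence of A lifts to Q elementwise. Working with `k ≤ depth A` requires neither
finiteness of the depth nor that the supremum is attained. -/
theorem exists_regOn_ker (π : Q →+* A) (hπ : Function.Surjective π) (k : ℕ)
    (hk : (k : ℕ∞) ≤ depth A) :
    ∃ as : List Q, (∀ a ∈ as, a ∈ maximalIdeal Q) ∧ RegOn (RingHom.ker π) as ∧ k ≤ as.length := by
  obtain ⟨rs, hrs, hreg, hlen⟩ : ∃ rs : List A, (∀ r ∈ rs, r ∈ maximalIdeal A) ∧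
      RingTheory.Sequence.IsWeaklyRegular A rs ∧ k ≤ rs.length := by
    rcases k with _ | k
    · exact ⟨[], by simp, .nil _ _, by simp⟩
    · have hlt : (k : ℕ∞) < depth A := lt_of_lt_of_le (by exact_mod_cast k.lt_succ_self) hk
      obtain ⟨rs, hrs⟩ := lt_iSup_iff.1 hlt
      obtain ⟨h, hrs⟩ := lt_iSup_iff.1 hrs
      exact ⟨rs, h.1, h.2.toIsWeaklyRegular, by exact_mod_cast hrs⟩
  choose g hg using hπ
  refine ⟨rs.map g, ?_, ?_, by simpa using hlen⟩
  · intro a ha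
    obtain ⟨r, hr, rfl⟩ := List.mem_map.1 ha
    intro hu
    have := hrs r hr
    rw [← hg r] at this
    exact this (hu.map π)
  · let := π.toAlgebra
    apply regOn_of_isWeaklyRegular
    have h1 : RingTheory.Sequence.IsWeaklyRegular A ((rs.map g).map (algebraMap Q A)) := by
      rw [List.map_map, show (algebraMap Q A : Q → A) ∘ g = id from funext hg, List.map_id]
      exact hreg
    rw [RingTheory.Sequence.isWeaklyRegular_map_algebraMap_iff] at h1
    have e : (Q ⧸ RingHom.ker π) ≃ₗ[Q] A :=
      LinearMap.quotKerEquivOfSurjective (Algebra.linearMap Q A) (fun a => ⟨g a, hg a⟩)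
    exact (e.isWeaklyRegular_congr _).2 h1

universe u

variable [IsNoetherianRing Q]
  {F : ℕ → Type*} [∀ i, AddCommGroup (F i)] [∀ i, Module Q (F i)] [∀ i, Module.Projective Q (F i)]
  {ι : ℕ → Type u} [∀ i, Fintype (ι i)] [∀ i, DecidableEq (ι i)]

/-- In the minimal free resolution of a Cohen–Macaulay quotient of a regular local ring, every
basis vector outside the last free module occurs in the next differential. -/
theorem exists_length_of_depth_eq (dG : ∀ i, F (i + 1) →ₗ[Q] F i)
    (hdG : ∀ i, Function.Exact (dG (i + 1)) (dG i)) (ε : F 0 →ₗ[Q] Q) (hε : ∃ v, ε v = 1)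
    (hdε : ∀ v, v ∈ LinearMap.range (dG 0) ↔ ε v ∈ maximalIdeal Q)
    (xs : List Q) (hxs : RegOn (⊥ : Ideal Q) xs)
    (hmax : addList (⊥ : Ideal Q) xs = maximalIdeal Q)
    (π : Q →+* A) (hπ : Function.Surjective π)
    (hA : ((depth A : ℕ∞) : WithBot ℕ∞) = ringKrullDim A)
    (d : ∀ i, (ι (i + 1) → Q) →ₗ[Q] (ι i → Q)) (hd : ∀ i, Function.Exact (d (i + 1)) (d i))
    (hmin : ∀ i v k, d i v k ∈ maximalIdeal Q) (k₀ : ι 0)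
    (hd0 : ∀ v, v ∈ LinearMap.range (d 0) ↔ v k₀ ∈ RingHom.ker π) :
    ∃ c : ℕ, (∀ i, c < i → IsEmpty (ι i)) ∧
      ∀ i, i < c → ∀ k : ι i, ∃ l : ι (i + 1), d i (Pi.single l 1) k ≠ 0 := by
  have hxm : ∀ x ∈ xs, x ∈ maximalIdeal Q := fun x hx => by
    rw [← hmax, addList_ideal]
    exact Ideal.mem_sup_right (Ideal.subset_span hx)
  obtain ⟨c, k, ys, hys, hysJ, rfl, hck, hk⟩ := exists_regOn_and_le_ringKrullDim dG hdG ε hε hdε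
    xs hxs hxm (RingHom.ker π) (RingHom.ker_ne_top π)
  rw [ringKrullDim_eq_of_ringEquiv (RingHom.quotientKerEquivOfSurjective hπ), ← hA] at hk
  obtain ⟨as, has, hreg, hlen⟩ := exists_regOn_ker π hπ k (by exact_mod_cast hk)
  -- Here k ≤ dim A = depth A and c + k = N, so the Auslander–Buchsbaum inequality bounds the length
  -- of the resolution by N - k = c.
  refine ⟨ys.length, fun i hi => ?_, fun i hi k => ?_⟩
  · refine isEmpty_of_regOn d hd xs hxs (by rw [hmax]; exact Ideal.IsPrime.ne_top') (by rwa [hmax])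
      as (by rwa [hmax]) ?_ i (by omega)
    exact regOn_comap (LinearMap.proj k₀) (fun a => ⟨Pi.single k₀ a, by simp⟩) _ _ hd0 _ hreg
  · by_contra! hcon
    -- If the `k`-th row of `d i` is zero, the `k`-th coordinate function is a cocycle of Hom(F, Q).
    -- For i = 0 it must vanish; for i > 0 it is a coboundary, whose values lie in the maximal ideal
    -- by minimality. Either contradicts its value 1 at the basis vector.
    have hzero : ∀ v, d i v k = 0 := fun v => by
      rw [pi_eq_sum_univ' v, map_sum, Finset.sum_apply]
      refine Finset.sum_eq_zero fun l _ => ?_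
      rw [map_smul, Pi.smul_apply, hcon, smul_zero]
    have hcv := cohVanish_of_annihilator (F := fun i => ι i → Q) d hd ys ⊥ hys (fun y hy v => (hd0 _).2
      (Ideal.mul_mem_right _ _ (hysJ y hy))) i hi
    rcases i with _ | i
    · have := hcv (LinearMap.proj k) (fun v => by simpa using hzero v) (Pi.single k 1)
      simp at this
    · obtain ⟨ψ, hψ⟩ := hcv (LinearMap.proj k) (fun v => by simpa using hzero v)
      have h2 := hψ (Pi.single k 1)
      have h3 : ψ (d i (Pi.single k 1)) ∈ maximalIdeal Q := by
        rw [pi_eq_sum_univ' (d i _), map_sum]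
        refine Ideal.sum_mem _ fun l _ => ?_
        rw [map_smul]
        exact Ideal.mul_mem_right _ _ (hmin _ _ _)
      have h4 : (1 : Q) = ψ (d i (Pi.single k 1)) := by simpa [sub_eq_zero] using h2
      rw [← h4] at h3
      exact (Ideal.ne_top_iff_one _).1 Ideal.IsPrime.ne_top' h3

end CohenMacaulay

/-! ### Localization of complexes of free modules. -/

section Localization

set_option linter.unusedSectionVars false

variable {R : Type*} [CommRing R] (𝔪 : Ideal R) [𝔪.IsPrime]

/-- The localization at `𝔪` of a linear map between free modules. -/
def locMap {κ μ : Type*} [Fintype κ] [DecidableEq κ] (f : (κ → R) →ₗ[R] (μ → R)) :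
    (κ → Localization.AtPrime 𝔪) →ₗ[Localization.AtPrime 𝔪] (μ → Localization.AtPrime 𝔪) :=
  Matrix.mulVecLin ((LinearMap.toMatrix' f).map (algebraMap R (Localization.AtPrime 𝔪)))

theorem locMap_algebraMap {κ μ : Type*} [Fintype κ] [DecidableEq κ]
    (f : (κ → R) →ₗ[R] (μ → R)) (v : κ → R) :
    locMap 𝔪 f (fun k => algebraMap R (Localization.AtPrime 𝔪) (v k)) =
      fun m => algebraMap R (Localization.AtPrime 𝔪) (f v m) := by
  funext m
  conv_rhs => rw [← Matrix.toLin'_toMatrix' f, Matrix.toLin'_apply, RingHom.map_mulVec]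
  rfl

theorem exists_smul_eq_algebraMap {κ : Type*} [Finite κ] (w : κ → Localization.AtPrime 𝔪) :
    ∃ (s : R) (v : κ → R), s ∉ 𝔪 ∧ ∀ k, algebraMap R _ s * w k = algebraMap R _ (v k) := by
  obtain ⟨b, hb⟩ := IsLocalization.exist_integer_multiples_of_finite 𝔪.primeCompl w
  choose v hv using hb
  exact ⟨b, v, b.2, fun k => by rw [hv, Algebra.smul_def]⟩

theorem isUnit_algebraMap_of_notMem {s : R} (hs : s ∉ 𝔪) :
    IsUnit (algebraMap R (Localization.AtPrime 𝔪) s) :=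
  IsLocalization.map_units (Localization.AtPrime 𝔪) (⟨s, hs⟩ : 𝔪.primeCompl)

theorem mem_map_atPrime_iff {Y : Ideal R} {z : R} :
    algebraMap R (Localization.AtPrime 𝔪) z ∈ Y.map (algebraMap R (Localization.AtPrime 𝔪)) ↔
      ∃ s, s ∉ 𝔪 ∧ s * z ∈ Y := by
  rw [IsLocalization.algebraMap_mem_map_algebraMap_iff 𝔪.primeCompl]
  exact ⟨fun ⟨s, hs, h⟩ => ⟨s, hs, h⟩, fun ⟨s, hs, h⟩ => ⟨s, hs, h⟩⟩

theorem map_addSMul_ideal {S : Type*} [CommRing S] (g : R →+* S) (Y : Ideal R) (a : R) :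
    Ideal.map g (addSMul Y a) = (addSMul (Y.map g) (g a) : Ideal S) := by
  rw [addSMul_ideal, addSMul_ideal, Ideal.map_sup, Ideal.map_span, Set.image_singleton]

theorem map_addList_ideal {S : Type*} [CommRing S] (g : R →+* S) (Y : Ideal R) (l : List R) :
    Ideal.map g (addList Y l) = (addList (Y.map g) (l.map g) : Ideal S) := by
  induction l generalizing Y with
  | nil => rfl
  | cons a l ih => rw [addList_cons, ih, map_addSMul_ideal, List.map_cons, addList_cons]

theorem regOn_map_atPrime (Y : Ideal R) (l : List R) (h : RegOn Y l) :
    RegOn (Y.map (algebraMap R (Localization.AtPrime 𝔪)))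
      (l.map (algebraMap R (Localization.AtPrime 𝔪))) := by
  induction l generalizing Y with
  | nil => trivial
  | cons a l ih =>
    refine ⟨fun w hw => ?_, ?_⟩
    · obtain ⟨s, v, hs, hv⟩ := exists_smul_eq_algebraMap 𝔪 (fun _ : Unit => w)
      have hv' : algebraMap R _ s * w = _ := hv ()
      rw [← Ideal.unit_mul_mem_iff_mem _ (isUnit_algebraMap_of_notMem 𝔪 hs), hv',
        mem_map_atPrime_iff]
      have h2 := Ideal.mul_mem_left _ (algebraMap R (Localization.AtPrime 𝔪) s) hw
      rw [smul_eq_mul, mul_left_comm, hv', ← map_mul, mem_map_atPrime_iff] at h2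
      obtain ⟨t, ht, h2⟩ := h2
      exact ⟨t, ht, h.1 _ (by rwa [smul_eq_mul, mul_left_comm])⟩
    · have := ih (addSMul Y a) h.2
      rwa [map_addSMul_ideal] at this

variable 
  {κ μ ν : Type*} [Fintype κ] [DecidableEq κ] [Fintype μ] [DecidableEq μ]

/-- After multiplication by a common denominator a vector comes from R. As R is a domain, it embeds
in its localization, so a kernel relation there already holds in R. -/
theorem locMap_exact [IsDomain R] (f : (κ → R) →ₗ[R] (μ → R)) (g : (μ → R) →ₗ[R] (ν → R))
    (h : Function.Exact f g) : Function.Exact (locMap 𝔪 f) (locMap 𝔪 g) := by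
  have hinj : Function.Injective (algebraMap R (Localization.AtPrime 𝔪)) :=
    IsLocalization.injective _ 𝔪.primeCompl_le_nonZeroDivisors
  intro w
  constructor
  · intro hw
    obtain ⟨s, v, hs, hv⟩ := exists_smul_eq_algebraMap 𝔪 w
    have hu := isUnit_algebraMap_of_notMem 𝔪 hs
    have hsw : algebraMap R (Localization.AtPrime 𝔪) s • w = fun k => algebraMap R _ (v k) :=
      funext hv
    have h1 := congrArg (locMap 𝔪 g) hsw
    rw [map_smul, hw, smul_zero, locMap_algebraMap] at h1
    obtain ⟨z, hz⟩ := (h v).1 (funext fun k => hinj (by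
      rw [← congrFun h1 k]; simp))
    refine ⟨(↑hu.unit⁻¹ : Localization.AtPrime 𝔪) • fun k => algebraMap R _ (z k), ?_⟩
    rw [map_smul, locMap_algebraMap, hz, ← hsw, smul_smul, IsUnit.val_inv_mul, one_smul]
  · rintro ⟨w, rfl⟩
    obtain ⟨s, v, hs, hv⟩ := exists_smul_eq_algebraMap 𝔪 w
    have hu := isUnit_algebraMap_of_notMem 𝔪 hs
    have hsw : algebraMap R (Localization.AtPrime 𝔪) s • w = fun k => algebraMap R _ (v k) :=
      funext hv
    rw [← hu.smul_eq_zero, ← map_smul, ← map_smul, hsw, locMap_algebraMap, locMap_algebraMap,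
      h.apply_apply_eq_zero]
    funext k
    simp

theorem mem_range_locMap_iff (f : (κ → R) →ₗ[R] (μ → R)) (k₀ : μ) (J : Ideal R)
    (h : ∀ v, v ∈ LinearMap.range f ↔ v k₀ ∈ J) (w : μ → Localization.AtPrime 𝔪) :
    w ∈ LinearMap.range (locMap 𝔪 f) ↔
      w k₀ ∈ J.map (algebraMap R (Localization.AtPrime 𝔪)) := by
  constructor
  · rintro ⟨w, rfl⟩
    obtain ⟨s, v, hs, hv⟩ := exists_smul_eq_algebraMap 𝔪 w
    have hu := isUnit_algebraMap_of_notMem 𝔪 hs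
    have hsw : algebraMap R (Localization.AtPrime 𝔪) s • w = fun k => algebraMap R _ (v k) :=
      funext hv
    rw [← Ideal.unit_mul_mem_iff_mem _ hu, ← smul_eq_mul, ← Pi.smul_apply, ← map_smul, hsw,
      locMap_algebraMap]
    exact Ideal.mem_map_of_mem _ ((h _).1 ⟨v, rfl⟩)
  · intro hw
    obtain ⟨s, v, hs, hv⟩ := exists_smul_eq_algebraMap 𝔪 w
    rw [← Ideal.unit_mul_mem_iff_mem _ (isUnit_algebraMap_of_notMem 𝔪 hs), hv,
      mem_map_atPrime_iff] at hw
    obtain ⟨t, ht, htv⟩ := hw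
    obtain ⟨z, hz⟩ := (h (t • v)).2 htv
    have hts : t * s ∉ 𝔪 := fun hm => (Ideal.IsPrime.mem_or_mem ‹_› hm).elim ht hs
    have hu := isUnit_algebraMap_of_notMem 𝔪 hts
    refine ⟨(↑hu.unit⁻¹ : Localization.AtPrime 𝔪) • fun k => algebraMap R _ (z k), ?_⟩
    rw [map_smul, locMap_algebraMap, hz]
    funext k
    have h2 : algebraMap R (Localization.AtPrime 𝔪) ((t • v) k) =
        algebraMap R (Localization.AtPrime 𝔪) (t * s) * w k := by
      rw [Pi.smul_apply, smul_eq_mul, map_mul, map_mul, mul_assoc, hv]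
    rw [Pi.smul_apply, h2, smul_eq_mul, ← mul_assoc, IsUnit.val_inv_mul, one_mul]

theorem locMap_mem (f : (κ → R) →ₗ[R] (μ → R)) (J : Ideal R) (h : ∀ v k, f v k ∈ J)
    (w : κ → Localization.AtPrime 𝔪) (k : μ) :
    locMap 𝔪 f w k ∈ J.map (algebraMap R (Localization.AtPrime 𝔪)) := by
  obtain ⟨s, v, hs, hv⟩ := exists_smul_eq_algebraMap 𝔪 w
  have hsw : algebraMap R (Localization.AtPrime 𝔪) s • w = fun k => algebraMap R _ (v k) :=
    funext hv
  rw [← Ideal.unit_mul_mem_iff_mem _ (isUnit_algebraMap_of_notMem 𝔪 hs), ← smul_eq_mul,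
    ← Pi.smul_apply, ← map_smul, hsw, locMap_algebraMap]
  exact Ideal.mem_map_of_mem _ (h _ _)

end Localization

/-! ### Descent of the local result to the global resolution. -/

section CohenMacaulay

variable {R A : Type*} [CommRing R] [CommRing A] (𝔪 : Ideal R) [𝔪.IsMaximal]

theorem localRingHom_surjective_of_surjective (φ : R →+* A) (hφ : Function.Surjective φ)
    (p : Ideal A) [p.IsPrime] (hp : 𝔪 = p.comap φ) :
    Function.Surjective (Localization.localRingHom 𝔪 p φ hp) := by
  intro x
  obtain ⟨a, s, rfl⟩ := IsLocalization.exists_mk'_eq p.primeCompl x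
  obtain ⟨b, rfl⟩ := hφ a
  obtain ⟨t, ht⟩ := hφ s
  refine ⟨IsLocalization.mk' _ b (⟨t, fun h => s.2 ?_⟩ : 𝔪.primeCompl), ?_⟩
  · rw [SetLike.mem_coe, hp, Ideal.mem_comap, ht] at h
    exact h
  · rw [Localization.localRingHom_mk']
    congr 1
    exact Subtype.ext ht

theorem ker_localRingHom (φ : R →+* A) (hφ : Function.Surjective φ)
    (p : Ideal A) [p.IsPrime] (hp : 𝔪 = p.comap φ) :
    RingHom.ker (Localization.localRingHom 𝔪 p φ hp) =
      (RingHom.ker φ).map (algebraMap R (Localization.AtPrime 𝔪)) := by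
  ext x
  obtain ⟨s, v, hs, hv⟩ := exists_smul_eq_algebraMap 𝔪 (fun _ : Unit => x)
  have hv' : algebraMap R _ s * x = _ := hv ()
  have hu := isUnit_algebraMap_of_notMem 𝔪 hs
  rw [← Ideal.unit_mul_mem_iff_mem _ hu, ← Ideal.unit_mul_mem_iff_mem (Ideal.map _ _) hu, hv',
    mem_map_atPrime_iff, RingHom.mem_ker, Localization.localRingHom_to_map,
    IsLocalization.map_eq_zero_iff p.primeCompl]
  constructor
  · rintro ⟨t, ht⟩
    obtain ⟨t', ht'⟩ := hφ t
    refine ⟨t', fun h => t.2 ?_, ?_⟩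
    · rw [hp, Ideal.mem_comap, ht'] at h
      exact h
    · rw [RingHom.mem_ker, map_mul, ht', ht]
  · rintro ⟨t, ht, h⟩
    refine ⟨⟨φ t, fun h => ht ?_⟩, ?_⟩
    · rw [hp, Ideal.mem_comap]
      exact h
    · rw [← map_mul]
      exact h

variable [IsDomain R] [IsNoetherianRing R] {ιG ι : ℕ → Type*} [∀ i, Fintype (ιG i)]
  [∀ i, Fintype (ι i)] [∀ i, DecidableEq (ιG i)] [∀ i, DecidableEq (ι i)]

/-- Only the localization of A at the image of 𝔪 is used: it is the quotient of the localization of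
R by the extended kernel. A matrix entry that is nonzero after localization was nonzero before, and
the index sets of the bases do not change. -/
theorem exists_length_of_isCohenMacaulay
    (dG : ∀ i, (ιG (i + 1) → R) →ₗ[R] (ιG i → R)) (hdG : ∀ i, Function.Exact (dG (i + 1)) (dG i))
    (g₀ : ιG 0) (hdG0 : ∀ v, v ∈ LinearMap.range (dG 0) ↔ v g₀ ∈ 𝔪)
    (xs : List R) (hxs : RegOn (⊥ : Ideal R) xs) (hmax : addList (⊥ : Ideal R) xs = 𝔪)
    (φ : R →+* A) (hφ : Function.Surjective φ) (hker : RingHom.ker φ ≤ 𝔪)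
    (hA : IsCohenMacaulay A)
    (d : ∀ i, (ι (i + 1) → R) →ₗ[R] (ι i → R)) (hd : ∀ i, Function.Exact (d (i + 1)) (d i))
    (hmin : ∀ i v k, d i v k ∈ 𝔪) (k₀ : ι 0)
    (hd0 : ∀ v, v ∈ LinearMap.range (d 0) ↔ v k₀ ∈ RingHom.ker φ) :
    ∃ c : ℕ, (∀ i, c < i → IsEmpty (ι i)) ∧
      ∀ i, i < c → ∀ k : ι i, ∃ l : ι (i + 1), d i (Pi.single l 1) k ≠ 0 := by
  have : (𝔪.map φ).IsMaximal := Ideal.IsMaximal.map_of_surjective_of_ker_le hφ hker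
  have hp : 𝔪 = (𝔪.map φ).comap φ := by
    rw [Ideal.comap_map_of_surjective' φ hφ, sup_eq_left.2 hker]
  have hQ : (𝔪.map (algebraMap R (Localization.AtPrime 𝔪))) =
      IsLocalRing.maximalIdeal (Localization.AtPrime 𝔪) :=
    Localization.AtPrime.map_eq_maximalIdeal
  obtain ⟨c, hc, hc'⟩ := exists_length_of_depth_eq
    (F := fun i => ιG i → Localization.AtPrime 𝔪) (fun i => locMap 𝔪 (dG i))
    (fun i => locMap_exact 𝔪 _ _ (hdG i)) (LinearMap.proj g₀) ⟨Pi.single g₀ 1, by simp⟩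
    (fun v => by rw [mem_range_locMap_iff 𝔪 (dG 0) g₀ 𝔪 hdG0, hQ]; rfl)
    (xs.map (algebraMap R (Localization.AtPrime 𝔪)))
    (by have := regOn_map_atPrime 𝔪 _ _ hxs; rwa [Ideal.map_bot] at this)
    (by rw [← Ideal.map_bot (f := algebraMap R (Localization.AtPrime 𝔪)), ← map_addList_ideal,
      hmax, hQ])
    (Localization.localRingHom 𝔪 (𝔪.map φ) φ hp)
    (localRingHom_surjective_of_surjective 𝔪 φ hφ _ hp) (hA.2 _)
    (fun i => locMap 𝔪 (d i)) (fun i => locMap_exact 𝔪 _ _ (hd i))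
    (fun i v k => by rw [← hQ]; exact locMap_mem 𝔪 _ _ (hmin i) v k) k₀
    (fun v => by rw [mem_range_locMap_iff 𝔪 (d 0) k₀ _ hd0, ker_localRingHom 𝔪 φ hφ])
  refine ⟨c, hc, fun i hi k => ?_⟩
  obtain ⟨l, hl⟩ := hc' i hi k
  refine ⟨l, fun h => hl ?_⟩
  have : (Pi.single l 1 : ι (i + 1) → Localization.AtPrime 𝔪) =
      fun k => algebraMap R _ ((Pi.single l 1 : ι (i + 1) → R) k) := by
    funext k
    rcases eq_or_ne k l with rfl | hk
    · simp
    · simp [hk]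
  rw [this, locMap_algebraMap]
  exact (congrArg _ h).trans (map_zero _)

end CohenMacaulay

/-! ### The variables as a regular sequence generating the irrelevant ideal. -/

section Variables

variable {K : Type*} [Field K] {τ : Type*}

theorem regOn_X (l : List τ) (T : Set τ) (hl : l.Nodup) (hT : ∀ s ∈ l, s ∉ T) :
    RegOn (Ideal.span (X '' T) : Ideal (MvPolynomial τ K)) (l.map X) := by
  induction l generalizing T with
  | nil => trivial
  | cons s l ih =>
    rw [List.nodup_cons] at hl
    refine ⟨fun v hv => ?_, ?_⟩
    · rw [mem_ideal_span_X_image] at hv ⊢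
      intro a ha
      obtain ⟨i, hi, hi'⟩ := hv (Finsupp.single s 1 + a) (by
        rw [mem_support_iff, smul_eq_mul, coeff_X_mul]
        exact mem_support_iff.1 ha)
      have hne : s ≠ i := fun h => hT s (by simp) (h ▸ hi)
      exact ⟨i, hi, by simpa [Finsupp.single_apply, hne] using hi'⟩
    · rw [addSMul_ideal, ← Ideal.span_union, ← Set.image_singleton, ← Set.image_union]
      refine ih _ hl.2 fun t ht => ?_
      rintro (h | h)
      · exact hT t (by simp [ht]) h
      · rw [Set.mem_singleton_iff.1 h] at ht
        exact hl.1 ht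

theorem addList_X (l : List τ) (T : Set τ) :
    addList (Ideal.span (X '' T) : Ideal (MvPolynomial τ K)) (l.map X) =
      Ideal.span (X '' (T ∪ {s | s ∈ l})) := by
  induction l generalizing T with
  | nil => simp
  | cons s l ih =>
    rw [List.map_cons, addList_cons, addSMul_ideal, ← Ideal.span_union, ← Set.image_singleton,
      ← Set.image_union, ih]
    congr 2
    ext t
    simp only [Set.mem_union, Set.mem_singleton_iff, Set.mem_ofPred_eq, List.mem_cons]
    tauto

theorem span_X_eq_ker_constantCoeff :
    (Ideal.span (X '' Set.univ) : Ideal (MvPolynomial τ K)) = RingHom.ker constantCoeff := by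
  ext v
  rw [mem_ideal_span_X_image, RingHom.mem_ker, constantCoeff_eq]
  constructor
  · intro h
    by_contra h0
    obtain ⟨i, -, hi⟩ := h 0 (mem_support_iff.2 h0)
    exact hi rfl
  · intro h a ha
    by_contra! hcon
    have : a = 0 := Finsupp.ext fun i => hcon i trivial
    exact mem_support_iff.1 ha (this ▸ h)

instance : (RingHom.ker (constantCoeff : MvPolynomial τ K →+* K)).IsMaximal :=
  RingHom.ker_isMaximal_of_surjective _ fun a => ⟨C a, constantCoeff_C _ _⟩

theorem exists_regOn_ker_constantCoeff [Finite τ] :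
    ∃ xs : List (MvPolynomial τ K), RegOn (⊥ : Ideal (MvPolynomial τ K)) xs ∧
      addList (⊥ : Ideal (MvPolynomial τ K)) xs = RingHom.ker constantCoeff := by
  have := Fintype.ofFinite τ
  have hbot : (⊥ : Ideal (MvPolynomial τ K)) = Ideal.span (X '' ∅) := by simp
  refine ⟨(Finset.univ : Finset τ).toList.map X, ?_, ?_⟩
  · rw [hbot]
    exact regOn_X _ _ (Finset.nodup_toList _) (by simp)
  · rw [hbot, addList_X, ← span_X_eq_ker_constantCoeff]
    simp

end Variables

/-! ### Free modules graded by an arbitrary commutative monoid. -/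

section Grading

set_option linter.unusedSectionVars false

variable {K : Type*} [Field K] {τ : Type*} {Δ : Type*} [AddCommMonoid Δ]

open Classical in
/-- The part of a polynomial supported on a set of monomials. -/
def restr (S : Set (τ →₀ ℕ)) (p : MvPolynomial τ K) : MvPolynomial τ K :=
  ∑ a ∈ p.support with a ∈ S, monomial a (coeff a p)

open Classical in
theorem coeff_restr (S : Set (τ →₀ ℕ)) (p : MvPolynomial τ K) (a : τ →₀ ℕ) :
    coeff a (restr S p) = if a ∈ S then coeff a p else 0 := by
  rw [restr, coeff_sum]
  simp only [coeff_monomial]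
  rw [Finset.sum_ite_eq' ]
  simp only [Finset.mem_filter, mem_support_iff]
  split_ifs <;> tauto

theorem restr_add (S : Set (τ →₀ ℕ)) (p q : MvPolynomial τ K) :
    restr S (p + q) = restr S p + restr S q := by
  classical
  ext a
  simp only [coeff_restr, coeff_add]
  split_ifs <;> simp

theorem restr_zero (S : Set (τ →₀ ℕ)) : restr S (0 : MvPolynomial τ K) = 0 := by
  simp [restr]

theorem restr_monomial_of_mem {S : Set (τ →₀ ℕ)} {a : τ →₀ ℕ} (ha : a ∈ S) (c : K) :
    restr S (monomial a c) = monomial a c := by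
  classical
  ext b
  rw [coeff_restr, coeff_monomial]
  by_cases h : a = b
  · simp [← h, ha]
  · simp [h]

theorem restr_monomial_of_notMem {S : Set (τ →₀ ℕ)} {a : τ →₀ ℕ} (ha : a ∉ S) (c : K) :
    restr S (monomial a c) = 0 := by
  classical
  ext b
  rw [coeff_restr, coeff_monomial]
  by_cases h : a = b
  · simp [← h, ha]
  · simp [h]

variable {ι κ : Type*} (W : τ → Δ)

/-- `v` is a homogeneous element of degree `δ` of the free module `⨁ R(-deg l)`. -/
def IsHom (deg : ι → Δ) (v : ι → MvPolynomial τ K) (δ : Δ) : Prop :=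
  ∀ l a, coeff a (v l) ≠ 0 → Finsupp.weight W a + deg l = δ

/-- The homogeneous component of degree `δ` of an element of `⨁ R(-deg l)`. -/
def comp (deg : ι → Δ) (δ : Δ) (v : ι → MvPolynomial τ K) : ι → MvPolynomial τ K :=
  fun l => restr {a | Finsupp.weight W a + deg l = δ} (v l)

open Classical in
theorem coeff_comp (deg : ι → Δ) (δ : Δ) (v : ι → MvPolynomial τ K) (l : ι) (a : τ →₀ ℕ) :
    coeff a (comp W deg δ v l) = if Finsupp.weight W a + deg l = δ then coeff a (v l) else 0 := by
  rw [comp, coeff_restr]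
  rfl

variable {W} {deg : ι → Δ} {δ : Δ} {v w : ι → MvPolynomial τ K}

theorem comp_isHom (deg : ι → Δ) (δ : Δ) (v : ι → MvPolynomial τ K) :
    IsHom W deg (comp W deg δ v) δ := by
  classical
  intro l a h
  rw [coeff_comp] at h
  by_contra hne
  exact h (if_neg hne)

theorem IsHom.comp_eq (h : IsHom W deg v δ) : comp W deg δ v = v := by
  classical
  funext l
  ext a
  rw [coeff_comp]
  split_ifs with h1
  · rfl
  · by_contra h2
    exact h1 (h l a (Ne.symm h2))

theorem IsHom.comp_ne (h : IsHom W deg v δ) {δ' : Δ} (hne : δ ≠ δ') : comp W deg δ' v = 0 := by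
  classical
  funext l
  ext a
  rw [coeff_comp, Pi.zero_apply, coeff_zero]
  split_ifs with h1
  · by_contra h2
    exact hne ((h l a h2).symm.trans h1)
  · rfl

theorem IsHom.add (hv : IsHom W deg v δ) (hw : IsHom W deg w δ) : IsHom W deg (v + w) δ := by
  intro l a h
  rw [Pi.add_apply, coeff_add] at h
  by_cases h1 : coeff a (v l) = 0
  · exact hw l a (by simpa [h1] using h)
  · exact hv l a h1

theorem IsHom.neg (hv : IsHom W deg v δ) : IsHom W deg (-v) δ := by
  intro l a h
  exact hv l a (by simpa using h)

theorem comp_add (deg : ι → Δ) (δ : Δ) (v w : ι → MvPolynomial τ K) :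
    comp W deg δ (v + w) = comp W deg δ v + comp W deg δ w :=
  funext fun _ => restr_add _ _ _

theorem comp_zero (deg : ι → Δ) (δ : Δ) : comp W deg δ (0 : ι → MvPolynomial τ K) = 0 :=
  funext fun _ => restr_zero _

/-- Taking homogeneous components, as an additive map. -/
def compHom (W : τ → Δ) (deg : ι → Δ) (δ : Δ) :
    (ι → MvPolynomial τ K) →+ (ι → MvPolynomial τ K) where
  toFun := comp W deg δ
  map_zero' := comp_zero deg δ
  map_add' := comp_add deg δ

theorem comp_sub (deg : ι → Δ) (δ : Δ) (v w : ι → MvPolynomial τ K) :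
    comp W deg δ (v - w) = comp W deg δ v - comp W deg δ w :=
  map_sub (compHom W deg δ) v w

theorem comp_sum {α : Type*} (deg : ι → Δ) (δ : Δ) (s : Finset α)
    (v : α → ι → MvPolynomial τ K) :
    comp W deg δ (∑ x ∈ s, v x) = ∑ x ∈ s, comp W deg δ (v x) :=
  map_sum (compHom W deg δ) v s

theorem IsHom.monomial_smul (hv : IsHom W deg v δ) (a : τ →₀ ℕ) (c : K) :
    IsHom W deg (monomial a c • v) (Finsupp.weight W a + δ) := by
  intro l b h
  rw [Pi.smul_apply, smul_eq_mul, coeff_monomial_mul'] at h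
  have hab : a ≤ b := by
    by_contra hab
    simp [hab] at h
  rw [if_pos hab] at h
  have := hv l _ (right_ne_zero_of_mul h)
  rw [← this, ← add_assoc, ← map_add, add_tsub_cancel_of_le hab]

/-- There is no subtraction in Δ, so the part of `r` that contributes is described by a set of
monomials instead of a degree δ' - δ. -/
theorem IsHom.comp_smul (hv : IsHom W deg v δ) (δ' : Δ) (r : MvPolynomial τ K) :
    comp W deg δ' (r • v) = restr {a | Finsupp.weight W a + δ = δ'} r • v := by
  induction r using MvPolynomial.induction_on' with
  | monomial a c =>
    by_cases h : Finsupp.weight W a + δ = δ'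
    · rw [restr_monomial_of_mem (by exact h)]
      exact (h ▸ hv.monomial_smul a c).comp_eq
    · rw [restr_monomial_of_notMem (by exact h), zero_smul]
      exact (hv.monomial_smul a c).comp_ne h
  | add p q hp hq => rw [add_smul, comp_add, hp, hq, restr_add, add_smul]

theorem exists_finset_comp [Finite ι] (W : τ → Δ) (deg : ι → Δ) (v : ι → MvPolynomial τ K) :
    ∃ s : Finset Δ, v = ∑ δ ∈ s, comp W deg δ v := by
  classical
  have := Fintype.ofFinite ι
  refine ⟨Finset.univ.biUnion fun l => (v l).support.image fun a => Finsupp.weight W a + deg l, ?_⟩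
  funext l
  ext a
  rw [Finset.sum_apply, coeff_sum]
  simp only [coeff_comp]
  rw [Finset.sum_ite_eq]
  split_ifs with h
  · rfl
  · by_contra h0
    exact h (Finset.mem_biUnion.2 ⟨l, Finset.mem_univ l,
      Finset.mem_image.2 ⟨a, mem_support_iff.2 h0, rfl⟩⟩)

/-- A submodule closed under taking homogeneous components. -/
def IsHomSub (W : τ → Δ) (deg : ι → Δ)
    (Z : Submodule (MvPolynomial τ K) (ι → MvPolynomial τ K)) : Prop :=
  ∀ v ∈ Z, ∀ δ, comp W deg δ v ∈ Z

section Maps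

variable [Fintype ι] [DecidableEq ι] {degκ : κ → Δ}

theorem linearMap_apply_eq_sum {R M : Type*} [CommRing R] [AddCommGroup M] [Module R M]
    (f : (ι → R) →ₗ[R] M) (v : ι → R) : f v = ∑ l, v l • f (Pi.single l 1) := by
  conv_lhs => rw [pi_eq_sum_univ' v, map_sum]
  refine Finset.sum_congr rfl fun l _ => ?_
  rw [map_smul]

/-- A homogeneous map of degree zero between graded free modules. -/
def IsHomMap (W : τ → Δ) (deg : ι → Δ) (degκ : κ → Δ)
    (f : (ι → MvPolynomial τ K) →ₗ[MvPolynomial τ K] (κ → MvPolynomial τ K)) : Prop :=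
  ∀ k, IsHom W degκ (f (Pi.single k 1)) (deg k)

theorem IsHomMap.comp_apply
    {f : (ι → MvPolynomial τ K) →ₗ[MvPolynomial τ K] (κ → MvPolynomial τ K)}
    (hf : IsHomMap W deg degκ f) (δ : Δ) (v : ι → MvPolynomial τ K) :
    comp W degκ δ (f v) = f (comp W deg δ v) := by
  rw [linearMap_apply_eq_sum f v, comp_sum, linearMap_apply_eq_sum f (comp W deg δ v)]
  exact Finset.sum_congr rfl fun l _ => (hf l).comp_smul δ (v l)

theorem IsHomMap.isHom {f : (ι → MvPolynomial τ K) →ₗ[MvPolynomial τ K] (κ → MvPolynomial τ K)}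
    (hf : IsHomMap W deg degκ f) (hv : IsHom W deg v δ) : IsHom W degκ (f v) δ := by
  rw [← hv.comp_eq, ← hf.comp_apply]
  exact comp_isHom _ _ _

theorem IsHomMap.isHomSub_ker
    {f : (ι → MvPolynomial τ K) →ₗ[MvPolynomial τ K] (κ → MvPolynomial τ K)}
    (hf : IsHomMap W deg degκ f) : IsHomSub W deg (LinearMap.ker f) := by
  intro v hv δ
  rw [LinearMap.mem_ker] at hv ⊢
  rw [← hf.comp_apply, hv, comp_zero]

theorem isHom_single (W : τ → Δ) (deg : ι → Δ) (k : ι) :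
    IsHom W deg (Pi.single k 1 : ι → MvPolynomial τ K) (deg k) := by
  classical
  intro l a h
  rcases eq_or_ne l k with rfl | hlk
  · rw [Pi.single_eq_same, coeff_one] at h
    have : a = 0 := by
      by_contra h0
      exact h (if_neg (Ne.symm h0))
    rw [this, map_zero, zero_add]
  · simp [Pi.single_eq_of_ne hlk] at h

/-- The linear map with prescribed values on the standard basis. -/
def ofCols (g : ι → κ → MvPolynomial τ K) :
    (ι → MvPolynomial τ K) →ₗ[MvPolynomial τ K] (κ → MvPolynomial τ K) :=
  Fintype.linearCombination (MvPolynomial τ K) g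

theorem ofCols_apply (g : ι → κ → MvPolynomial τ K) (v : ι → MvPolynomial τ K) :
    ofCols g v = ∑ l, v l • g l := rfl

theorem ofCols_single (g : ι → κ → MvPolynomial τ K) (k : ι) : ofCols g (Pi.single k 1) = g k := by
  simp [ofCols_apply, Pi.single_apply, ite_smul]

theorem range_ofCols (g : ι → κ → MvPolynomial τ K) :
    LinearMap.range (ofCols g) = Submodule.span _ (Set.range g) :=
  Fintype.range_linearCombination _ _

end Maps

end Grading

/-! ### Minimal homogeneous generators. -/

section Existence

set_option linter.unusedSectionVars false

variable {K : Type*} [Field K] {τ : Type*} [Finite τ] {Δ : Type*} [AddCommMonoid Δ]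
  [IsCancelAdd Δ] {W : τ → Δ} {ι : Type*} [Finite ι] {deg : ι → Δ}

theorem exists_homogeneous_generators (Z : Submodule (MvPolynomial τ K) (ι → MvPolynomial τ K))
    (hZ : IsHomSub W deg Z) :
    ∃ (r : ℕ) (deg' : Fin r → Δ) (g : Fin r → ι → MvPolynomial τ K),
      (∀ k, IsHom W deg (g k) (deg' k)) ∧ Submodule.span _ (Set.range g) = Z := by
  classical
  obtain ⟨S, hS⟩ := IsNoetherian.noetherian Z
  choose D hD using exists_finset_comp W deg (K := K)
  let T : Finset (Σ _ : ι → MvPolynomial τ K, Δ) := S.sigma D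
  refine ⟨T.card, fun k => (T.equivFin.symm k).1.2,
    fun k => comp W deg (T.equivFin.symm k).1.2 (T.equivFin.symm k).1.1,
    fun k => comp_isHom _ _ _, le_antisymm ?_ ?_⟩
  · rw [Submodule.span_le]
    rintro _ ⟨k, rfl⟩
    have := Finset.mem_sigma.1 (T.equivFin.symm k).2
    exact hZ _ (hS ▸ Submodule.subset_span this.1) _
  · rw [← hS, Submodule.span_le]
    intro v hv
    rw [SetLike.mem_coe, hD v]
    refine Submodule.sum_mem _ fun δ hδ => Submodule.subset_span ?_
    exact ⟨T.equivFin ⟨⟨v, δ⟩, Finset.mem_sigma.2 ⟨hv, hδ⟩⟩, by simp⟩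

/-- A graded submodule of a graded free module has a finite homogeneous generating set all of
whose relations have coefficients in the homogeneous maximal ideal. -/
theorem exists_minimal_generators (hW : ∀ a : τ →₀ ℕ, Finsupp.weight W a = 0 → a = 0)
    (Z : Submodule (MvPolynomial τ K) (ι → MvPolynomial τ K)) (hZ : IsHomSub W deg Z) :
    ∃ (r : ℕ) (deg' : Fin r → Δ) (g : Fin r → ι → MvPolynomial τ K),
      (∀ k, IsHom W deg (g k) (deg' k)) ∧ Submodule.span _ (Set.range g) = Z ∧
      ∀ c : Fin r → MvPolynomial τ K, ∑ k, c k • g k = 0 → ∀ k, constantCoeff (c k) = 0 := by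
  classical
  have hex := exists_homogeneous_generators Z hZ
  obtain ⟨deg', g, hg, hspan⟩ := Nat.find_spec hex
  refine ⟨_, deg', g, hg, hspan, ?_⟩
  have hmin : ∀ r, (∃ (deg' : Fin r → Δ) (g : Fin r → ι → MvPolynomial τ K),
      (∀ k, IsHom W deg (g k) (deg' k)) ∧ Submodule.span _ (Set.range g) = Z) →
      Nat.find hex ≤ r := fun r h => Nat.find_min' hex h
  generalize Nat.find hex = r at *
  intro c hc k
  by_contra hk
  rcases r with _ | r
  · exact k.elim0
  -- The number of generators is the smallest possible. In the component of degree `deg' k` of the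
  -- relation, the coefficient of `g k` reduces to its constant term, since by `hW` and cancellation
  -- only the monomial 1 preserves the degree. If that constant is nonzero, `g k` is redundant.
  have h1 := congrArg (comp W deg (deg' k)) hc
  rw [comp_sum, comp_zero] at h1
  simp only [fun l => (hg l).comp_smul (deg' k) (c l)] at h1
  have h2 : restr {a | Finsupp.weight W a + deg' k = deg' k} (c k) = C (constantCoeff (c k)) := by
    ext a
    rw [coeff_restr, coeff_C]
    by_cases ha : a = 0
    · simp [ha, constantCoeff_eq]
    · rw [if_neg, if_neg (Ne.symm ha)]
      intro h
      exact ha (hW a (by simpa using h))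
  rw [Fin.sum_univ_succAbove _ k, h2] at h1
  have h3 : g k ∈ Submodule.span (MvPolynomial τ K) (Set.range (g ∘ k.succAbove)) := by
    have h4 : (C (constantCoeff (c k)) : MvPolynomial τ K) • g k ∈
        Submodule.span (MvPolynomial τ K) (Set.range (g ∘ k.succAbove)) := by
      rw [eq_neg_of_add_eq_zero_left h1]
      exact Submodule.neg_mem _ (Submodule.sum_mem _ fun l _ =>
        Submodule.smul_mem _ _ (Submodule.subset_span ⟨l, rfl⟩))
    have h5 := Submodule.smul_mem _ (C (constantCoeff (c k))⁻¹ : MvPolynomial τ K) h4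
    rwa [smul_smul, ← C_mul, inv_mul_cancel₀ hk, C_1, one_smul] at h5
  have := hmin r ⟨deg' ∘ k.succAbove, g ∘ k.succAbove, fun l => hg _, by
    rw [← hspan]
    refine le_antisymm (Submodule.span_mono (Set.range_comp_subset_range _ _)) ?_
    rw [Submodule.span_le]
    rintro _ ⟨l, rfl⟩
    rcases eq_or_ne l k with rfl | hl
    · exact h3
    · obtain ⟨m, rfl⟩ := Fin.exists_succAbove_eq hl
      exact Submodule.subset_span ⟨m, rfl⟩⟩
  omega

end Existence

/-! ### Comparison of graded resolutions. -/

section Resolutions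

variable {K : Type*} [Field K] {τ : Type*} {Δ : Type*} [AddCommMonoid Δ]

/-- The elements of the free module of rank one with entry in `J`. -/
def idealSub (J : Ideal (MvPolynomial τ K)) {ι : Type*} (k : ι) :
    Submodule (MvPolynomial τ K) (ι → MvPolynomial τ K) :=
  Submodule.comap (LinearMap.proj k : (ι → MvPolynomial τ K) →ₗ[MvPolynomial τ K] _) J

@[simp] theorem mem_idealSub (J : Ideal (MvPolynomial τ K)) {ι : Type*} (k : ι)
    (v : ι → MvPolynomial τ K) : v ∈ idealSub J k ↔ v k ∈ J := Iff.rfl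

/-- `J` is homogeneous for the grading with weights `W`. -/
def IsHomIdeal (W : τ → Δ) (J : Ideal (MvPolynomial τ K)) : Prop :=
  IsHomSub W (fun _ : Unit => 0) (idealSub J ())

/-- A graded free resolution of `R / J`, not necessarily minimal, with an augmentation lifted to
`R`. -/
structure GradedRes (W : τ → Δ) (J : Ideal (MvPolynomial τ K)) where
  /-- the ranks -/
  rank : ℕ → ℕ
  /-- the degrees of the basis vectors -/
  deg : ∀ i, Fin (rank i) → Δ
  /-- the lifted augmentation -/
  aug : (Fin (rank 0) → MvPolynomial τ K) →ₗ[MvPolynomial τ K] (Unit → MvPolynomial τ K)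
  /-- the differentials -/
  d : ∀ i, (Fin (rank (i + 1)) → MvPolynomial τ K) →ₗ[MvPolynomial τ K]
    (Fin (rank i) → MvPolynomial τ K)
  aug_hom : IsHomMap W (deg 0) (fun _ => 0) aug
  d_hom : ∀ i, IsHomMap W (deg (i + 1)) (deg i) (d i)
  aug_surj : ∀ r, ∃ v, aug v - r ∈ idealSub J ()
  exact_zero : ∀ v, v ∈ LinearMap.range (d 0) ↔ aug v ∈ idealSub J ()
  exact_succ : ∀ i, Function.Exact (d (i + 1)) (d i)

namespace GradedRes

variable {W : τ → Δ} {J : Ideal (MvPolynomial τ K)}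

/-- Minimality at degree `j` of the differential leaving the `i`-th module. -/
def NoConstOut (F : GradedRes W J) (j : Δ) : ℕ → Prop
  | 0 => True
  | i + 1 => ∀ k, F.deg (i + 1) k = j → ∀ l, constantCoeff (F.d i (Pi.single k 1) l) = 0

/-- Minimality at degree `j` of the differential entering the `i`-th module. -/
def NoConstIn (F : GradedRes W J) (j : Δ) (i : ℕ) : Prop :=
  ∀ k, F.deg i k = j → ∀ m, constantCoeff (F.d i (Pi.single m 1) k) = 0

/-- The comparison theorem, with each chosen preimage of a basis vector replaced by its component of
the right degree. For the augmentation this needs J to be homogeneous. -/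
theorem exists_chainMap (hJ : IsHomIdeal W J) (F G : GradedRes W J) :
    ∃ α : ∀ i, (Fin (F.rank i) → MvPolynomial τ K) →ₗ[MvPolynomial τ K]
        (Fin (G.rank i) → MvPolynomial τ K),
      (∀ i, IsHomMap W (F.deg i) (G.deg i) (α i)) ∧
      (∀ v, G.aug (α 0 v) - F.aug v ∈ idealSub J ()) ∧
      ∀ i v, G.d i (α (i + 1) v) = α i (F.d i v) := by
  have zero : ∃ α : (Fin (F.rank 0) → MvPolynomial τ K) →ₗ[MvPolynomial τ K]
      (Fin (G.rank 0) → MvPolynomial τ K), IsHomMap W (F.deg 0) (G.deg 0) α ∧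
      ∀ v, G.aug (α v) - F.aug v ∈ idealSub J () := by
    choose g hg using fun k => G.aug_surj (F.aug (Pi.single k 1))
    refine ⟨ofCols fun k => comp W (G.deg 0) (F.deg 0 k) (g k), fun k => ?_, fun v => ?_⟩
    · rw [ofCols_single]
      exact comp_isHom _ _ _
    · rw [ofCols_apply, map_sum, linearMap_apply_eq_sum F.aug v, ← Finset.sum_sub_distrib]
      refine Submodule.sum_mem _ fun k _ => ?_
      rw [map_smul, ← smul_sub, ← G.aug_hom.comp_apply]
      refine Submodule.smul_mem _ _ ?_
      have h := hJ _ (hg k) (F.deg 0 k)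
      rwa [comp_sub, (F.aug_hom k).comp_eq] at h
  have step : ∀ i (α : (Fin (F.rank i) → MvPolynomial τ K) →ₗ[MvPolynomial τ K]
      (Fin (G.rank i) → MvPolynomial τ K)), IsHomMap W (F.deg i) (G.deg i) α →
      (∀ v, α (F.d i v) ∈ LinearMap.range (G.d i)) →
      ∃ β : (Fin (F.rank (i + 1)) → MvPolynomial τ K) →ₗ[MvPolynomial τ K]
        (Fin (G.rank (i + 1)) → MvPolynomial τ K), IsHomMap W (F.deg (i + 1)) (G.deg (i + 1)) β ∧
        ∀ v, G.d i (β v) = α (F.d i v) := by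
    intro i α hα hr
    choose g hg using fun k => hr (Pi.single k 1)
    refine ⟨ofCols fun k => comp W (G.deg (i + 1)) (F.deg (i + 1) k) (g k), fun k => ?_,
      fun v => ?_⟩
    · rw [ofCols_single]
      exact comp_isHom _ _ _
    · rw [ofCols_apply, map_sum, linearMap_apply_eq_sum (F.d i) v, map_sum]
      refine Finset.sum_congr rfl fun k _ => ?_
      rw [map_smul, map_smul, ← (G.d_hom i).comp_apply, hg,
        (hα.isHom (F.d_hom i k)).comp_eq]
  choose! s hs1 hs2 using step
  obtain ⟨α₀, hα₀, hα₀'⟩ := zero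
  let seq : ∀ i, {α : (Fin (F.rank i) → MvPolynomial τ K) →ₗ[MvPolynomial τ K]
      (Fin (G.rank i) → MvPolynomial τ K) // IsHomMap W (F.deg i) (G.deg i) α ∧
      ∀ v, α (F.d i v) ∈ LinearMap.range (G.d i)} := fun i =>
    Nat.rec ⟨α₀, hα₀, fun v => by
      rw [G.exact_zero]
      have h := hα₀' (F.d 0 v)
      exact (Submodule.sub_mem_iff_left _ ((F.exact_zero _).1 ⟨v, rfl⟩)).1 h⟩
    (fun i α => ⟨s i α.1, hs1 i α.1 α.2.1 α.2.2, fun v => (G.exact_succ i _).1 (by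
      rw [hs2 i α.1 α.2.1 α.2.2, (F.exact_succ i).apply_apply_eq_zero, map_zero])⟩) i
  exact ⟨fun i => (seq i).1, fun i => (seq i).2.1, hα₀',
    fun i v => hs2 i (seq i).1 (seq i).2.1 (seq i).2.2 v⟩

/-- The graded Betti numbers of a free resolution. -/
def bettiNum [DecidableEq Δ] (F : GradedRes W J) (i : ℕ) (j : Δ) : ℕ :=
  Fintype.card {k : Fin (F.rank i) // F.deg i k = j}

theorem constantCoeff_linearMap_apply {ι κ : Type*} [Fintype ι] [DecidableEq ι]
    (f : (ι → MvPolynomial τ K) →ₗ[MvPolynomial τ K] (κ → MvPolynomial τ K))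
    (v : ι → MvPolynomial τ K) (k : κ) :
    constantCoeff (f v k) =
      ∑ l, constantCoeff (v l) * constantCoeff (f (Pi.single l 1) k) := by
  rw [linearMap_apply_eq_sum f v, Finset.sum_apply, map_sum]
  refine Finset.sum_congr rfl fun l _ => ?_
  rw [Pi.smul_apply, smul_eq_mul, map_mul]

theorem constantCoeff_eq_zero_of_ne {ι κ : Type*} [DecidableEq ι]
    {deg : ι → Δ} {degκ : κ → Δ}
    {f : (ι → MvPolynomial τ K) →ₗ[MvPolynomial τ K] (κ → MvPolynomial τ K)}
    (hf : IsHomMap W deg degκ f) {k : ι} {l : κ} (h : degκ l ≠ deg k) :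
    constantCoeff (f (Pi.single k 1) l) = 0 := by
  by_contra h0
  have := hf k l 0 h0
  rw [map_zero, zero_add] at this
  exact h this

/-- The number of basis vectors of degree `j` around which the differentials of a resolution are
minimal is at most the corresponding number for any other resolution. -/
theorem bettiNum_le [DecidableEq Δ] (hJ : IsHomIdeal W J) (F G : GradedRes W J) (i : ℕ) (j : Δ)
    (hin : F.NoConstIn j i) (hout : F.NoConstOut j i) : F.bettiNum i j ≤ G.bettiNum i j := by
  obtain ⟨α, hα, hα0, hαd⟩ := exists_chainMap hJ F G
  obtain ⟨β, hβ, hβ0, hβd⟩ := exists_chainMap hJ G F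
  obtain ⟨h, h0, hh⟩ := exists_homotopy (F := fun i => Fin (F.rank i) → MvPolynomial τ K)
    (G := fun i => Fin (F.rank i) → MvPolynomial τ K) F.d F.d
    (fun i v => (F.exact_succ i).apply_apply_eq_zero v) F.exact_succ
    (fun i => β i ∘ₗ α i - LinearMap.id)
    (fun i v => by simp [hαd, hβd])
    (fun v => by
      rw [F.exact_zero]
      have := Submodule.add_mem _ (hβ0 (α 0 v)) (hα0 v)
      simpa using this)
  -- β∘α - id equals dh + hd. In degree `j`, `hin` kills the constant terms of dh and `hout` those
  -- of hd, so the constant terms of β∘α form the identity matrix.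
  have key : ∀ k k' : {k : Fin (F.rank i) // F.deg i k = j},
      constantCoeff (β i (α i (Pi.single k'.1 1)) k.1) = if k = k' then 1 else 0 := by
    rintro ⟨k, hk⟩ ⟨k', hk'⟩
    have hone : constantCoeff ((Pi.single k' 1 : Fin (F.rank i) → MvPolynomial τ K) k) =
        if (⟨k, hk⟩ : {k : Fin (F.rank i) // F.deg i k = j}) = ⟨k', hk'⟩ then (1 : K) else 0 := by
      rw [Pi.single_apply]
      simp only [Subtype.mk.injEq]
      split_ifs <;> simp
    rw [← hone, ← sub_eq_zero, ← map_sub]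
    have h1 : ∀ w, constantCoeff (F.d i w k) = 0 := fun w => by
      rw [constantCoeff_linearMap_apply]
      exact Finset.sum_eq_zero fun m _ => by rw [hin k hk m, mul_zero]
    cases i with
    | zero =>
      have := congrFun (h0 (Pi.single k' 1)) k
      simp only [LinearMap.sub_apply, LinearMap.comp_apply, LinearMap.id_apply,
        Pi.sub_apply] at this
      rw [this]
      exact h1 _
    | succ i =>
      have := congrFun (hh i (Pi.single k' 1)) k
      simp only [LinearMap.sub_apply, LinearMap.comp_apply, LinearMap.id_apply,
        Pi.sub_apply, Pi.add_apply] at this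
      rw [this, map_add, h1, zero_add, constantCoeff_linearMap_apply]
      exact Finset.sum_eq_zero fun l _ => by rw [hout k' hk' l, zero_mul]
  let A : Matrix {l : Fin (G.rank i) // G.deg i l = j} {k : Fin (F.rank i) // F.deg i k = j} K :=
    Matrix.of fun l k => constantCoeff (α i (Pi.single k.1 1) l.1)
  let B : Matrix {k : Fin (F.rank i) // F.deg i k = j} {l : Fin (G.rank i) // G.deg i l = j} K :=
    Matrix.of fun k l => constantCoeff (β i (Pi.single l.1 1) k.1)
  -- A homogeneous map has constant entries only between basis vectors of equal degree, so the
  -- constant part of the composition factors through the degree `j` basis vectors of G.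
  have hBA : B * A = 1 := by
    ext k k'
    rw [Matrix.mul_apply, Matrix.one_apply, ← key, constantCoeff_linearMap_apply]
    let f : Fin (G.rank i) → K := fun l => constantCoeff (α i (Pi.single k'.1 1) l) *
      constantCoeff (β i (Pi.single l 1) k.1)
    trans ∑ l ∈ Finset.univ.filter (fun l => G.deg i l = j), f l
    · rw [Finset.sum_subtype (p := fun l => G.deg i l = j) _ (by simp) f]
      exact Finset.sum_congr rfl fun l _ => mul_comm _ _
    · refine Finset.sum_filter_of_ne fun l _ hl => ?_
      by_contra hne
      refine hl ?_
      simp only [f]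
      rw [constantCoeff_eq_zero_of_ne (hα i) (by rw [k'.2]; exact hne), zero_mul]
  have hinj : Function.Injective (Matrix.mulVecLin A) := by
    intro v w hvw
    have := congrArg (Matrix.mulVecLin B) hvw
    simpa [Matrix.mulVec_mulVec, hBA] using this
  have := LinearMap.finrank_le_finrank_of_injective hinj
  simpa [bettiNum] using this

end GradedRes

end Resolutions

/-! ### Existence of minimal graded resolutions by iterated syzygies. -/

section Existence

variable {K : Type*} [Field K] {τ : Type*} [Finite τ] {Δ : Type*} [AddCommMonoid Δ]
  [IsCancelAdd Δ] (W : τ → Δ)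

/-- A graded submodule, contained in the homogeneous maximal ideal, of a graded free module. -/
structure SyzygyModule (K : Type*) [Field K] where
  /-- the rank -/
  r : ℕ
  /-- the degrees of the basis vectors -/
  deg : Fin r → Δ
  /-- the submodule -/
  Z : Submodule (MvPolynomial τ K) (Fin r → MvPolynomial τ K)
  hom : IsHomSub W deg Z
  const : ∀ v ∈ Z, ∀ k, constantCoeff (v k) = 0

variable {W}

theorem SyzygyModule.exists_next (hW : ∀ a : τ →₀ ℕ, Finsupp.weight W a = 0 → a = 0)
    (S : SyzygyModule W K) : ∃ (S' : SyzygyModule W K)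
      (d : (Fin S'.r → MvPolynomial τ K) →ₗ[MvPolynomial τ K] (Fin S.r → MvPolynomial τ K)),
      IsHomMap W S'.deg S.deg d ∧ LinearMap.range d = S.Z ∧ LinearMap.ker d = S'.Z := by
  obtain ⟨r, deg', g, hg, hspan, hmin⟩ := exists_minimal_generators hW S.Z S.hom
  have hhom : IsHomMap W deg' S.deg (ofCols g) := fun k => by
    rw [ofCols_single]
    exact hg k
  exact ⟨⟨r, deg', LinearMap.ker (ofCols g), hhom.isHomSub_ker, fun v hv => hmin v hv⟩, ofCols g,
    hhom, by rw [range_ofCols, hspan], rfl⟩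

theorem exists_minimal_gradedRes (hW : ∀ a : τ →₀ ℕ, Finsupp.weight W a = 0 → a = 0)
    (J : Ideal (MvPolynomial τ K)) (hJ : IsHomIdeal W J) (hJ0 : J ≤ RingHom.ker constantCoeff) :
    ∃ F : GradedRes W J, (∀ i v k, constantCoeff (F.d i v k) = 0) ∧
      ∃ k₀, F.deg 0 k₀ = 0 ∧ ∀ v, v ∈ LinearMap.range (F.d 0) ↔ v k₀ ∈ J := by
  choose next d hd hrange hker using
    fun S : SyzygyModule W K => S.exists_next hW
  let init : SyzygyModule W K := ⟨1, fun _ => 0, idealSub J 0, fun v hv δ => by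
    exact hJ (fun _ => v 0) hv δ, fun v hv k => by
    rw [Subsingleton.elim k 0]
    exact hJ0 hv⟩
  let seq : ℕ → SyzygyModule W K := fun i => Nat.rec init (fun _ S => next S) i
  refine ⟨⟨fun i => (seq i).r, fun i => (seq i).deg, LinearMap.funLeft _ _ (fun _ => (0 : Fin 1)),
    fun i => d (seq i), ?_, fun i => hd (seq i), ?_, ?_, ?_⟩, ?_, (0 : Fin 1), rfl, ?_⟩
  · intro k l a h
    exact isHom_single W (fun _ : Fin 1 => (0 : Δ)) k 0 a h
  · intro r
    exact ⟨(fun _ : Fin 1 => r ()), by simp [LinearMap.funLeft_apply]⟩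
  · intro v
    rw [hrange]
    rfl
  · intro i
    rw [LinearMap.exact_iff, hker]
    exact (hrange (next (seq i))).symm
  · intro i v k
    exact (seq i).const _ (hrange (seq i) ▸ ⟨v, rfl⟩) k
  · intro v
    exact iff_of_eq (congrArg (v ∈ ·) (hrange init))

end Existence

/-! ### Regularity read off from a single minimal resolution. -/

section Standard

variable {K : Type*} [Field K] {τ : Type*}

theorem mem_stdPiece_iff {p : MvPolynomial τ K} {z : ℤ} :
    p ∈ stdPiece K τ z ↔ ∀ a, coeff a p ≠ 0 → Finsupp.weight (fun _ : τ => (1 : ℤ)) a = z :=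
  Iff.rfl

theorem isHom_iff_stdPiece {ι : Type*} {deg : ι → ℤ} {v : ι → MvPolynomial τ K} {δ : ℤ} :
    IsHom (fun _ => 1) deg v δ ↔ ∀ l, v l ∈ stdPiece K τ (δ - deg l) := by
  simp only [IsHom, mem_stdPiece_iff, eq_sub_iff_add_eq]

variable {J : Ideal (MvPolynomial τ K)}

/-- A minimal graded free resolution in the sense of `MinGradedFreeRes` from a graded resolution
with a lifted augmentation. -/
def GradedRes.toMin (F : GradedRes (fun _ : τ => (1 : ℤ)) J)
    (hmin : ∀ i v k, constantCoeff (F.d i v k) = 0) :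
    MinGradedFreeRes (K := K) (τ := τ) (quotientPiece J) where
  rank := F.rank
  deg := F.deg
  aug := Submodule.mkQ J ∘ₗ LinearMap.proj () ∘ₗ F.aug
  d := F.d
  aug_homogeneous k := ⟨F.aug (Pi.single k 1) (), by
    simpa using isHom_iff_stdPiece.1 (F.aug_hom k) (), rfl⟩
  d_homogeneous i k := isHom_iff_stdPiece.1 (F.d_hom i k)
  aug_surjective x := by
    obtain ⟨x, rfl⟩ := Submodule.mkQ_surjective J x
    obtain ⟨v, hv⟩ := F.aug_surj (fun _ => x)
    exact ⟨v, (Submodule.Quotient.eq J).2 hv⟩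
  exact_zero v := by
    refine Iff.trans ?_ (F.exact_zero v).symm
    exact Submodule.Quotient.mk_eq_zero J
  exact_succ := F.exact_succ
  minimal i k l := hmin i _ _

theorem MinGradedFreeRes.exists_gradedRes
    (F : MinGradedFreeRes (K := K) (τ := τ) (quotientPiece J)) :
    ∃ G : GradedRes (fun _ : τ => (1 : ℤ)) J, (∀ i v k, constantCoeff (G.d i v k) = 0) ∧
      ∀ i j, G.bettiNum i j = F.betti i j := by
  choose p hp hp' using F.aug_homogeneous
  have haug : ∀ v, Submodule.mkQ J (ofCols (fun k (_ : Unit) => p k) v ()) = F.aug v := by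
    intro v
    rw [linearMap_apply_eq_sum F.aug v, ofCols_apply, Finset.sum_apply, map_sum]
    refine Finset.sum_congr rfl fun k _ => ?_
    rw [Pi.smul_apply, map_smul, ← hp']
    rfl
  refine ⟨⟨F.rank, F.deg, ofCols fun k _ => p k, F.d, fun k => ?_, fun i k => ?_, fun r => ?_,
    fun v => ?_, F.exact_succ⟩, fun i v k => ?_, fun i j => rfl⟩
  · rw [ofCols_single, isHom_iff_stdPiece]
    simpa using hp k
  · exact isHom_iff_stdPiece.2 (F.d_homogeneous i k)
  · obtain ⟨v, hv⟩ := F.aug_surjective (Submodule.mkQ J (r ()))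
    exact ⟨v, (Submodule.Quotient.eq J).1 ((haug v).trans hv)⟩
  · refine (F.exact_zero v).symm.trans ?_
    rw [← haug]
    exact Submodule.Quotient.mk_eq_zero J
  · rw [GradedRes.constantCoeff_linearMap_apply]
    exact Finset.sum_eq_zero fun l _ => by rw [F.minimal, mul_zero]

theorem GradedRes.noConst_of_minimal {Δ : Type*} [AddCommMonoid Δ] {W : τ → Δ}
    (F : GradedRes W J) (hmin : ∀ i v k, constantCoeff (F.d i v k) = 0) (j : Δ) (i : ℕ) :
    F.NoConstIn j i ∧ F.NoConstOut j i := by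
  refine ⟨fun k _ m => hmin _ _ _, ?_⟩
  cases i with
  | zero => trivial
  | succ i => exact fun k _ l => hmin _ _ _

/-- Two minimal resolutions have the same graded Betti numbers, by `GradedRes.bettiNum_le` in both
directions, so one of them decides the regularity. -/
theorem hasRegularity_iff (hJ : IsHomIdeal (fun _ : τ => (1 : ℤ)) J)
    (F : GradedRes (fun _ : τ => (1 : ℤ)) J) (hmin : ∀ i v k, constantCoeff (F.d i v k) = 0)
    (r : ℤ) : HasRegularity K τ (quotientPiece J) r ↔
      IsGreatest {z : ℤ | ∃ (i : ℕ) (j : ℤ), F.bettiNum i j ≠ 0 ∧ z = j - i} r := by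
  have key : ∀ G : MinGradedFreeRes (K := K) (τ := τ) (quotientPiece J), ∀ i j,
      G.betti i j = F.bettiNum i j := by
    intro G i j
    obtain ⟨G', hG', hb⟩ := G.exists_gradedRes
    rw [← hb]
    exact le_antisymm
      (GradedRes.bettiNum_le hJ G' F i j (G'.noConst_of_minimal hG' j i).1
        (G'.noConst_of_minimal hG' j i).2)
      (GradedRes.bettiNum_le hJ F G' i j (F.noConst_of_minimal hmin j i).1
        (F.noConst_of_minimal hmin j i).2)
  constructor
  · rintro ⟨⟨G⟩, h⟩
    have := h G
    simpa only [key] using this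
  · intro h
    refine ⟨⟨F.toMin hmin⟩, fun G => ?_⟩
    simpa only [key] using h

end Standard

/-! ### Transport along a graded isomorphism of polynomial rings. -/

section Transport

variable {K : Type*} [Field K] {τ τ' : Type*}
  (e : MvPolynomial τ K ≃ₐ[K] MvPolynomial τ' K)

/-- Transport of a linear map between free modules along a ring isomorphism. -/
def transMap {κ μ : Type*} (f : (κ → MvPolynomial τ K) →ₗ[MvPolynomial τ K] (μ → MvPolynomial τ K)) :
    (κ → MvPolynomial τ' K) →ₗ[MvPolynomial τ' K] (μ → MvPolynomial τ' K) where
  toFun v m := e (f (fun k => e.symm (v k)) m)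
  map_add' v w := by
    funext m
    have : (fun k => e.symm ((v + w) k)) = (fun k => e.symm (v k)) + fun k => e.symm (w k) := by
      funext k
      simp
    rw [this, map_add]
    simp
  map_smul' r v := by
    funext m
    have : (fun k => e.symm ((r • v) k)) = e.symm r • fun k => e.symm (v k) := by
      funext k
      simp
    rw [this, map_smul]
    simp

theorem transMap_apply {κ μ : Type*}
    (f : (κ → MvPolynomial τ K) →ₗ[MvPolynomial τ K] (μ → MvPolynomial τ K))
    (v : κ → MvPolynomial τ K) :
    transMap e f (fun k => e (v k)) = fun m => e (f v m) := by
  funext m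
  simp [transMap]

theorem exists_eq_comp_symm {κ : Type*} (w : κ → MvPolynomial τ' K) :
    ∃ v : κ → MvPolynomial τ K, w = fun k => e (v k) :=
  ⟨fun k => e.symm (w k), by simp⟩

theorem transMap_single {κ μ : Type*} [DecidableEq κ]
    (f : (κ → MvPolynomial τ K) →ₗ[MvPolynomial τ K] (μ → MvPolynomial τ K)) (k : κ) :
    transMap e f (Pi.single k 1) = fun m => e (f (Pi.single k 1) m) := by
  rw [← transMap_apply]
  congr 1
  funext l
  rcases eq_or_ne l k with rfl | h
  · simp
  · simp [h]

theorem transMap_exact {κ μ ν : Type*}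
    (f : (κ → MvPolynomial τ K) →ₗ[MvPolynomial τ K] (μ → MvPolynomial τ K))
    (g : (μ → MvPolynomial τ K) →ₗ[MvPolynomial τ K] (ν → MvPolynomial τ K))
    (h : Function.Exact f g) : Function.Exact (transMap e f) (transMap e g) := by
  intro w
  obtain ⟨v, rfl⟩ := exists_eq_comp_symm e w
  rw [transMap_apply]
  constructor
  · intro hv
    obtain ⟨u, hu⟩ := (h v).1 (funext fun k => e.injective (by
      rw [Pi.zero_apply, map_zero]; exact congrFun hv k))
    exact ⟨fun k => e (u k), by rw [transMap_apply, hu]⟩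
  · rintro ⟨u, hu⟩
    obtain ⟨u, rfl⟩ := exists_eq_comp_symm e u
    rw [transMap_apply] at hu
    have : v = f u := funext fun k => (e.injective (congrFun hu k)).symm
    rw [this, h.apply_apply_eq_zero]
    funext k
    simp

variable (he : ∀ p z, p ∈ stdPiece K τ z → e p ∈ stdPiece K τ' z)
include he

theorem isHomMap_transMap {κ μ : Type*} [DecidableEq κ] {deg : κ → ℤ} {deg' : μ → ℤ}
    (f : (κ → MvPolynomial τ K) →ₗ[MvPolynomial τ K] (μ → MvPolynomial τ K))
    (hf : IsHomMap (fun _ => 1) deg deg' f) : IsHomMap (fun _ => 1) deg deg' (transMap e f) := by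
  intro k
  rw [transMap_single, isHom_iff_stdPiece]
  exact fun l => he _ _ (isHom_iff_stdPiece.1 (hf k) l)

/-- Transport of a graded resolution along a graded isomorphism of polynomial rings. -/
def GradedRes.transport {J : Ideal (MvPolynomial τ K)} {J' : Ideal (MvPolynomial τ' K)}
    (hJ : ∀ p, e p ∈ J' ↔ p ∈ J) (F : GradedRes (fun _ : τ => (1 : ℤ)) J) :
    GradedRes (fun _ : τ' => (1 : ℤ)) J' where
  rank := F.rank
  deg := F.deg
  aug := transMap e F.aug
  d i := transMap e (F.d i)
  aug_hom := isHomMap_transMap e he _ F.aug_hom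
  d_hom i := isHomMap_transMap e he _ (F.d_hom i)
  aug_surj r := by
    obtain ⟨r, rfl⟩ := exists_eq_comp_symm e r
    obtain ⟨v, hv⟩ := F.aug_surj r
    refine ⟨fun k => e (v k), ?_⟩
    rw [transMap_apply, mem_idealSub, Pi.sub_apply, ← map_sub, hJ]
    exact hv
  exact_zero w := by
    obtain ⟨v, rfl⟩ := exists_eq_comp_symm e w
    rw [transMap_apply, mem_idealSub, hJ, ← mem_idealSub, ← F.exact_zero]
    constructor
    · rintro ⟨u, hu⟩
      obtain ⟨u, rfl⟩ := exists_eq_comp_symm e u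
      rw [transMap_apply] at hu
      exact ⟨u, funext fun k => e.injective (congrFun hu k)⟩
    · rintro ⟨u, rfl⟩
      exact ⟨fun k => e (u k), transMap_apply e _ _⟩
  exact_succ i := transMap_exact e _ _ (F.exact_succ i)

theorem HasRegularity.transport {J : Ideal (MvPolynomial τ K)} {J' : Ideal (MvPolynomial τ' K)}
    (hec : ∀ p, constantCoeff (e p) = constantCoeff p) (hJ : ∀ p, e p ∈ J' ↔ p ∈ J)
    (hhom : IsHomIdeal (fun _ : τ => (1 : ℤ)) J) (hhom' : IsHomIdeal (fun _ : τ' => (1 : ℤ)) J')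
    {r : ℤ} (h : HasRegularity K τ (quotientPiece J) r) :
    HasRegularity K τ' (quotientPiece J') r := by
  obtain ⟨F⟩ := h.1
  obtain ⟨G, hG, -⟩ := F.exists_gradedRes
  rw [hasRegularity_iff hhom G hG] at h
  refine (hasRegularity_iff hhom' (G.transport e he hJ) (fun i w k => ?_) r).2 h
  obtain ⟨v, rfl⟩ := exists_eq_comp_symm e w
  exact (congrArg _ (congrFun (transMap_apply e (G.d i) v) k)).trans ((hec _).trans (hG _ _ _))

end Transport

/-! ### The filtration by weight and leading forms. -/

section Filtration

variable {K : Type*} [Field K] {τ : Type*} {Γ : Type*} [AddCommMonoid Γ] [LinearOrder Γ]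
  (W : τ → Γ) {ι κ : Type*}

/-- All terms of `v` have weighted degree at most `γ`. -/
def FilLE (deg : ι → Γ) (v : ι → MvPolynomial τ K) (γ : Γ) : Prop :=
  ∀ l a, coeff a (v l) ≠ 0 → Finsupp.weight W a + deg l ≤ γ

/-- All terms of `v` have weighted degree less than `γ`. -/
def FilLT (deg : ι → Γ) (v : ι → MvPolynomial τ K) (γ : Γ) : Prop :=
  ∀ l a, coeff a (v l) ≠ 0 → Finsupp.weight W a + deg l < γ

variable {W} {deg : ι → Γ} {degκ : κ → Γ} {v w : ι → MvPolynomial τ K} {γ γ' : Γ}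

theorem IsHom.filLE (h : IsHom W deg v γ) : FilLE W deg v γ := fun l a ha => (h l a ha).le

theorem FilLE.filLT (h : FilLE W deg v γ) (hγ : γ < γ') : FilLT W deg v γ' :=
  fun l a ha => (h l a ha).trans_lt hγ

theorem FilLT.filLE (h : FilLT W deg v γ) : FilLE W deg v γ := fun l a ha => (h l a ha).le

theorem FilLE.mono (h : FilLE W deg v γ) (hγ : γ ≤ γ') : FilLE W deg v γ' :=
  fun l a ha => (h l a ha).trans hγ

theorem FilLE.add (hv : FilLE W deg v γ) (hw : FilLE W deg w γ) : FilLE W deg (v + w) γ := by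
  intro l a h
  rw [Pi.add_apply, coeff_add] at h
  by_cases h1 : coeff a (v l) = 0
  · exact hw l a (by simpa [h1] using h)
  · exact hv l a h1

theorem FilLT.add (hv : FilLT W deg v γ) (hw : FilLT W deg w γ) : FilLT W deg (v + w) γ := by
  intro l a h
  rw [Pi.add_apply, coeff_add] at h
  by_cases h1 : coeff a (v l) = 0
  · exact hw l a (by simpa [h1] using h)
  · exact hv l a h1

theorem FilLT.neg (hv : FilLT W deg v γ) : FilLT W deg (-v) γ :=
  fun l a h => hv l a (by simpa using h)

theorem FilLT.comp_eq_zero (hv : FilLT W deg v γ) : comp W deg γ v = 0 := by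
  classical
  funext l
  ext a
  rw [coeff_comp, Pi.zero_apply, coeff_zero]
  split_ifs with h
  · by_contra h0
    exact (hv l a h0).ne h
  · rfl

theorem FilLE.sub_comp (hv : FilLE W deg v γ) : FilLT W deg (v - comp W deg γ v) γ := by
  classical
  intro l a h
  rw [Pi.sub_apply, coeff_sub, coeff_comp] at h
  split_ifs at h with h1
  · simp at h
  · exact lt_of_le_of_ne (hv l a (by simpa using h)) h1

theorem exists_filLE [Finite ι] (deg : ι → Γ) (v : ι → MvPolynomial τ K) :
    v = 0 ∨ ∃ γ, FilLE W deg v γ ∧ ∃ l a, coeff a (v l) ≠ 0 ∧ Finsupp.weight W a + deg l = γ := by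
  classical
  have := Fintype.ofFinite ι
  let s : Finset Γ := Finset.univ.biUnion fun l =>
    (v l).support.image fun a => Finsupp.weight W a + deg l
  have hs : ∀ l a, coeff a (v l) ≠ 0 → Finsupp.weight W a + deg l ∈ s := fun l a h =>
    Finset.mem_biUnion.2 ⟨l, Finset.mem_univ l, Finset.mem_image.2 ⟨a, mem_support_iff.2 h, rfl⟩⟩
  rcases s.eq_empty_or_nonempty with h | h
  · left
    funext l
    ext a
    by_contra h0
    have := hs l a h0
    simp [h] at this
  · right
    refine ⟨s.max' h, fun l a ha => s.le_max' _ (hs l a ha), ?_⟩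
    obtain ⟨l, -, hl⟩ := Finset.mem_biUnion.1 (s.max'_mem h)
    obtain ⟨a, ha, hla⟩ := Finset.mem_image.1 hl
    exact ⟨l, a, mem_support_iff.1 ha, hla⟩

/-- A strict bound becomes a bound by some smaller weight, which feeds the well-founded induction;
zero has no top weight and is kept apart. -/
theorem FilLT.exists_filLE [Finite ι] (hv : FilLT W deg v γ) :
    v = 0 ∨ ∃ γ' < γ, FilLE W deg v γ' := by
  rcases ReesReg.exists_filLE (W := W) deg v with h | ⟨γ', h, l, a, ha, hla⟩
  · exact Or.inl h
  · exact Or.inr ⟨γ', hla ▸ hv l a ha, h⟩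

variable [IsOrderedCancelAddMonoid Γ] [Fintype ι] [DecidableEq ι]
  {f g : (ι → MvPolynomial τ K) →ₗ[MvPolynomial τ K] (κ → MvPolynomial τ K)}

theorem exists_coeff_ne_zero {l : κ} {a : τ →₀ ℕ} (h : coeff a (f v l) ≠ 0) :
    ∃ k b c, b + c = a ∧ coeff b (v k) ≠ 0 ∧ coeff c (f (Pi.single k 1) l) ≠ 0 := by
  classical
  rw [linearMap_apply_eq_sum f v, Finset.sum_apply, coeff_sum] at h
  obtain ⟨k, -, hk⟩ := Finset.exists_ne_zero_of_sum_ne_zero h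
  rw [Pi.smul_apply, smul_eq_mul, coeff_mul] at hk
  obtain ⟨⟨b, c⟩, hbc, hk⟩ := Finset.exists_ne_zero_of_sum_ne_zero hk
  exact ⟨k, b, c, Finset.HasAntidiagonal.mem_antidiagonal.1 hbc, left_ne_zero_of_mul hk, right_ne_zero_of_mul hk⟩

theorem FilLE.map (hf : ∀ k, FilLE W degκ (f (Pi.single k 1)) (deg k)) (hv : FilLE W deg v γ) :
    FilLE W degκ (f v) γ := by
  intro l a h
  obtain ⟨k, b, c, rfl, hb, hc⟩ := exists_coeff_ne_zero h
  rw [map_add, add_assoc]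
  exact (add_le_add_right (hf k l c hc) _).trans (hv k b hb)

theorem FilLE.map_lt (hf : ∀ k, FilLT W degκ (f (Pi.single k 1)) (deg k)) (hv : FilLE W deg v γ) :
    FilLT W degκ (f v) γ := by
  intro l a h
  obtain ⟨k, b, c, rfl, hb, hc⟩ := exists_coeff_ne_zero h
  rw [map_add, add_assoc]
  exact (add_lt_add_right (hf k l c hc) _).trans_le (hv k b hb)

theorem FilLE.map_of_leading (hg : IsHomMap W deg degκ g)
    (hf : ∀ k, FilLT W degκ ((f - g) (Pi.single k 1)) (deg k)) (hv : FilLE W deg v γ) :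
    FilLE W degκ (f v) γ ∧ comp W degκ γ (f v) = g (comp W deg γ v) := by
  have h1 := hv.map_lt hf
  have h2 : f v = g v + (f - g) v := by simp
  rw [h2]
  refine ⟨(hv.map fun k => (hg k).filLE).add h1.filLE, ?_⟩
  rw [comp_add, h1.comp_eq_zero, add_zero, hg.comp_apply]

end Filtration

/-! ### Lifting one step of a resolution from leading forms. -/

section Lifting

set_option linter.unusedSectionVars false

variable {K : Type*} [Field K] {τ : Type*} {Γ : Type*} [AddCommMonoid Γ] [LinearOrder Γ]
  [IsOrderedCancelAddMonoid Γ] [WellFoundedLT Γ] (W : τ → Γ) {ι κ : Type*}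
  [Fintype ι] [DecidableEq ι] [Fintype κ] [DecidableEq κ]

/-- `Z'` is the module of leading forms of `Z`, compatibly with the standard grading. -/
structure IsLeading (deg : ι → Γ × ℤ)
    (Z Z' : Submodule (MvPolynomial τ K) (ι → MvPolynomial τ K)) : Prop where
  hom : IsHomSub (fun _ => (1 : ℤ)) (fun l => (deg l).2) Z
  comp_mem : ∀ v ∈ Z, ∀ γ, FilLE W (fun l => (deg l).1) v γ →
    comp W (fun l => (deg l).1) γ v ∈ Z'
  exists_lift : ∀ v ∈ Z', ∀ γ z, IsHom W (fun l => (deg l).1) v γ →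
    IsHom (fun _ => (1 : ℤ)) (fun l => (deg l).2) v z →
    ∃ u, FilLT W (fun l => (deg l).1) u γ ∧
      IsHom (fun _ => (1 : ℤ)) (fun l => (deg l).2) u z ∧ v + u ∈ Z

variable {W} {deg : ι → Γ × ℤ} {degκ : κ → Γ × ℤ}

theorem weight_prod_fst (a : τ →₀ ℕ) :
    (Finsupp.weight (fun s => (W s, (1 : ℤ))) a).1 = Finsupp.weight W a := by
  simp [Finsupp.weight_apply, Finsupp.sum, Prod.fst_sum]

theorem weight_prod_snd (a : τ →₀ ℕ) :
    (Finsupp.weight (fun s => (W s, (1 : ℤ))) a).2 = Finsupp.weight (fun _ : τ => (1 : ℤ)) a := by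
  simp [Finsupp.weight_apply, Finsupp.sum, Prod.snd_sum]

theorem IsHom.fst {ι : Type*} {deg : ι → Γ × ℤ} {v : ι → MvPolynomial τ K} {δ : Γ × ℤ}
    (h : IsHom (fun s => (W s, (1 : ℤ))) deg v δ) : IsHom W (fun l => (deg l).1) v δ.1 := by
  intro l a ha
  rw [← weight_prod_fst, ← h l a ha, Prod.fst_add]

theorem IsHom.snd {ι : Type*} {deg : ι → Γ × ℤ} {v : ι → MvPolynomial τ K} {δ : Γ × ℤ}
    (h : IsHom (fun s => (W s, (1 : ℤ))) deg v δ) :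
    IsHom (fun _ => (1 : ℤ)) (fun l => (deg l).2) v δ.2 := by
  intro l a ha
  rw [← weight_prod_snd (W := W), ← h l a ha, Prod.snd_add]

/-- Each column of `g` lies in Z' and is corrected by lower terms to an element of Z; these are the
columns of `f`. The point is strictness (`hstrict`): an element of Z of weight at most γ has a
preimage of weight at most γ, obtained by lifting its leading form and recursing on the remainder.
Strictness gives surjectivity onto Z and also makes ker g the leading forms of ker f, so the
construction can be repeated. -/
theorem IsLeading.exists_lift_map
    {Z Z' : Submodule (MvPolynomial τ K) (κ → MvPolynomial τ K)} (hZ : IsLeading W degκ Z Z')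
    (g : (ι → MvPolynomial τ K) →ₗ[MvPolynomial τ K] (κ → MvPolynomial τ K))
    (hg : IsHomMap (fun s => (W s, (1 : ℤ))) deg degκ g) (hgZ : LinearMap.range g = Z') :
    ∃ f : (ι → MvPolynomial τ K) →ₗ[MvPolynomial τ K] (κ → MvPolynomial τ K),
      IsHomMap (fun _ => (1 : ℤ)) (fun l => (deg l).2) (fun l => (degκ l).2) f ∧
      LinearMap.range f = Z ∧ IsLeading W deg (LinearMap.ker f) (LinearMap.ker g) := by
  have hg1 : IsHomMap W (fun l => (deg l).1) (fun l => (degκ l).1) g := fun k => (hg k).fst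
  have hg2 : IsHomMap (fun _ => (1 : ℤ)) (fun l => (deg l).2) (fun l => (degκ l).2) g :=
    fun k => (hg k).snd
  choose u hu1 hu2 hu3 using fun k => hZ.exists_lift (g (Pi.single k 1)) (hgZ ▸ ⟨_, rfl⟩)
    (deg k).1 (deg k).2 (hg1 k) (hg2 k)
  let f := g + ofCols u
  have hf1 : ∀ k, FilLT W (fun l => (degκ l).1) ((f - g) (Pi.single k 1)) (deg k).1 := fun k => by
    simpa [f, ofCols_single] using hu1 k
  have hf2 : IsHomMap (fun _ => (1 : ℤ)) (fun l => (deg l).2) (fun l => (degκ l).2) f := fun k => by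
    simpa [f, ofCols_single] using (hg2 k).add (hu2 k)
  have hfZ : ∀ v, f v ∈ Z := fun v => by
    rw [linearMap_apply_eq_sum f v]
    refine Submodule.sum_mem _ fun k _ => Submodule.smul_mem _ _ ?_
    simpa [f, ofCols_single] using hu3 k
  have hstrict : ∀ γ, ∀ w ∈ Z, FilLE W (fun l => (degκ l).1) w γ →
      ∃ v, FilLE W (fun l => (deg l).1) v γ ∧ f v = w := by
    intro γ
    induction γ using WellFoundedLT.induction with
    | ind γ ih =>
      intro w hw hwγ
      have h1 := hZ.comp_mem w hw γ hwγ
      rw [← hgZ] at h1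
      obtain ⟨v₀, hv₀⟩ := h1
      have hv₁ : g (comp W (fun l => (deg l).1) γ v₀) = comp W (fun l => (degκ l).1) γ w := by
        rw [← hg1.comp_apply, hv₀, (comp_isHom _ _ _).comp_eq]
      set v₁ := comp W (fun l => (deg l).1) γ v₀ with hv₁'
      have hv₁h : IsHom W (fun l => (deg l).1) v₁ γ := comp_isHom _ _ _
      have h2 : FilLT W (fun l => (degκ l).1) (w - f v₁) γ := by
        have h3 := hv₁h.filLE.map_lt hf1
        have h4 : w - f v₁ = (w - comp W (fun l => (degκ l).1) γ w) + -((f - g) v₁) := by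
          rw [← hv₁, LinearMap.sub_apply]
          abel
        rw [h4]
        exact hwγ.sub_comp.add h3.neg
      rcases h2.exists_filLE with h3 | ⟨γ', hγ', h3⟩
      · exact ⟨v₁, hv₁h.filLE, (sub_eq_zero.1 h3).symm⟩
      · obtain ⟨v₂, hv₂, hv₂'⟩ := ih γ' hγ' _ (Submodule.sub_mem _ hw (hfZ v₁)) h3
        exact ⟨v₁ + v₂, hv₁h.filLE.add (hv₂.mono hγ'.le), by rw [map_add, hv₂']; abel⟩
  refine ⟨f, hf2, le_antisymm ?_ ?_, hf2.isHomSub_ker, ?_, ?_⟩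
  · rintro _ ⟨v, rfl⟩
    exact hfZ v
  · intro w hw
    rcases exists_filLE (W := W) (fun l => (degκ l).1) w with rfl | ⟨γ, hγ, -⟩
    · exact Submodule.zero_mem _
    · obtain ⟨v, -, hv⟩ := hstrict γ w hw hγ
      exact ⟨v, hv⟩
  · intro v hv γ hγ
    rw [LinearMap.mem_ker] at hv ⊢
    rw [← (hγ.map_of_leading hg1 hf1).2, hv, comp_zero]
  · intro v hv γ z hvγ hvz
    rw [LinearMap.mem_ker] at hv
    have h1 := hvγ.filLE.map_lt hf1
    rw [LinearMap.sub_apply, hv, sub_zero] at h1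
    obtain ⟨u, hu, hfu⟩ : ∃ u, FilLT W (fun l => (deg l).1) u γ ∧ f u = f v := by
      rcases h1.exists_filLE with h2 | ⟨γ', hγ', h2⟩
      · exact ⟨0, fun l a h => absurd (by simp) h, by rw [h2, map_zero]⟩
      · obtain ⟨u, hu, hfu⟩ := hstrict γ' _ (hfZ v) h2
        exact ⟨u, hu.filLT hγ', hfu⟩
    -- The preimage `u` of `f v` need not be homogeneous for the standard grading; since `f v` is,
    -- the component of degree `z` of `u` is still a preimage.
    refine ⟨-comp (fun _ => (1 : ℤ)) (fun l => (deg l).2) z u, FilLT.neg ?_,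
      (comp_isHom _ _ _).neg, ?_⟩
    · classical
      intro l a h
      rw [coeff_comp] at h
      exact hu l a (fun h0 => h (by rw [h0, ite_self]))
    · rw [LinearMap.mem_ker, map_add, map_neg, ← hf2.comp_apply, hfu, (hf2.isHom hvz).comp_eq,
        add_neg_cancel]

end Lifting

/-! ### Lifting a whole resolution. -/

section LiftRes

variable {K : Type*} [Field K] {τ : Type*} {Γ : Type*} [AddCommMonoid Γ] [LinearOrder Γ]
  [IsOrderedCancelAddMonoid Γ] [WellFoundedLT Γ] {W : τ → Γ} {J J' : Ideal (MvPolynomial τ K)}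

/-- A bigraded resolution of `R / J'`, where `J'` is the ideal of leading forms of `J`, lifts to a
graded resolution of `R / J` of the same shape. -/
theorem GradedRes.exists_lift (F : GradedRes (fun s => (W s, (1 : ℤ))) J') (k₀ : Fin (F.rank 0))
    (hk₀ : F.deg 0 k₀ = 0) (hF : ∀ v, v ∈ LinearMap.range (F.d 0) ↔ v k₀ ∈ J')
    (hJ : IsLeading W (fun _ : Unit => 0) (idealSub J ()) (idealSub J' ())) :
    ∃ G : GradedRes (fun _ : τ => (1 : ℤ)) J,
      ∀ i j, G.bettiNum i j = Fintype.card {k : Fin (F.rank i) // (F.deg i k).2 = j} := by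
  have step : ∀ i (Z : Submodule (MvPolynomial τ K) (Fin (F.rank i) → MvPolynomial τ K)),
      IsLeading W (F.deg i) Z (LinearMap.range (F.d i)) →
      ∃ f : (Fin (F.rank (i + 1)) → MvPolynomial τ K) →ₗ[MvPolynomial τ K]
        (Fin (F.rank i) → MvPolynomial τ K),
        IsHomMap (fun _ => (1 : ℤ)) (fun l => (F.deg (i + 1) l).2) (fun l => (F.deg i l).2) f ∧
        LinearMap.range f = Z ∧
        IsLeading W (F.deg (i + 1)) (LinearMap.ker f) (LinearMap.range (F.d (i + 1))) := by
    intro i Z hZ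
    obtain ⟨f, h1, h2, h3⟩ := hZ.exists_lift_map (F.d i) (F.d_hom i) rfl
    exact ⟨f, h1, h2, by rwa [← LinearMap.exact_iff.1 (F.exact_succ i)]⟩
  choose! s hs1 hs2 hs3 using step
  have zero : IsLeading W (F.deg 0) (idealSub J k₀) (LinearMap.range (F.d 0)) := by
    have hr : LinearMap.range (F.d 0) = idealSub J' k₀ := by
      ext v
      exact hF v
    rw [hr]
    refine ⟨fun v hv δ => ?_, fun v hv γ hγ => ?_, fun v hv γ z h1 h2 => ?_⟩
    · have := hJ.hom (fun _ => v k₀) hv δ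
      simpa [comp, hk₀] using this
    · have := hJ.comp_mem (fun _ => v k₀) hv γ (fun _ a ha => by
        simpa [hk₀] using hγ k₀ a ha)
      simpa [comp, hk₀] using this
    · obtain ⟨u, hu1, hu2, hu3⟩ := hJ.exists_lift (fun _ => v k₀) hv γ z
        (fun _ a ha => by simpa [hk₀] using h1 k₀ a ha)
        (fun _ a ha => by simpa [hk₀] using h2 k₀ a ha)
      refine ⟨Pi.single k₀ (u ()), fun l a ha => ?_, fun l a ha => ?_, ?_⟩
      · rcases eq_or_ne l k₀ with rfl | hl
        · simpa [hk₀] using hu1 () a (by simpa using ha)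
        · simp [hl] at ha
      · rcases eq_or_ne l k₀ with rfl | hl
        · simpa [hk₀] using hu2 () a (by simpa using ha)
        · simp [hl] at ha
      · simpa using hu3
  let seq : ∀ i, {Z : Submodule (MvPolynomial τ K) (Fin (F.rank i) → MvPolynomial τ K) //
      IsLeading W (F.deg i) Z (LinearMap.range (F.d i))} := fun i =>
    Nat.rec ⟨idealSub J k₀, zero⟩ (fun i Z => ⟨LinearMap.ker (s i Z.1), hs3 i Z.1 Z.2⟩) i
  refine ⟨⟨F.rank, fun i l => (F.deg i l).2, LinearMap.funLeft _ _ (fun _ => k₀),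
    fun i => s i (seq i).1, fun k l a ha => ?_, fun i => hs1 i _ (seq i).2, fun r => ?_,
    fun v => ?_, fun i => ?_⟩, fun i j => rfl⟩
  · rw [LinearMap.funLeft_apply] at ha
    rcases eq_or_ne k₀ k with rfl | hk
    · exact (congrArg (_ + ·) (by simp [hk₀])).trans
        (isHom_single (fun _ => (1 : ℤ)) (fun l => (F.deg 0 l).2) k₀ k₀ a ha)
    · simp [hk] at ha
  · exact ⟨fun _ => r (), by
      rw [mem_idealSub, Pi.sub_apply, LinearMap.funLeft_apply, sub_self]; exact J.zero_mem⟩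
  · rw [hs2 0 _ (seq 0).2]
    rfl
  · rw [LinearMap.exact_iff]
    exact (hs2 (i + 1) _ (seq (i + 1)).2).symm

end LiftRes

/-! ### Regularity of an ideal and of its leading forms. -/

section Regularity

variable {K : Type*} [Field K] {τ : Type*}

theorem weight_one_nonneg (a : τ →₀ ℕ) : 0 ≤ Finsupp.weight (fun _ : τ => (1 : ℤ)) a := by
  simp [Finsupp.weight_apply, Finsupp.sum, Finset.sum_nonneg]

theorem weight_one_eq_zero {a : τ →₀ ℕ} (h : Finsupp.weight (fun _ : τ => (1 : ℤ)) a = 0) :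
    a = 0 := by
  rw [Finsupp.weight_apply, Finsupp.sum, Finset.sum_eq_zero_iff_of_nonneg (by simp)] at h
  ext s
  by_contra hs
  have := h s (Finsupp.mem_support_iff.2 hs)
  simp at this
  exact hs this

variable {Γ : Type*} [AddCommMonoid Γ] {W : τ → Γ} {J J' : Ideal (MvPolynomial τ K)}

theorem weight_prod_eq_zero {a : τ →₀ ℕ}
    (h : Finsupp.weight (fun s => (W s, (1 : ℤ))) a = 0) : a = 0 := by
  apply weight_one_eq_zero
  have := congrArg Prod.snd h
  simpa [Finsupp.weight_apply, Finsupp.sum, Prod.snd_sum] using this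

theorem GradedRes.bettiNum_ne_zero_iff {Δ : Type*} [AddCommMonoid Δ] [DecidableEq Δ] {W : τ → Δ}
    (F : GradedRes W J) (i : ℕ) (j : Δ) : F.bettiNum i j ≠ 0 ↔ ∃ k, F.deg i k = j := by
  rw [GradedRes.bettiNum, ← Nat.pos_iff_ne_zero, Fintype.card_pos_iff]
  simp

theorem GradedRes.noConstIn_of_bettiNum_eq_zero {Δ : Type*} [AddCommMonoid Δ] [DecidableEq Δ]
    {W : τ → Δ} (F : GradedRes W J) (i : ℕ) (j : Δ) (h : F.bettiNum (i + 1) j = 0) :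
    F.NoConstIn j i := by
  intro k hk m
  refine GradedRes.constantCoeff_eq_zero_of_ne (F.d_hom i) fun hne => ?_
  exact (F.bettiNum_ne_zero_iff _ _).2 ⟨m, hne.symm.trans hk⟩ h

theorem GradedRes.noConstOut_of_bettiNum_eq_zero {Δ : Type*} [AddCommMonoid Δ] [DecidableEq Δ]
    {W : τ → Δ} (F : GradedRes W J) (i : ℕ) (j : Δ) (h : ∀ i', i = i' + 1 → F.bettiNum i' j = 0) :
    F.NoConstOut j i := by
  cases i with
  | zero => trivial
  | succ i =>
    intro k hk l
    refine GradedRes.constantCoeff_eq_zero_of_ne (F.d_hom i) fun hne => ?_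
    exact (F.bettiNum_ne_zero_iff _ _).2 ⟨l, hne.trans hk⟩ (h i rfl)

/-- If every basis vector outside of the last module of a minimal resolution occurs in the next
differential, then the regularity is attained at the end of the resolution. -/
theorem exists_degree_bound (F : GradedRes (fun _ : τ => (1 : ℤ)) J)
    (hmin : ∀ i v k, constantCoeff (F.d i v k) = 0) (k₀ : Fin (F.rank 0)) (c : ℕ)
    (hc : ∀ i, i < c → ∀ k, ∃ l, F.d i (Pi.single l 1) k ≠ 0) :
    ∃ T : ℤ, (∃ k, F.deg c k = T) ∧ ∀ i, i ≤ c → ∀ k, F.deg i k - i ≤ T - c := by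
  -- A nonzero entry of a minimal differential has a nonconstant monomial, so the degree grows by at
  -- least one per step and degree minus homological degree cannot fall.
  have next : ∀ i, i < c → ∀ k, ∃ l, F.deg i k + 1 ≤ F.deg (i + 1) l := by
    intro i hi k
    obtain ⟨l, hl⟩ := hc i hi k
    obtain ⟨a, ha⟩ := MvPolynomial.ne_zero_iff.1 hl
    refine ⟨l, ?_⟩
    have h1 := F.d_hom i l k a ha
    have h2 : Finsupp.weight (fun _ : τ => (1 : ℤ)) a ≠ 0 := fun h0 => ha (by
      rw [weight_one_eq_zero h0]
      exact hmin i _ k)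
    have h3 := weight_one_nonneg a
    omega
  have hne : ∀ i, i ≤ c → Nonempty (Fin (F.rank i)) := by
    intro i
    induction i with
    | zero => exact fun _ => ⟨k₀⟩
    | succ i ih =>
      intro hi
      obtain ⟨k⟩ := ih (by omega)
      obtain ⟨l, -⟩ := next i (by omega) k
      exact ⟨l⟩
  have := hne c le_rfl
  obtain ⟨k, hk⟩ := Finite.exists_max (F.deg c)
  have key : ∀ n i, i + n = c → ∀ l, F.deg i l - i ≤ F.deg c k - c := by
    intro n
    induction n with
    | zero =>
      rintro i rfl l
      exact sub_le_sub_right (hk l) _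
    | succ n ih =>
      intro i hi l
      obtain ⟨l', hl'⟩ := next i (by omega) l
      have h1 := ih (i + 1) (by omega) l'
      push_cast at h1
      omega
  exact ⟨F.deg c k, ⟨k, rfl⟩, fun i hi => key (c - i) i (by omega)⟩

variable [LinearOrder Γ] [IsOrderedCancelAddMonoid Γ] [WellFoundedLT Γ] [Finite τ]

/-- The bigraded resolution with its first grading forgotten. -/
def GradedRes.forgetFst (F : GradedRes (fun s => (W s, (1 : ℤ))) J) :
    GradedRes (fun _ : τ => (1 : ℤ)) J where
  rank := F.rank
  deg i l := (F.deg i l).2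
  aug := F.aug
  d := F.d
  aug_hom k := (F.aug_hom k).snd
  d_hom i k := (F.d_hom i k).snd
  aug_surj := F.aug_surj
  exact_zero := F.exact_zero
  exact_succ := F.exact_succ

/-- Regularity does not change under passing to the ideal of leading forms if the regularity of
the latter is attained at the end of the resolution. -/
theorem exists_hasRegularity_of_isLeading
    (hJ : IsLeading W (fun _ : Unit => 0) (idealSub J ()) (idealSub J' ()))
    (hJ0 : J ≤ RingHom.ker constantCoeff)
    (hJ' : IsHomIdeal (fun _ : τ => (1 : ℤ)) J')
    (F : GradedRes (fun s => (W s, (1 : ℤ))) J')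
    (hmin : ∀ i v k, constantCoeff (F.d i v k) = 0) (k₀ : Fin (F.rank 0)) (hk₀ : F.deg 0 k₀ = 0)
    (hF : ∀ v, v ∈ LinearMap.range (F.d 0) ↔ v k₀ ∈ J')
    (c : ℕ) (hc : ∀ i, c < i → IsEmpty (Fin (F.rank i)))
    (hc' : ∀ i, i < c → ∀ k, ∃ l, F.d i (Pi.single l 1) k ≠ 0) :
    ∃ r, HasRegularity K τ (quotientPiece J) r ∧ HasRegularity K τ (quotientPiece J') r := by
  obtain ⟨T, hT, hle⟩ := exists_degree_bound F.forgetFst hmin k₀ c hc'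
  obtain ⟨G, hG⟩ := F.exists_lift k₀ hk₀ hF hJ
  have hG' : ∀ i j, G.bettiNum i j = F.forgetFst.bettiNum i j := hG
  have hhom : IsHomIdeal (fun _ : τ => (1 : ℤ)) J := hJ.hom
  obtain ⟨M, hM, -⟩ := exists_minimal_gradedRes (W := fun _ : τ => (1 : ℤ))
    (fun a => weight_one_eq_zero) J hhom hJ0
  have hup : ∀ i j, F.forgetFst.bettiNum i j ≠ 0 → i ≤ c ∧ j - i ≤ T - c := by
    intro i j h
    obtain ⟨k, rfl⟩ := (F.forgetFst.bettiNum_ne_zero_iff i j).1 h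
    have hi : i ≤ c := by
      by_contra hi
      exact (hc i (by omega)).false k
    exact ⟨hi, hle i hi k⟩
  -- At spot i < c degrees are at most T - (c - i) < T, and beyond `c` nothing remains. So no
  -- constant entry of the differentials of G touches a basis vector of degree T at spot `c`.
  have hzero : ∀ i, i ≠ c → G.bettiNum i T = 0 := by
    intro i hi
    rw [hG']
    by_contra h
    have := hup i T h
    omega
  refine ⟨T - c, ?_, ?_⟩
  · rw [hasRegularity_iff hhom M hM]
    refine ⟨⟨c, T, ?_, rfl⟩, ?_⟩
    · have h1 := GradedRes.bettiNum_le hhom G M c T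
        (G.noConstIn_of_bettiNum_eq_zero c T (hzero _ (by omega)))
        (G.noConstOut_of_bettiNum_eq_zero c T fun i' hi' => hzero i' (by omega))
      have h2 : F.forgetFst.bettiNum c T ≠ 0 := (F.forgetFst.bettiNum_ne_zero_iff c T).2 hT
      rw [hG'] at h1
      omega
    · rintro _ ⟨i, j, hij, rfl⟩
      have h1 := GradedRes.bettiNum_le hhom M G i j (M.noConst_of_minimal hM j i).1
        (M.noConst_of_minimal hM j i).2
      rw [hG'] at h1
      exact (hup i j (by omega)).2
  · rw [hasRegularity_iff hJ' F.forgetFst hmin]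
    refine ⟨⟨c, T, (F.forgetFst.bettiNum_ne_zero_iff c T).2 hT, rfl⟩, ?_⟩
    rintro _ ⟨i, j, hij, rfl⟩
    exact (hup i j hij).2

/-- Regularity does not change under passing to the ideal of leading forms if the latter defines a
Cohen–Macaulay ring. -/
theorem exists_hasRegularity_of_isCohenMacaulay {A : Type*} [CommRing A]
    (hJ : IsLeading W (fun _ : Unit => 0) (idealSub J ()) (idealSub J' ()))
    (hJ0 : J ≤ RingHom.ker constantCoeff) (hJ0' : J' ≤ RingHom.ker constantCoeff)
    (hJ' : IsHomIdeal (fun _ : τ => (1 : ℤ)) J')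
    (hJ'W : IsHomIdeal (fun s => (W s, (1 : ℤ))) J')
    (φ : MvPolynomial τ K →+* A) (hφ : Function.Surjective φ) (hker : RingHom.ker φ = J')
    (hA : IsCohenMacaulay A) :
    ∃ r, HasRegularity K τ (quotientPiece J) r ∧ HasRegularity K τ (quotientPiece J') r := by
  obtain ⟨F, hmin, k₀, hk₀, hF⟩ := exists_minimal_gradedRes (fun a => weight_prod_eq_zero)
    J' hJ'W hJ0'
  have hhom𝔪 : IsHomIdeal (fun _ : τ => (1 : ℤ))
      (RingHom.ker (constantCoeff : MvPolynomial τ K →+* K)) := by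
    classical
    intro v hv δ
    rw [mem_idealSub, RingHom.mem_ker, constantCoeff_eq] at hv ⊢
    rw [coeff_comp, hv, ite_self]
  obtain ⟨G, -, g₀, -, hG⟩ := exists_minimal_gradedRes (W := fun _ : τ => (1 : ℤ))
    (fun a => weight_one_eq_zero) _ hhom𝔪 le_rfl
  obtain ⟨xs, hxs, hxs'⟩ := exists_regOn_ker_constantCoeff (K := K) (τ := τ)
  obtain ⟨c, hc, hc'⟩ := exists_length_of_isCohenMacaulay
    (RingHom.ker (constantCoeff : MvPolynomial τ K →+* K))
    (ιG := fun i => Fin (G.rank i)) (ι := fun i => Fin (F.rank i)) G.d G.exact_succ g₀ hG xs hxs hxs'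
    φ hφ (hker ▸ hJ0') hA F.d F.exact_succ hmin k₀ (by rwa [hker])
  exact exists_hasRegularity_of_isLeading hJ hJ0 hJ' F hmin k₀ hk₀ hF c hc hc'

end Regularity

/-! ### The presentation of the Rees algebra and its gradings. -/

section ReesPresentation

variable {K : Type*} [Field K] {n m : ℕ}

/-- The image of the monomial with exponent `a` under `reesMap f`, up to the power of `t`. -/
def termImage (f : Fin m → MvPolynomial (Fin n) K) (a : Fin n ⊕ Fin m →₀ ℕ) :
    MvPolynomial (Fin n) K :=
  (∏ i, X i ^ a (Sum.inl i)) * ∏ j, f j ^ a (Sum.inr j)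

/-- The degree of a monomial in the variables `t_j`. -/
def tDegree (a : Fin n ⊕ Fin m →₀ ℕ) : ℕ := ∑ j, a (Sum.inr j)

theorem reesMap_monomial (f : Fin m → MvPolynomial (Fin n) K) (a : Fin n ⊕ Fin m →₀ ℕ) (c : K) :
    reesMap f (monomial a c) = Polynomial.monomial (tDegree a) (C c * termImage f a) := by
  rw [reesMap, aeval_monomial, Finsupp.prod_fintype _ _ (fun _ => pow_zero _),
    Fintype.prod_sum_type]
  simp only [Sum.elim_inl, Sum.elim_inr, mul_pow, Finset.prod_mul_distrib, ← map_pow, ← map_prod,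
    Finset.prod_pow_eq_pow_sum]
  rw [← Polynomial.C_mul_X_pow_eq_monomial, termImage, tDegree]
  simp only [map_mul, mul_assoc]
  rfl

theorem coeff_reesMap_monomial (f : Fin m → MvPolynomial (Fin n) K) (a : Fin n ⊕ Fin m →₀ ℕ) (c : K)
    (s : ℕ) : (reesMap f (monomial a c)).coeff s =
      if tDegree a = s then C c * termImage f a else 0 := by
  rw [reesMap_monomial, Polynomial.coeff_monomial]

theorem coeff_reesMap (f : Fin m → MvPolynomial (Fin n) K) (v : MvPolynomial (Fin n ⊕ Fin m) K)
    (s : ℕ) : (reesMap f v).coeff s =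
      ∑ a ∈ v.support, if tDegree a = s then C (coeff a v) * termImage f a else 0 := by
  conv_lhs => rw [v.as_sum, map_sum, Polynomial.finsetSum_coeff]
  simp only [coeff_reesMap_monomial]

theorem mem_reesKer_iff {f : Fin m → MvPolynomial (Fin n) K} {v : MvPolynomial (Fin n ⊕ Fin m) K} :
    v ∈ reesKer f ↔ ∀ s, (reesMap f v).coeff s = 0 := by
  rw [reesKer, RingHom.mem_ker, Polynomial.ext_iff]
  rfl

theorem isWeightedHomogeneous_termImage {Δ : Type*} [AddCommMonoid Δ]
    {f : Fin m → MvPolynomial (Fin n) K} {V : Fin n → Δ} {U : Fin n ⊕ Fin m → Δ} {ε : Δ}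
    (hV : ∀ i, U (Sum.inl i) = V i)
    (hf : ∀ j, IsWeightedHomogeneous V (f j) (U (Sum.inr j) + ε)) (a : Fin n ⊕ Fin m →₀ ℕ) :
    IsWeightedHomogeneous V (termImage f a) (Finsupp.weight U a + tDegree a • ε) := by
  have h := (IsWeightedHomogeneous.prod Finset.univ (fun i => (X i : MvPolynomial (Fin n) K) ^
    a (Sum.inl i)) _ fun i _ => (isWeightedHomogeneous_X K V i).pow (a (Sum.inl i))).mul
    (IsWeightedHomogeneous.prod Finset.univ (fun j => f j ^ a (Sum.inr j)) _
      fun j _ => (hf j).pow (a (Sum.inr j)))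
  refine (congrArg (IsWeightedHomogeneous V (termImage f a)) ?_).mpr h
  rw [Finsupp.weight_apply, Finsupp.sum_fintype _ _ (by simp), Fintype.sum_sum_type, tDegree]
  simp only [hV, smul_add, Finset.sum_add_distrib, Finset.sum_smul, add_assoc]

/-- The map becomes graded if the Rees variable t has degree -ε. To avoid negatives, the coefficient
of t^s is compared in degree δ + sε. -/
theorem isHomIdeal_reesKer {Δ : Type*} [AddCommMonoid Δ] [IsRightCancelAdd Δ]
    {f : Fin m → MvPolynomial (Fin n) K} {V : Fin n → Δ} {U : Fin n ⊕ Fin m → Δ} {ε : Δ}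
    (hV : ∀ i, U (Sum.inl i) = V i)
    (hf : ∀ j, IsWeightedHomogeneous V (f j) (U (Sum.inr j) + ε)) :
    IsHomIdeal U (reesKer f) := by
  classical
  have key : ∀ v δ s, (reesMap f (comp U (fun _ : Unit => 0) δ (fun _ => v) ())).coeff s =
      weightedHomogeneousComponent V (δ + s • ε) ((reesMap f v).coeff s) := by
    intro v δ s
    induction v using MvPolynomial.induction_on' with
    | monomial a c =>
      have ha := isWeightedHomogeneous_termImage (K := K) hV hf a
      rw [coeff_reesMap_monomial]
      by_cases h : Finsupp.weight U a = δ
      · rw [comp, restr_monomial_of_mem (by simpa using h), coeff_reesMap_monomial]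
        split_ifs with hs
        · rw [weightedHomogeneousComponent_C_mul, ← hs, ← h, ha.weightedHomogeneousComponent_same]
        · simp
      · rw [comp, restr_monomial_of_notMem (by simpa using h), map_zero, Polynomial.coeff_zero]
        split_ifs with hs
        · rw [weightedHomogeneousComponent_C_mul, ha.weightedHomogeneousComponent_ne, mul_zero]
          rw [← hs]
          exact fun h' => h (add_right_cancel h').symm
        · simp
    | add p q hp hq =>
      rw [map_add, Polynomial.coeff_add, map_add, ← hp, ← hq, ← Polynomial.coeff_add, ← map_add]
      congr 2
      exact congrFun (comp_add (fun _ : Unit => (0 : Δ)) δ (fun _ => p) (fun _ => q)) ()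
  intro v hv δ
  rw [mem_idealSub, mem_reesKer_iff] at hv ⊢
  intro s
  have h := key (v ()) δ s
  rw [hv s, map_zero] at h
  exact h

theorem isHomIdeal_reesKer_one {f : Fin m → MvPolynomial (Fin n) K} {d : ℕ}
    (hf : ∀ j, (f j).IsHomogeneous d) : IsHomIdeal (fun _ => (1 : ℤ)) (reesKer f) := by
  refine isHomIdeal_reesKer (V := fun _ => 1) (ε := d - 1) (fun _ => rfl) fun j a ha => ?_
  have h := hf j ha
  rw [← h, Finsupp.weight_apply, Finsupp.weight_apply]
  simp [Finsupp.sum]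

/-- The kernel is homogeneous, so it contains the constant term of each of its elements, and the map
is injective on constants. -/
theorem reesKer_le_ker_constantCoeff {f : Fin m → MvPolynomial (Fin n) K} {d : ℕ}
    (hf : ∀ j, (f j).IsHomogeneous d) : reesKer f ≤ RingHom.ker constantCoeff := by
  classical
  intro v hv
  have h := isHomIdeal_reesKer_one hf (fun _ => v) hv 0
  have h' : comp (fun _ => (1 : ℤ)) (fun _ : Unit => 0) 0 (fun _ => v) () =
      C (constantCoeff v) := by
    ext a
    rw [coeff_comp, coeff_C, add_zero]
    by_cases ha : a = 0
    · simp [ha, constantCoeff_eq]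
    · rw [if_neg (fun h0 => ha (weight_one_eq_zero h0)), if_neg (Ne.symm ha)]
  rw [mem_idealSub, h', reesKer, RingHom.mem_ker, reesMap, aeval_C] at h
  exact (map_eq_zero _).1 h

theorem reesMap_rename (f : Fin m → MvPolynomial (Fin n) K) (p : MvPolynomial (Fin n) K) :
    reesMap f (rename Sum.inl p) = Polynomial.C p := by
  rw [reesMap, aeval_rename]
  induction p using MvPolynomial.induction_on with
  | C c => rw [aeval_C]; rfl
  | add p q hp hq => rw [map_add, hp, hq, map_add]
  | mul_X p i hp => rw [map_mul, hp, aeval_X, map_mul]; rfl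

theorem reesMap_mem_reesAlgebra (f : Fin m → MvPolynomial (Fin n) K)
    {I : Ideal (MvPolynomial (Fin n) K)} (hf : ∀ j, f j ∈ I) (v : MvPolynomial (Fin n ⊕ Fin m) K) :
    reesMap f v ∈ reesAlgebra I := by
  induction v using MvPolynomial.induction_on with
  | C c => rw [reesMap, aeval_C]; exact Subalgebra.algebraMap_mem (reesAlgebra I) (C c)
  | add p q hp hq => rw [map_add]; exact add_mem hp hq
  | mul_X p i hp =>
    rw [map_mul]
    refine mul_mem hp ?_
    rw [reesMap, aeval_X]
    cases i with
    | inl i => exact Subalgebra.algebraMap_mem (reesAlgebra I) (X i)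
    | inr j =>
      rw [Sum.elim_inr, Polynomial.C_mul_X_eq_monomial]
      exact reesAlgebra.monomial_mem.2 (by simpa using hf j)

theorem exists_reesMap_eq (f : Fin m → MvPolynomial (Fin n) K)
    {p : Polynomial (MvPolynomial (Fin n) K)} (hp : p ∈ reesAlgebra (Ideal.span (Set.range f))) :
    ∃ v, reesMap f v = p := by
  rw [← adjoin_monomial_eq_reesAlgebra] at hp
  induction hp using Algebra.adjoin_induction with
  | mem p hp =>
    obtain ⟨r, hr, rfl⟩ := hp
    induction hr using Submodule.span_induction with
    | mem r hr =>
      obtain ⟨j, rfl⟩ := hr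
      exact ⟨X (Sum.inr j), by
        rw [reesMap, aeval_X, Sum.elim_inr, Polynomial.C_mul_X_eq_monomial]⟩
    | zero => exact ⟨0, by simp⟩
    | add p q _ _ hp hq =>
      obtain ⟨v, hv⟩ := hp
      obtain ⟨w, hw⟩ := hq
      exact ⟨v + w, by rw [map_add, hv, hw, map_add]⟩
    | smul a p _ hp =>
      obtain ⟨v, hv⟩ := hp
      exact ⟨rename Sum.inl a * v, by
        rw [map_mul, hv, reesMap_rename, LinearMap.map_smul, Polynomial.smul_eq_C_mul]⟩
  | algebraMap r => exact ⟨rename Sum.inl r, reesMap_rename f r⟩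
  | add p q _ _ hp hq =>
    obtain ⟨v, hv⟩ := hp
    obtain ⟨w, hw⟩ := hq
    exact ⟨v + w, by rw [map_add, hv, hw]⟩
  | mul p q _ _ hp hq =>
    obtain ⟨v, hv⟩ := hp
    obtain ⟨w, hw⟩ := hq
    exact ⟨v * w, by rw [map_mul, hv, hw]⟩

end ReesPresentation

/-! ### Leading forms of the Rees ideal, and subduction. -/

section LeadingTerms

variable {K : Type*} [Field K] {n m : ℕ} (σ : MonomialOrder (Fin n))

theorem termImage_ne_zero {f : Fin m → MvPolynomial (Fin n) K} (hf : ∀ j, f j ≠ 0)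
    (a : Fin n ⊕ Fin m →₀ ℕ) : termImage f a ≠ 0 :=
  mul_ne_zero (Finset.prod_ne_zero_iff.2 fun _ _ => pow_ne_zero _ (X_ne_zero _))
    (Finset.prod_ne_zero_iff.2 fun _ _ => pow_ne_zero _ (hf _))

/-- Taking leading terms, as a homomorphism of monoids. -/
def leadingTermHom : MvPolynomial (Fin n) K →* MvPolynomial (Fin n) K where
  toFun := σ.leadingTerm
  map_one' := by simpa using σ.leadingTerm_C (1 : K)
  map_mul' := σ.leadingTerm_mul

theorem leadingTerm_termImage (f : Fin m → MvPolynomial (Fin n) K) (a : Fin n ⊕ Fin m →₀ ℕ) :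
    σ.leadingTerm (termImage f a) = termImage (fun j => σ.leadingTerm (f j)) a := by
  have hX : ∀ i, leadingTermHom σ (X i : MvPolynomial (Fin n) K) = X i :=
    fun i => σ.leadingTerm_monomial _ _
  change leadingTermHom σ _ = _
  simp only [termImage, map_mul, map_prod, map_pow, hX]
  rfl

/-- The weights for which the leading terms of the elements of `reesKer f` are homogeneous. -/
def leadingWeight (f : Fin m → MvPolynomial (Fin n) K) : Fin n ⊕ Fin m → σ.syn :=
  Sum.elim (fun i => σ.toSyn (Finsupp.single i 1)) (fun j => σ.toSyn (σ.degree (f j)))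

theorem toSyn_degree_termImage {f : Fin m → MvPolynomial (Fin n) K} (hf : ∀ j, f j ≠ 0)
    (a : Fin n ⊕ Fin m →₀ ℕ) :
    σ.toSyn (σ.degree (termImage f a)) = Finsupp.weight (leadingWeight σ f) a := by
  have h := termImage_ne_zero hf a
  rw [termImage] at h ⊢
  rw [σ.degree_mul (left_ne_zero_of_mul h) (right_ne_zero_of_mul h),
    σ.degree_prod fun _ _ => pow_ne_zero _ (X_ne_zero _),
    σ.degree_prod fun _ _ => pow_ne_zero _ (hf _), Finsupp.weight_apply,
    Finsupp.sum_fintype _ _ (by simp), Fintype.sum_sum_type]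
  simp only [σ.degree_pow, σ.degree_X, map_add, map_sum, map_nsmul, leadingWeight, Sum.elim_inl,
    Sum.elim_inr]

theorem monomial_coeff_eq_ite {p : MvPolynomial (Fin n) K} (b : Fin n →₀ ℕ)
    (h : σ.toSyn (σ.degree p) ≤ σ.toSyn b) :
    monomial b (coeff b p) = if σ.toSyn (σ.degree p) = σ.toSyn b then σ.leadingTerm p else 0 := by
  split_ifs with h1
  · rw [← σ.toSyn.injective h1]
    rfl
  · rw [σ.coeff_eq_zero_of_lt (lt_of_le_of_ne h h1), monomial_zero]

/-- A monomial of weight σ(b) maps to a polynomial with leading exponent `b`, and lighter ones do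
not reach `b`. So the terms at x^b in the image of v come from leading terms of images of its
heaviest monomials only. In particular leading forms of kernel elements lie in the kernel for the
leading terms. -/
theorem reesMap_comp_leadingWeight {f : Fin m → MvPolynomial (Fin n) K} (hf : ∀ j, f j ≠ 0)
    {v : MvPolynomial (Fin n ⊕ Fin m) K} (b : Fin n →₀ ℕ)
    (hv : ∀ a, coeff a v ≠ 0 → Finsupp.weight (leadingWeight σ f) a ≤ σ.toSyn b) (s : ℕ) :
    (reesMap (fun j => σ.leadingTerm (f j))
      (restr {a | Finsupp.weight (leadingWeight σ f) a = σ.toSyn b} v)).coeff s =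
      monomial b (coeff b ((reesMap f v).coeff s)) := by
  classical
  rw [restr, map_sum, Polynomial.finsetSum_coeff, Finset.sum_filter, coeff_reesMap, coeff_sum,
    map_sum]
  refine Finset.sum_congr rfl fun a ha => ?_
  have h := hv a (mem_support_iff.1 ha)
  rw [← toSyn_degree_termImage σ hf] at h
  rw [coeff_reesMap_monomial]
  split_ifs with h1 h2 h2
  · rw [coeff_C_mul, ← C_mul_monomial, monomial_coeff_eq_ite σ b h, toSyn_degree_termImage σ hf,
      if_pos (Set.mem_ofPred.1 h1), leadingTerm_termImage]
  · simp
  · rw [coeff_C_mul, ← C_mul_monomial, monomial_coeff_eq_ite σ b h, toSyn_degree_termImage σ hf,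
      if_neg (fun h' => h1 (Set.mem_ofPred.2 h')), mul_zero]
  · simp

/-- Lifting to the Rees algebra without increasing the degree. -/
theorem exists_reesMap_eq_monomial {f : Fin m → MvPolynomial (Fin n) K} (hf : ∀ j, f j ≠ 0) (s : ℕ)
    (N : Ideal (MvPolynomial (Fin n) K)) (hN : ∀ a, tDegree a = s → termImage f a ∈ N)
    (hlead : ∀ g ∈ N, g ≠ 0 → ∃ a, tDegree a = s ∧ σ.degree (termImage f a) = σ.degree g)
    (δ : σ.syn) : ∀ g ∈ N, (∀ b ∈ g.support, σ.toSyn b ≤ δ) →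
      ∃ u, FilLE (leadingWeight σ f) (fun _ : Unit => 0) (fun _ => u) δ ∧
        reesMap f u = Polynomial.monomial s g := by
  classical
  induction δ using WellFoundedLT.induction with
  | ind δ ih =>
  intro g hg hδ
  by_cases hg0 : g = 0
  · exact ⟨0, fun _ _ h => absurd (by simp) h, by simp [hg0]⟩
  obtain ⟨a, ha, hag⟩ := hlead g hg hg0
  have hlc : σ.leadingCoeff (termImage f a) ≠ 0 :=
    σ.leadingCoeff_ne_zero_iff.2 (termImage_ne_zero hf a)
  -- One step of subduction: `c` makes the leading terms cancel, and the difference stays in `N`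
  -- with a smaller leading exponent.
  obtain ⟨c, hc⟩ : ∃ c, c * σ.leadingCoeff (termImage f a) = σ.leadingCoeff g :=
    ⟨_, div_mul_cancel₀ _ hlc⟩
  have hle : σ.toSyn (σ.degree g) ≤ δ := hδ _ (σ.degree_mem_support hg0)
  have hwa : Finsupp.weight (leadingWeight σ f) a ≤ δ := by
    rw [← toSyn_degree_termImage σ hf, hag]
    exact hle
  have hmon : FilLE (leadingWeight σ f) (fun _ : Unit => 0) (fun _ => monomial a c) δ := by
    intro _ b hb
    rw [coeff_monomial] at hb
    rw [add_zero]
    have : a = b := by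
      by_contra h
      exact hb (if_neg h)
    exact this ▸ hwa
  have hsub : ∀ b ∈ (g - C c * termImage f a).support, σ.toSyn b < σ.toSyn (σ.degree g) := by
    intro b hb
    have hb' := mem_support_iff.1 hb
    rw [coeff_sub, coeff_C_mul] at hb'
    by_contra hlt
    rcases eq_or_lt_of_le (not_lt.1 hlt) with h | h
    · rw [← σ.toSyn.injective h] at hb'
      refine hb' (sub_eq_zero.2 (hc.symm.trans ?_))
      rw [← hag]
      rfl
    · exact hb' (by rw [σ.coeff_eq_zero_of_lt h, σ.coeff_eq_zero_of_lt (hag ▸ h)]; simp)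
  obtain ⟨u, hu, hu'⟩ : ∃ u, FilLE (leadingWeight σ f) (fun _ : Unit => 0) (fun _ => u) δ ∧
      reesMap f u = Polynomial.monomial s (g - C c * termImage f a) := by
    by_cases h0 : g - C c * termImage f a = 0
    · exact ⟨0, fun _ _ h => absurd (by simp) h, by simp [h0]⟩
    have hlt := hsub _ (σ.degree_mem_support h0)
    obtain ⟨u, hu, hu'⟩ := ih _ (hlt.trans_le hle) _
      (N.sub_mem hg (N.mul_mem_left _ (hN a ha))) fun b hb => σ.le_degree hb
    exact ⟨u, hu.mono (hlt.le.trans hle), hu'⟩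
  refine ⟨u + monomial a c, hu.add hmon, ?_⟩
  rw [map_add, hu', reesMap_monomial, ha, ← map_add, sub_add_cancel]

/-- The leading terms of elements of a power of `I` are leading terms of products of the
generators. -/
theorem exists_degree_termImage_eq {f : Fin m → MvPolynomial (Fin n) K}
    {I : Ideal (MvPolynomial (Fin n) K)}
    (hin : initialIdeal σ I = Ideal.span (Set.range fun j => σ.leadingTerm (f j)))
    (hpow : ∀ s : ℕ, 1 ≤ s → initialIdeal σ (I ^ s) = initialIdeal σ I ^ s)
    (s : ℕ) {g : MvPolynomial (Fin n) K} (hg : g ∈ I ^ s) (hg0 : g ≠ 0) :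
    ∃ a : Fin n ⊕ Fin m →₀ ℕ, tDegree a = s ∧ σ.degree (termImage f a) = σ.degree g := by
  classical
  have h : σ.leadingTerm g ∈ initialIdeal σ I ^ s := by
    -- The assumption on powers starts at s = 1; for s = 0 the ideal on the right is the unit ideal.
    rcases Nat.eq_zero_or_pos s with rfl | hs
    · simp
    · rw [← hpow s hs]
      exact Ideal.subset_span ⟨g, hg, rfl⟩
  rw [hin] at h
  obtain ⟨v, hv⟩ := exists_reesMap_eq _ (reesAlgebra.monomial_mem.2 h)
  have h1 := coeff_reesMap (fun j => σ.leadingTerm (f j)) v s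
  rw [hv, Polynomial.coeff_monomial, if_pos rfl] at h1
  have h2 : coeff (σ.degree g) (σ.leadingTerm g) ≠ 0 := by
    rw [MonomialOrder.leadingTerm, coeff_monomial, if_pos rfl]
    exact σ.leadingCoeff_ne_zero_iff.2 hg0
  rw [h1, coeff_sum] at h2
  obtain ⟨a, -, ha⟩ := Finset.exists_ne_zero_of_sum_ne_zero h2
  split_ifs at ha with has
  · refine ⟨a, has, ?_⟩
    rw [coeff_C_mul, ← leadingTerm_termImage, MonomialOrder.leadingTerm, coeff_monomial] at ha
    by_contra hne
    simp [hne] at ha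
  · simp at ha

/-- For the lifting part, let v of weight σ(b) be in the kernel for the leading terms. The top terms
of its image under `reesMap f` cancel, and its coefficient at t^s lies in I^s. Subduction lifts each
coefficient to an element of weight below σ(b); subtracting these lifts from v gives an element of
the kernel for f. -/
theorem isLeading_reesKer {f : Fin m → MvPolynomial (Fin n) K} (hf0 : ∀ j, f j ≠ 0) {d : ℕ}
    (hf : ∀ j, (f j).IsHomogeneous d) {I : Ideal (MvPolynomial (Fin n) K)} (hfI : ∀ j, f j ∈ I)
    (hlead : ∀ s, ∀ g ∈ I ^ s, g ≠ 0 →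
      ∃ a : Fin n ⊕ Fin m →₀ ℕ, tDegree a = s ∧ σ.degree (termImage f a) = σ.degree g) :
    IsLeading (leadingWeight σ f) (fun _ : Unit => 0) (idealSub (reesKer f) ())
      (idealSub (reesKer fun j => σ.leadingTerm (f j)) ()) where
  hom := isHomIdeal_reesKer_one hf
  comp_mem v hv γ hγ := by
    obtain ⟨b, rfl⟩ := σ.toSyn.surjective γ
    rw [mem_idealSub, mem_reesKer_iff] at hv ⊢
    intro s
    have h := reesMap_comp_leadingWeight σ hf0 (v := v ()) b
      (fun a ha => by simpa using hγ () a ha) s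
    rw [hv s, coeff_zero, monomial_zero] at h
    simpa [comp] using h
  exists_lift v hv γ z hγ hz := by
    classical
    obtain ⟨b, rfl⟩ := σ.toSyn.surjective γ
    have hvb : ∀ a, coeff a (v ()) ≠ 0 →
        Finsupp.weight (leadingWeight σ f) a = σ.toSyn b := fun a ha => by
      simpa using hγ () a ha
    rw [mem_idealSub, mem_reesKer_iff] at hv
    have hlt : ∀ s, ∀ e ∈ ((reesMap f (v ())).coeff s).support, σ.toSyn e < σ.toSyn b := by
      intro s e he
      have h := reesMap_comp_leadingWeight σ hf0 (v := v ()) b (fun a ha => (hvb a ha).le) s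
      have h' : restr {a | Finsupp.weight (leadingWeight σ f) a = σ.toSyn b} (v ()) = v () := by
        ext a
        rw [coeff_restr]
        split_ifs with h1
        · rfl
        · by_contra h2
          exact h1 (hvb a (Ne.symm h2))
      rw [h', hv s] at h
      have hb0 : coeff b ((reesMap f (v ())).coeff s) = 0 := (monomial_eq_zero).1 h.symm
      have hle : σ.toSyn e ≤ σ.toSyn b := by
        rw [mem_support_iff, coeff_reesMap, coeff_sum] at he
        obtain ⟨a, ha, hae⟩ := Finset.exists_ne_zero_of_sum_ne_zero he
        split_ifs at hae
        · rw [coeff_C_mul] at hae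
          rw [← hvb a (mem_support_iff.1 ha), ← toSyn_degree_termImage σ hf0]
          exact σ.le_degree (mem_support_iff.2 (right_ne_zero_of_mul hae))
        · simp at hae
      refine lt_of_le_of_ne hle fun h => ?_
      rw [σ.toSyn.injective h] at he
      exact mem_support_iff.1 he hb0
    have hlift : ∀ s, ∃ u, FilLT (leadingWeight σ f) (fun _ : Unit => 0) (fun _ => u) (σ.toSyn b) ∧
        reesMap f u = Polynomial.monomial s ((reesMap f (v ())).coeff s) := by
      intro s
      by_cases h0 : (reesMap f (v ())).coeff s = 0
      · exact ⟨0, fun _ _ h => absurd (by simp) h, by simp [h0]⟩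
      have hmem := reesMap_mem_reesAlgebra f hfI (v ()) s
      obtain ⟨u, hu, hu'⟩ := exists_reesMap_eq_monomial σ hf0 s (I ^ s) (fun a ha => by
        have h1 := reesMap_mem_reesAlgebra f hfI (monomial a 1) s
        rwa [coeff_reesMap_monomial, if_pos ha, C_1, one_mul] at h1) (hlead s) _ _ hmem
        fun e he => σ.le_degree he
      exact ⟨u, hu.filLT (hlt s _ (σ.degree_mem_support h0)), hu'⟩
    choose u hu hu' using hlift
    let w : Unit → MvPolynomial (Fin n ⊕ Fin m) K :=
      fun _ => ∑ s ∈ (reesMap f (v ())).support, u s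
    have hw : FilLT (leadingWeight σ f) (fun _ : Unit => 0) w (σ.toSyn b) := by
      intro l a ha
      rw [coeff_sum] at ha
      obtain ⟨s, -, hs⟩ := Finset.exists_ne_zero_of_sum_ne_zero ha
      exact hu s l a hs
    have hmem : v - w ∈ idealSub (reesKer f) () := by
      rw [mem_idealSub, reesKer, RingHom.mem_ker, Pi.sub_apply, map_sub, map_sum, sub_eq_zero]
      simp only [hu']
      exact Polynomial.as_sum_support _
    refine ⟨-comp (fun _ => (1 : ℤ)) (fun _ : Unit => 0) z w, ?_, ?_, ?_⟩
    · refine FilLT.neg fun l a ha => hw l a fun h0 => ha ?_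
      rw [coeff_comp, h0, ite_self]
    · exact (comp_isHom _ _ _).neg
    · have h := isHomIdeal_reesKer_one hf _ hmem z
      have hz' : IsHom (fun _ => (1 : ℤ)) (fun _ : Unit => (0 : ℤ)) v z := hz
      rw [comp_sub, hz'.comp_eq] at h
      rwa [← sub_eq_add_neg]

theorem isHomIdeal_reesKer_leadingTerm {f : Fin m → MvPolynomial (Fin n) K} (hf0 : ∀ j, f j ≠ 0)
    {d : ℕ} (hf : ∀ j, (f j).IsHomogeneous d) :
    IsHomIdeal (fun s => (leadingWeight σ f s, (1 : ℤ)))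
      (reesKer fun j => σ.leadingTerm (f j)) := by
  classical
  refine isHomIdeal_reesKer (V := fun i => (σ.toSyn (Finsupp.single i 1), (1 : ℤ)))
    (ε := (0, (d : ℤ) - 1)) (fun _ => rfl) fun j => ?_
  rw [MonomialOrder.leadingTerm]
  refine isWeightedHomogeneous_monomial _ _ _ ?_
  have h : Finsupp.weight (1 : Fin n → ℕ) (σ.degree (f j)) = d :=
    hf j (σ.coeff_degree_ne_zero_iff.2 (hf0 j))
  refine Prod.ext ?_ ?_
  · rw [weight_prod_fst, Finsupp.weight_apply]
    simp only [leadingWeight, Sum.elim_inr, Prod.fst_add, add_zero, ← map_nsmul]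
    rw [Finsupp.sum, ← map_sum]
    congr 1
    simpa [Finsupp.sum] using (σ.degree (f j)).sum_single
  · rw [weight_prod_snd, Prod.snd_add, ← h, Finsupp.weight_apply, Finsupp.weight_apply]
    simp [Finsupp.sum]

end LeadingTerms

/-! ### Independence of the minimal generators. -/

section Generators

variable {K : Type*} [Field K] {n m m' d d' : ℕ}

/-- An element of the degree of the generators is a linear combination of them. -/
theorem mem_span_field_of_mem_span {s : Set (MvPolynomial (Fin n) K)}
    (hs : ∀ p ∈ s, p.IsHomogeneous d) {g : MvPolynomial (Fin n) K} (hg : g.IsHomogeneous d)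
    (h : g ∈ Ideal.span s) : g ∈ Submodule.span K s := by
  have key : ∀ p ∈ Ideal.span s, homogeneousComponent d p ∈ Submodule.span K s := by
    intro p hp
    refine Submodule.closure_induction (p := fun p _ => homogeneousComponent d p ∈
      Submodule.span K s) ?_ ?_ ?_ hp
    · simp
    · intro x y _ _ hx hy
      rw [map_add]
      exact add_mem hx hy
    · intro r x hx
      induction r using MvPolynomial.induction_on' with
      | monomial a c =>
        by_cases ha : a = 0
        · subst ha
          rw [smul_eq_mul, ← C_apply, homogeneousComponent_C_mul,
            homogeneousComponent_of_mem (hs x hx), if_pos rfl, ← smul_eq_C_mul]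
          exact Submodule.smul_mem _ _ (Submodule.subset_span hx)
        · rw [smul_eq_mul, homogeneousComponent_of_mem
            ((isHomogeneous_monomial c (n := a.degree) rfl).mul (hs x hx)), if_neg]
          · exact zero_mem _
          · have : a.degree ≠ 0 := fun h => ha ((Finsupp.degree_eq_zero_iff a).1 h)
            omega
      | add p q hp hq =>
        rw [add_smul, map_add]
        exact add_mem hp hq
  have := key g h
  rwa [homogeneousComponent_of_mem hg, if_pos rfl] at this

/-- Nonzero elements of an ideal generated in degree `d` have degree at least `d`. -/
theorem degree_le_of_mem_span {s : Set (MvPolynomial (Fin n) K)}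
    (hs : ∀ p ∈ s, p.IsHomogeneous d) {g : MvPolynomial (Fin n) K} (hg : g.IsHomogeneous d')
    (hg0 : g ≠ 0) (h : g ∈ Ideal.span s) : d ≤ d' := by
  by_contra hlt
  have key : ∀ p ∈ Ideal.span s, homogeneousComponent d' p = 0 := by
    intro p hp
    refine Submodule.closure_induction (p := fun p _ => homogeneousComponent d' p = 0) ?_ ?_ ?_ hp
    · simp
    · intro x y _ _ hx hy
      rw [map_add, hx, hy, add_zero]
    · intro r x hx
      induction r using MvPolynomial.induction_on' with
      | monomial a c =>
        rw [smul_eq_mul, homogeneousComponent_of_mem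
          ((isHomogeneous_monomial c (n := a.degree) rfl).mul (hs x hx)), if_neg (by omega)]
      | add p q hp hq => rw [add_smul, map_add, hp, hq, add_zero]
  refine hg0 ?_
  have := key g h
  rwa [homogeneousComponent_of_mem hg, if_pos rfl] at this

theorem isMinimalEquigenerators_of_linearIndependent {f : Fin m → MvPolynomial (Fin n) K}
    {I : Ideal (MvPolynomial (Fin n) K)} (hf : ∀ j, (f j).IsHomogeneous d)
    (hI : Ideal.span (Set.range f) = I) (hli : LinearIndependent K f) :
    IsMinimalEquigenerators f I := by
  refine ⟨⟨d, hf⟩, hI, fun j hj => ?_⟩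
  have h := mem_span_field_of_mem_span (by rintro _ ⟨i, -, rfl⟩; exact hf i) (hf j) hj
  exact linearIndependent_iff_notMem_span.1 hli j (by
    rwa [Set.compl_eq_univ_sdiff] at h)

theorem IsMinimalEquigenerators.linearIndependent {f : Fin m → MvPolynomial (Fin n) K}
    {I : Ideal (MvPolynomial (Fin n) K)} (hf : IsMinimalEquigenerators f I) :
    LinearIndependent K f := by
  refine linearIndependent_iff_notMem_span.2 fun j hj => hf.2.2 j ?_
  rw [Set.compl_eq_univ_sdiff]
  exact Submodule.span_subset_span K _ _ hj

/-- Each family lies in the ideal generated by the other, so the two degrees agree; a generator of f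
is then a K-linear combination of g. The substitution of the t_j by the transition matrix identifies
the two presentations. -/
theorem IsMinimalEquigenerators.span_le {f : Fin m → MvPolynomial (Fin n) K}
    {g : Fin m' → MvPolynomial (Fin n) K} {I : Ideal (MvPolynomial (Fin n) K)}
    (hf : IsMinimalEquigenerators f I) (hg : IsMinimalEquigenerators g I) :
    Submodule.span K (Set.range f) ≤ Submodule.span K (Set.range g) := by
  obtain ⟨⟨d, hd⟩, hfI, -⟩ := hf
  obtain ⟨⟨d', hd'⟩, hgI, -⟩ := id hg
  rw [Submodule.span_le]
  rintro _ ⟨j, rfl⟩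
  by_cases h0 : f j = 0
  · rw [h0]
    exact zero_mem _
  have hj : f j ∈ Ideal.span (Set.range g) := hgI ▸ hfI ▸ Ideal.subset_span ⟨j, rfl⟩
  have hgr : ∀ p ∈ Set.range g, p.IsHomogeneous d' := by rintro _ ⟨i, rfl⟩; exact hd' i
  have hfr : ∀ p ∈ Set.range f, p.IsHomogeneous d := by rintro _ ⟨i, rfl⟩; exact hd i
  have h1 := degree_le_of_mem_span hgr (hd j) h0 hj
  have hm : 0 < m' := by
    rcases Nat.eq_zero_or_pos m' with rfl | h
    · simp [Set.range_eq_empty] at hj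
      exact absurd hj h0
    · exact h
  have h2 := degree_le_of_mem_span hfr (hd' ⟨0, hm⟩) (hg.linearIndependent.ne_zero _)
    (hfI ▸ hgI ▸ Ideal.subset_span ⟨_, rfl⟩)
  obtain rfl : d = d' := le_antisymm h2 h1
  exact mem_span_field_of_mem_span hgr (hd j) hj

/-- The linear substitution of the variables `t_j` given by a matrix. -/
def linearSubst (A : Fin m → Fin m' → K) :
    MvPolynomial (Fin n ⊕ Fin m) K →ₐ[K] MvPolynomial (Fin n ⊕ Fin m') K :=
  aeval (Sum.elim (fun i => X (Sum.inl i)) (fun j => ∑ k, C (A j k) * X (Sum.inr k)))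

theorem reesMap_linearSubst {A : Fin m → Fin m' → K} {f : Fin m → MvPolynomial (Fin n) K}
    {g : Fin m' → MvPolynomial (Fin n) K} (h : ∀ j, f j = ∑ k, A j k • g k)
    (p : MvPolynomial (Fin n ⊕ Fin m) K) : reesMap g (linearSubst A p) = reesMap f p := by
  have : (reesMap g).comp (linearSubst A) = reesMap f := by
    ext1 s
    cases s with
    | inl i => simp [reesMap, linearSubst]
    | inr j =>
      simp only [reesMap, linearSubst, AlgHom.comp_apply, aeval_X, Sum.elim_inr, map_sum, map_mul,
        h, Finset.sum_mul, smul_eq_C_mul]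
      refine Finset.sum_congr rfl fun k _ => ?_
      rw [← algebraMap_eq, AlgHom.commutes, mul_assoc]
      rfl
  exact DFunLike.congr_fun this p

theorem linearSubst_linearSubst {A : Fin m → Fin m' → K} {B : Fin m' → Fin m → K}
    {f : Fin m → MvPolynomial (Fin n) K} (hf : LinearIndependent K f)
    {g : Fin m' → MvPolynomial (Fin n) K} (hA : ∀ j, f j = ∑ k, A j k • g k)
    (hB : ∀ k, g k = ∑ j, B k j • f j) (p : MvPolynomial (Fin n ⊕ Fin m) K) :
    linearSubst B (linearSubst A p) = p := by
  classical
  have hAB : ∀ i j, ∑ k, A i k * B k j = if i = j then 1 else 0 := by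
    intro i
    have h1 : ∑ j, (∑ k, A i k * B k j - if i = j then 1 else 0) • f j = 0 := by
      simp only [sub_smul, Finset.sum_sub_distrib, Finset.sum_smul, ite_smul, one_smul, zero_smul,
        Finset.sum_ite_eq, Finset.mem_univ, if_true]
      rw [Finset.sum_comm, sub_eq_zero]
      conv_rhs => rw [hA i]
      refine Finset.sum_congr rfl fun k _ => ?_
      rw [hB k, Finset.smul_sum]
      simp only [mul_smul]
    exact fun j => sub_eq_zero.1 (Fintype.linearIndependent_iff.1 hf _ h1 j)
  have : (linearSubst B).comp (linearSubst A) = AlgHom.id K (MvPolynomial (Fin n ⊕ Fin m) K) := by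
    ext1 s
    cases s with
    | inl i => simp [linearSubst]
    | inr i =>
      simp only [linearSubst, AlgHom.comp_apply, aeval_X, Sum.elim_inr, map_sum, map_mul,
        AlgHom.id_apply, algHom_C, algebraMap_eq]
      simp only [Finset.mul_sum, ← mul_assoc, ← map_mul]
      rw [Finset.sum_comm]
      simp only [← Finset.sum_mul, ← map_sum, hAB]
      simp
  exact DFunLike.congr_fun this p

theorem linearSubst_mem_stdPiece (A : Fin m → Fin m' → K) {p : MvPolynomial (Fin n ⊕ Fin m) K}
    {z : ℤ} (hp : p ∈ stdPiece K (Fin n ⊕ Fin m) z) :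
    linearSubst A p ∈ stdPiece K (Fin n ⊕ Fin m') z := by
  rw [p.as_sum, map_sum]
  refine Submodule.sum_mem _ fun a ha => ?_
  rw [linearSubst, aeval_monomial, ← hp (mem_support_iff.1 ha), algebraMap_eq]
  refine IsWeightedHomogeneous.C_mul ?_ _
  rw [Finsupp.weight_apply]
  refine IsWeightedHomogeneous.prod _ _ (fun s => a s • (1 : ℤ)) fun s _ =>
    IsWeightedHomogeneous.pow ?_ _
  cases s with
  | inl i => exact isWeightedHomogeneous_X K _ _
  | inr j =>
    exact IsWeightedHomogeneous.sum _ _ _ fun k _ => (isWeightedHomogeneous_X K _ _).C_mul _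

theorem constantCoeff_linearSubst (A : Fin m → Fin m' → K) (p : MvPolynomial (Fin n ⊕ Fin m) K) :
    constantCoeff (linearSubst A p) = constantCoeff p := by
  induction p using MvPolynomial.induction_on with
  | C c => rw [linearSubst, aeval_C, algebraMap_eq, constantCoeff_C, constantCoeff_C]
  | add p q hp hq => rw [map_add, map_add, hp, hq, map_add]
  | mul_X p s hp =>
    rw [map_mul, map_mul, map_mul, hp]
    cases s <;> simp [linearSubst]

/-- The regularity of the Rees algebra does not depend on the choice of minimal generators. -/
theorem IsMinimalEquigenerators.hasRegularity {f : Fin m → MvPolynomial (Fin n) K}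
    {g : Fin m' → MvPolynomial (Fin n) K} {I : Ideal (MvPolynomial (Fin n) K)}
    (hf : IsMinimalEquigenerators f I) (hg : IsMinimalEquigenerators g I) {r : ℤ}
    (h : HasRegularity K (Fin n ⊕ Fin m) (quotientPiece (reesKer f)) r) :
    HasRegularity K (Fin n ⊕ Fin m') (quotientPiece (reesKer g)) r := by
  have hA : ∀ j, ∃ a : Fin m' → K, f j = ∑ k, a k • g k := fun j => by
    obtain ⟨a, ha⟩ := (Submodule.mem_span_range_iff_exists_fun K).1
      (hf.span_le hg (Submodule.subset_span ⟨j, rfl⟩))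
    exact ⟨a, ha.symm⟩
  have hB : ∀ j, ∃ a : Fin m → K, g j = ∑ k, a k • f k := fun j => by
    obtain ⟨a, ha⟩ := (Submodule.mem_span_range_iff_exists_fun K).1
      (hg.span_le hf (Submodule.subset_span ⟨j, rfl⟩))
    exact ⟨a, ha.symm⟩
  choose A hA using hA
  choose B hB using hB
  let e : MvPolynomial (Fin n ⊕ Fin m) K ≃ₐ[K] MvPolynomial (Fin n ⊕ Fin m') K :=
    AlgEquiv.ofAlgHom (linearSubst A) (linearSubst B)
      (AlgHom.ext fun p => linearSubst_linearSubst hg.linearIndependent hB hA p)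
      (AlgHom.ext fun p => linearSubst_linearSubst hf.linearIndependent hA hB p)
  obtain ⟨d, hd⟩ := hf.1
  obtain ⟨d', hd'⟩ := hg.1
  refine HasRegularity.transport e (fun p z hp => linearSubst_mem_stdPiece A hp)
    (constantCoeff_linearSubst A) (fun p => ?_) (isHomIdeal_reesKer_one hd)
    (isHomIdeal_reesKer_one hd') h
  rw [reesKer, reesKer, RingHom.mem_ker, RingHom.mem_ker, ← reesMap_linearSubst hA p]
  rfl

theorem IsMinimalEquigenerators.hasReesRegularity {f : Fin m → MvPolynomial (Fin n) K}
    {I : Ideal (MvPolynomial (Fin n) K)} (hf : IsMinimalEquigenerators f I) {r : ℤ}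
    (h : HasRegularity K (Fin n ⊕ Fin m) (quotientPiece (reesKer f)) r) :
    HasReesRegularity I r :=
  ⟨⟨m, f, hf⟩, fun _ _ hg => hf.hasRegularity hg h⟩

theorem linearIndependent_of_degree_injective (σ : MonomialOrder (Fin n))
    {f : Fin m → MvPolynomial (Fin n) K} (hf0 : ∀ j, f j ≠ 0)
    (hinj : Function.Injective fun j => σ.degree (f j)) : LinearIndependent K f := by
  classical
  rw [Fintype.linearIndependent_iff]
  intro c hc
  by_contra! hne
  obtain ⟨j, hj, hmax⟩ := (Finset.univ.filter fun j => c j ≠ 0).exists_max_image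
    (fun j => σ.toSyn (σ.degree (f j))) (by simpa [Finset.filter_nonempty_iff] using hne)
  have hj : c j ≠ 0 := by simpa using hj
  have h := congrArg (coeff (σ.degree (f j))) hc
  rw [coeff_sum, Finset.sum_eq_single j, coeff_smul, coeff_zero, smul_eq_mul] at h
  · exact (mul_ne_zero hj (σ.coeff_degree_ne_zero_iff.2 (hf0 j))) h
  · intro i _ hij
    rw [coeff_smul, smul_eq_mul]
    by_cases hi : c i = 0
    · rw [hi, zero_mul]
    · rw [σ.coeff_eq_zero_of_lt, mul_zero]
      refine lt_of_le_of_ne (hmax i (by simpa using hi)) fun h => ?_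
      exact hij (hinj (σ.toSyn.injective h))
  · simp

/-- One polynomial for each leading monomial of a family. -/
theorem exists_subfamily_degree_injective (σ : MonomialOrder (Fin n))
    (f : Fin m → MvPolynomial (Fin n) K) :
    ∃ (k : ℕ) (ρ : Fin k → Fin m), (∀ j, f (ρ j) ≠ 0) ∧
      (Function.Injective fun j => σ.degree (f (ρ j))) ∧
      Ideal.span (Set.range fun j => σ.leadingTerm (f (ρ j))) =
        Ideal.span (Set.range fun j => σ.leadingTerm (f j)) := by
  classical
  let D : Finset (Fin n →₀ ℕ) := (Finset.univ.filter fun j => f j ≠ 0).image fun j => σ.degree (f j)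
  have hD : ∀ δ : D, ∃ j, f j ≠ 0 ∧ σ.degree (f j) = δ := fun δ => by
    obtain ⟨j, hj, h⟩ := Finset.mem_image.1 δ.2
    exact ⟨j, (Finset.mem_filter.1 hj).2, h⟩
  choose τ hτ hτ' using hD
  refine ⟨D.card, fun j => τ (D.equivFin.symm j), fun j => hτ _, fun i j hij => ?_, ?_⟩
  · simp only [hτ'] at hij
    exact D.equivFin.symm.injective (Subtype.ext hij)
  · refine le_antisymm (Ideal.span_mono ?_) (Ideal.span_le.2 ?_)
    · rintro _ ⟨j, rfl⟩
      exact ⟨_, rfl⟩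
    · rintro _ ⟨j, rfl⟩
      by_cases hj : f j = 0
      · simp [hj]
      let δ : D := ⟨σ.degree (f j), by simpa [D] using ⟨j, hj, rfl⟩⟩
      have h1 : σ.leadingTerm (f (τ δ)) ∈
          Ideal.span (Set.range fun i => σ.leadingTerm (f (τ (D.equivFin.symm i)))) :=
        Ideal.subset_span ⟨D.equivFin δ, by simp⟩
      have h2 : σ.leadingTerm (f j) =
          C (σ.leadingCoeff (f j) / σ.leadingCoeff (f (τ δ))) * σ.leadingTerm (f (τ δ)) := by
        rw [MonomialOrder.leadingTerm, MonomialOrder.leadingTerm, C_mul_monomial, hτ' δ,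
          div_mul_cancel₀ _ (σ.leadingCoeff_ne_zero_iff.2 (hτ δ))]
      simp only [SetLike.mem_coe]
      rw [h2]
      exact Ideal.mul_mem_left _ _ h1

end Generators

end ReesReg

end

/-! ### The theorem. -/

theorem theorem3p1 {K : Type*} [Field K] {n m d : ℕ} (σ : MonomialOrder (Fin n))
    (I : Ideal (MvPolynomial (Fin n) K)) (f : Fin m → MvPolynomial (Fin n) K)
    (hf : ∀ j, (f j).IsHomogeneous d)
    (hI : I = Ideal.span (Set.range f))
    (hin : ReesReg.initialIdeal σ I = Ideal.span (Set.range fun j => σ.leadingTerm (f j)))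
    (hpow : ∀ s : ℕ, 1 ≤ s → ReesReg.initialIdeal σ (I ^ s) = ReesReg.initialIdeal σ I ^ s)
    (hCM : ReesReg.IsCohenMacaulay (reesAlgebra (ReesReg.initialIdeal σ I))) :
    ∃ r : ℤ, ReesReg.HasReesRegularity I r ∧
      ReesReg.HasReesRegularity (ReesReg.initialIdeal σ I) r := by
  -- The given generators may be redundant or share leading monomials. After thinning, the g_j and
  -- their leading terms are both linearly independent, hence minimal generating sets of equal size.
  obtain ⟨k, ρ, hg0, hginj, hspan⟩ := ReesReg.exists_subfamily_degree_injective σ f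
  obtain ⟨g, hgρ⟩ : ∃ g : Fin k → MvPolynomial (Fin n) K, g = fun j => f (ρ j) := ⟨_, rfl⟩
  have hg : ∀ j, g j ≠ 0 := fun j => hgρ ▸ hg0 j
  have hinj : Function.Injective fun j => σ.degree (g j) := by rwa [hgρ]
  have hgd : ∀ j, (g j).IsHomogeneous d := fun j => hgρ ▸ hf (ρ j)
  have hgI : ∀ j, g j ∈ I := fun j => by
    rw [hI, hgρ]
    exact Ideal.subset_span ⟨_, rfl⟩
  have hing : ReesReg.initialIdeal σ I = Ideal.span (Set.range fun j => σ.leadingTerm (g j)) := by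
    rw [hin, hgρ, hspan]
  have hlead := fun s p => ReesReg.exists_degree_termImage_eq σ hing hpow s (g := p)
  have hLTd : ∀ j, (σ.leadingTerm (g j)).IsHomogeneous d := fun j =>
    MvPolynomial.isHomogeneous_monomial _ ((Finsupp.degree_eq_weight_one (R := ℕ) ▸
      hgd j (σ.coeff_degree_ne_zero_iff.2 (hg j))))
  have hLT0 : ∀ j, σ.leadingTerm (g j) ≠ 0 := fun j h =>
    hg j ((σ.leadingTerm_eq_zero_iff _).1 h)
  have hgen : Ideal.span (Set.range g) = I := by
    refine le_antisymm (Ideal.span_le.2 ?_) fun p hp => ?_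
    · rintro _ ⟨j, rfl⟩
      exact hgI j
    -- Subduction with s = 1 writes pt as the image of some `u`, so p lies in the ideal generated by
    -- the thinned family.
    · obtain ⟨u, -, hu⟩ := ReesReg.exists_reesMap_eq_monomial σ hg 1 I (fun a ha => by
        have h1 := ReesReg.reesMap_mem_reesAlgebra g hgI (MvPolynomial.monomial a 1) 1
        rwa [ReesReg.coeff_reesMap_monomial, if_pos ha, MvPolynomial.C_1, one_mul, pow_one] at h1)
        (fun q hq => hlead 1 q (by rwa [pow_one])) _ p hp fun b hb => σ.le_degree hb
      have h1 := ReesReg.reesMap_mem_reesAlgebra g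
        (fun j => Ideal.subset_span (Set.mem_range_self j)) u
      rw [hu] at h1
      simpa using reesAlgebra.monomial_mem.1 h1
  have hmin := ReesReg.isMinimalEquigenerators_of_linearIndependent hgd hgen
    (ReesReg.linearIndependent_of_degree_injective σ hg hinj)
  have hmin' := ReesReg.isMinimalEquigenerators_of_linearIndependent hLTd hing.symm
    (ReesReg.linearIndependent_of_degree_injective σ hLT0 (by
      simpa only [σ.degree_leadingTerm] using hinj))
  have hmem : ∀ v, (ReesReg.reesMap fun j => σ.leadingTerm (g j)).toRingHom v ∈
      reesAlgebra (ReesReg.initialIdeal σ I) :=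
    ReesReg.reesMap_mem_reesAlgebra _ fun j => Ideal.subset_span (Set.mem_image_of_mem _ (hgI j))
  let φ := (ReesReg.reesMap fun j => σ.leadingTerm (g j)).toRingHom.codRestrict _ hmem
  have hφ : Function.Surjective φ := by
    rintro ⟨p, hp⟩
    obtain ⟨v, hv⟩ := ReesReg.exists_reesMap_eq (fun j => σ.leadingTerm (g j)) (hing ▸ hp)
    exact ⟨v, Subtype.ext hv⟩
  have hker : RingHom.ker φ = ReesReg.reesKer fun j => σ.leadingTerm (g j) := by
    ext v
    rw [ReesReg.reesKer, RingHom.mem_ker, RingHom.mem_ker, ← Subtype.coe_inj]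
    rfl
  obtain ⟨r, h1, h2⟩ := ReesReg.exists_hasRegularity_of_isCohenMacaulay
    (ReesReg.isLeading_reesKer σ hg hgd hgI hlead) (ReesReg.reesKer_le_ker_constantCoeff hgd)
    (ReesReg.reesKer_le_ker_constantCoeff hLTd) (ReesReg.isHomIdeal_reesKer_one hLTd)
    (ReesReg.isHomIdeal_reesKer_leadingTerm σ hg hgd) φ hφ hker hCM
  exact ⟨r, hmin.hasReesRegularity h1, hmin'.hasReesRegularity h2⟩
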